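/- Let $d,n\ge 1$ and $D\ge 0$ be integers, $0\le s<1$, $\Omega=(0,1)^d$, let $\Gamma\in\mathbb R^{D\times D}$ be symmetric positive definite, and let $B\ge 0$. For $y\in\mathbb R^D$ and a map $\mathcal G:\Omega\to\mathbb R^D$ put $$\Phi_{\mathcal G}(\theta)=\tfrac12\,(y-\mathcal G(\theta))^{\top}\Gamma^{-1}(y-\mathcal G(\theta)).$$ For $f:\Omega\to\mathbb R$ let $\|f\|_{n,\infty}=\max_{|\alpha|\le n}\|D^\alpha f\|_{L^\infty(\Omega)}$ (weak derivatives) be the norm of the Sobolev space $W^{n,\infty}(\Omega)$; let $\|f\|_{0,\infty}=\|f\|_{L^\infty(\Omega)}$ and, for $0<s<1$, $$\|f\|_{s,\infty}=\max\Big\{\|f\|_{L^\infty(\Omega)},\ \operatorname*{ess\,sup}_{x,x'\in\Omega}\frac{|f(x)-f(x')|}{|x-x'|^s}\Big\}.$$ A ReLU network is a composition of affine layers with the ReLU applied componentwise after every layer but the last (no skip connections); its depth is the number of layers, its number of weights is the number of nonzero entries of its weight matrices and bias vectors, and its number of units is the sum of the dimensions of all layers, input and output included. For a nondegenerate Gaussian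 density $\pi_0$ on $\mathbb R^d$ (any mean, any positive definite covariance), the posterior density on $\Omega$ with potential $\Phi$ is $$\hat\pi_\Phi(\theta)=\frac1Z\,e^{-\Phi(\theta)}\pi_0(\theta),\qquad Z=\int_\Omega e^{-\Phi(\theta)}\pi_0(\theta)\,d\theta,$$ and the Hellinger distance of densities on $\Omega$ is $d_H(f,g)=\big(\tfrac12\int_\Omega(\sqrt f-\sqrt g)^2\,d\theta\big)^{1/2}$. Then there are constants $c,C>0$, depending only on $d,D,n,s,\Gamma,B$, such that the following holds for all $y\in\mathbb R^D$ with $|y_j|\le B$ for all $j$, all $\mathcal G=(\mathcal G_1,\dots,\mathcal G_D)$ with $\mathcal G_j\in W^{n,\infty}(\Omega)$ and $\|\mathcal G_j\|_{n,\infty}\le B$ for all $j$, and all $\epsilon\in(0,1/2)$. 1. There is a ReLU network $\mathcal G^e:\mathbb R^d\to\mathbb R^D$ with $$\|\Phi_{\mathcal G}-\Phi_{\mathcal G^e}\|_{s,\infty}\le\epsilon,$$ with depth at most $c\log(\epsilon^{-n/(n-s)})$, and with at most $c\,\epsilon^{-d/(n-s)}\log^2(\epsilon^{-n/(n-s)})$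 weights and at most as many units. 2. For every ReLU network $\mathcal G^e:\mathbb R^d\to\mathbb R^D$ with $\|\Phi_{\mathcal G}-\Phi_{\mathcal G^e}\|_{s,\infty}\le\epsilon$, in particular for the one in 1, and for every nondegenerate Gaussian prior $\pi_0$, the posterior with the true likelihood and the posterior with the emulated likelihood satisfy $$d_H(\hat\pi_{\Phi_{\mathcal G}},\hat\pi_{\Phi_{\mathcal G^e}})\le C\epsilon .$$ -/

import Mathlib

open MeasureTheory Matrix
open scoped ENNReal ContDiff

noncomputable section

namespace Emulation

/-- The open unit cube `(0,1)^d`. -/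
def cube (d : ℕ) : Set (EuclideanSpace ℝ (Fin d)) :=
  {θ | ∀ i, 0 < θ i ∧ θ i < 1}

/-- Lebesgue measure on the open unit cube. -/
def cubeMeasure (d : ℕ) : Measure (EuclideanSpace ℝ (Fin d)) :=
  volume.restrict (cube d)

/-! ### Sobolev spaces on the cube, through weak derivatives -/

/-- The classical partial derivative `∂_i φ`. -/
def partialDeriv {d : ℕ} (i : Fin d) (φ : EuclideanSpace ℝ (Fin d) → ℝ) :
    EuclideanSpace ℝ (Fin d) → ℝ :=
  fun x => fderiv ℝ φ x (EuclideanSpace.single i 1)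

/-- The classical derivative `D^α φ = ∂_0^{α 0} ∂_1^{α 1} ⋯ φ` for a multi-index `α`. -/
def multiDeriv {d : ℕ} (α : Fin d → ℕ) (φ : EuclideanSpace ℝ (Fin d) → ℝ) :
    EuclideanSpace ℝ (Fin d) → ℝ :=
  (List.finRange d).foldr (fun i ψ => (partialDeriv i)^[α i] ψ) φ

/-- `g` is a weak derivative `D^α f` on the cube. -/
def IsWeakDeriv {d : ℕ} (α : Fin d → ℕ) (f g : EuclideanSpace ℝ (Fin d) → ℝ) : Prop :=
  ∀ φ : EuclideanSpace ℝ (Fin d) → ℝ,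
    ContDiff ℝ ∞ φ → HasCompactSupport φ → tsupport φ ⊆ cube d →
      ∫ x, f x * multiDeriv α φ x ∂(cubeMeasure d) =
        (-1) ^ (∑ i, α i) * ∫ x, g x * φ x ∂(cubeMeasure d)

/-- `f ∈ W^{n,p}((0,1)^d)`. -/
def MemSobolev {d : ℕ} (n : ℕ) (p : ℝ≥0∞) (f : EuclideanSpace ℝ (Fin d) → ℝ) : Prop :=
  MemLp f p (cubeMeasure d) ∧
    ∀ α : Fin d → ℕ, ∑ i, α i ≤ n → ∃ g, MemLp g p (cubeMeasure d) ∧ IsWeakDeriv α f g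

open Classical in
/-- The weak derivative `D^α f` in `L^∞`: it is determined almost everywhere; the value is `0` if
there is none. -/
def weakDeriv {d : ℕ} (α : Fin d → ℕ) (f : EuclideanSpace ℝ (Fin d) → ℝ) :
    EuclideanSpace ℝ (Fin d) → ℝ :=
  if h : ∃ g, MemLp g ∞ (cubeMeasure d) ∧ IsWeakDeriv α f g then h.choose else 0

/-- The norm `‖f‖_{n,∞} = max_{|α| ≤ n} ‖D^α f‖_∞` of `f ∈ W^{n,∞}((0,1)^d)`. -/
def sobolevNorm {d : ℕ} (n : ℕ) (f : EuclideanSpace ℝ (Fin d) → ℝ) : ℝ≥0∞ :=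
  ⨆ (α : Fin d → ℕ) (_ : ∑ i, α i ≤ n), eLpNorm (weakDeriv α f) ∞ (cubeMeasure d)

/-- The norm `‖f‖_{s,∞}` for `0 ≤ s < 1`: the `L^∞` norm if `s = 0`, and the Sobolev–Slobodeckij
norm `max {‖f‖_∞, ess sup |f x - f y| / |x - y|^s}` if `0 < s < 1`. -/
def slobodeckijNorm {d : ℕ} (s : ℝ) (f : EuclideanSpace ℝ (Fin d) → ℝ) : ℝ≥0∞ :=
  if s = 0 then eLpNorm f ∞ (cubeMeasure d)
  else max (eLpNorm f ∞ (cubeMeasure d))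
    (eLpNorm (fun z : EuclideanSpace ℝ (Fin d) × EuclideanSpace ℝ (Fin d) =>
      (f z.1 - f z.2) / ‖z.1 - z.2‖ ^ s) ∞ ((cubeMeasure d).prod (cubeMeasure d)))

/-! ### ReLU networks -/

/-- A standard feed-forward network with input dimension `k` and output dimension `m`: a finite
sequence of affine layers `x ↦ A x + b`. -/
inductive Net : ℕ → ℕ → Type
  | out {k m : ℕ} (A : Matrix (Fin m) (Fin k) ℝ) (b : Fin m → ℝ) : Net k m
  | hidden {k l m : ℕ} (A : Matrix (Fin l) (Fin k) ℝ) (b : Fin l → ℝ) (rest : Net l m) : Net k m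

/-- The function computed by the network: ReLU after every layer but the last. -/
def Net.eval : {k m : ℕ} → Net k m → (Fin k → ℝ) → (Fin m → ℝ)
  | _, _, .out A b, x => A *ᵥ x + b
  | _, _, .hidden A b rest, x => rest.eval fun i => max ((A *ᵥ x + b) i) 0

/-- The number of layers. -/
def Net.depth : {k m : ℕ} → Net k m → ℕ
  | _, _, .out _ _ => 1
  | _, _, .hidden _ _ rest => rest.depth + 1

/-- The number of nonzero entries of a weight matrix and a bias vector. -/
def layerWeights {k l : ℕ} (A : Matrix (Fin l) (Fin k) ℝ) (b : Fin l → ℝ) : ℕ :=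
  {q : Fin l × Fin k | A q.1 q.2 ≠ 0}.ncard + {i : Fin l | b i ≠ 0}.ncard

/-- The number of (nonzero) weights. -/
def Net.numWeights : {k m : ℕ} → Net k m → ℕ
  | _, _, .out A b => layerWeights A b
  | _, _, .hidden A b rest => layerWeights A b + rest.numWeights

/-- The number of units, those of the input and the output layer included. -/
def Net.numUnits : {k m : ℕ} → Net k m → ℕ
  | k, m, .out _ _ => k + m
  | k, _, .hidden _ _ rest => k + rest.numUnits

/-- The map `θ ↦ 𝒢ᵉ(θ)` given by a network. -/
def Net.emulator {d D : ℕ} (N : Net d D) (θ : EuclideanSpace ℝ (Fin d)) : Fin D → ℝ :=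
  N.eval fun i => θ i

/-! ### Potentials, posteriors, Hellinger distance -/

/-- The potential `Φ(y;θ) = ½ ‖y - G θ‖_Γ²` with `‖v‖_Γ² = vᵀ Γ⁻¹ v`, that is, the negative
log-likelihood, up to a constant, of `y = G θ + ε`, `ε ∼ N(0, Γ)`. -/
def potential {d D : ℕ} (Γ : Matrix (Fin D) (Fin D) ℝ) (y : Fin D → ℝ)
    (G : EuclideanSpace ℝ (Fin d) → Fin D → ℝ) (θ : EuclideanSpace ℝ (Fin d)) : ℝ :=
  1 / 2 * ((y - G θ) ⬝ᵥ (Γ⁻¹ *ᵥ (y - G θ)))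

/-- The Lebesgue density of the Gaussian distribution `N(m, S)` on `ℝ^d`. -/
def gaussianDensity {d : ℕ} (m : Fin d → ℝ) (S : Matrix (Fin d) (Fin d) ℝ)
    (θ : EuclideanSpace ℝ (Fin d)) : ℝ :=
  (√((2 * Real.pi) ^ d * S.det))⁻¹ *
    Real.exp (-(1 / 2) * ((fun i => θ i - m i) ⬝ᵥ (S⁻¹ *ᵥ fun i => θ i - m i)))

/-- The normalizing constant `Z = ∫ exp(-Φ) π₀` over the cube. -/
def normalizer {d : ℕ} (Φ π₀ : EuclideanSpace ℝ (Fin d) → ℝ) : ℝ :=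
  ∫ θ, Real.exp (-Φ θ) * π₀ θ ∂(cubeMeasure d)

/-- The posterior density `Z⁻¹ exp(-Φ(θ)) π₀(θ)` on the cube. -/
def posterior {d : ℕ} (Φ π₀ : EuclideanSpace ℝ (Fin d) → ℝ) (θ : EuclideanSpace ℝ (Fin d)) : ℝ :=
  (normalizer Φ π₀)⁻¹ * (Real.exp (-Φ θ) * π₀ θ)

/-- The Hellinger distance of densities on the cube:
`d_H(f, g)² = ½ ∫ (√f - √g)²`. -/
def hellinger {d : ℕ} (f g : EuclideanSpace ℝ (Fin d) → ℝ) : ℝ≥0∞ :=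
  (2⁻¹ * ∫⁻ θ, ENNReal.ofReal ((√(f θ) - √(g θ)) ^ 2) ∂(cubeMeasure d)) ^ (1 / 2 : ℝ)

end Emulation

end

/-!
On the cube a function with weak derivatives of order at most `n` bounded by `B` has a Lipschitz
representative, and mollification brings it arbitrarily close to smooth functions with the same
bounds, so smooth functions can be approximated instead. On the grid of mesh size `2^(-a)`,
patching local Taylor polynomials of degree `n - 1` together by products of hat functions gives the
error `2^(-a n)` in the supremum norm and `2^(-a (n - 1))` in the Lipschitz seminorm, hence
`2^(-a (n - s))` in the Hölder norm of order `s`.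

The result is a sum of about `2^(a d)` products of a fixed number of piecewise linear factors. By
polarization a product reduces to squares, and `M` compositions of the tent map compute squares up
to `4^(-M)`; with `M` a large multiple of `a` this accuracy makes up for the number of terms. Each
product is a network of depth of order `a` and bounded width, and the terms run in parallel. The
choice `2^a ≈ ε^(-1/(n - s))` gives the sizes, and the potential inherits the error because it is
quadratic in the forward map.

If two nonnegative potentials differ by at most `ε`, the posterior densities are within a factor
`e^(2ε)` of each other, so `(√p - √q)² ≤ (e^ε - 1)² p`, which integrates to the bound on the
Hellinger distance.
-/

noncomputable section

namespace Emulation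

namespace Net

/-- The largest dimension of a layer, input and output included. Together with the depth it bounds
the numbers of weights and units, see `numWeights_le` and `numUnits_le`. -/
def width : {k m : ℕ} → Net k m → ℕ
  | k, m, .out _ _ => max k m
  | k, _, .hidden _ _ rest => max k rest.width

theorem input_le_width : {k m : ℕ} → (N : Net k m) → k ≤ N.width
  | _, _, .out _ _ => le_max_left _ _
  | _, _, .hidden _ _ _ => le_max_left _ _

theorem output_le_width : {k m : ℕ} → (N : Net k m) → m ≤ N.width
  | _, _, .out _ _ => le_max_right _ _
  | _, _, .hidden _ _ rest => rest.output_le_width.trans (le_max_right _ _)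

theorem one_le_depth {k m : ℕ} (N : Net k m) : 1 ≤ N.depth := by
  cases N <;> simp [depth]

theorem continuous_eval : {k m : ℕ} → (N : Net k m) → Continuous N.eval
  | _, _, .out A b => by
      simp only [eval]
      fun_prop
  | _, _, .hidden A b rest =>
      rest.continuous_eval.comp (by fun_prop : Continuous fun x i => max ((A *ᵥ x + b) i) 0)

theorem layerWeights_le {k l : ℕ} (A : Matrix (Fin l) (Fin k) ℝ) (b : Fin l → ℝ) :
    layerWeights A b ≤ l * k + l := by
  refine add_le_add ((Set.ncard_le_ncard (Set.subset_univ _)).trans ?_)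
    ((Set.ncard_le_ncard (Set.subset_univ _)).trans ?_) <;>
  simp [Set.ncard_univ]

theorem numUnits_le : {k m : ℕ} → (N : Net k m) → N.numUnits ≤ (N.depth + 1) * N.width
  | k, m, .out _ _ => by
      simp only [numUnits, depth, width]
      omega
  | k, m, .hidden _ _ rest => by
      calc k + rest.numUnits ≤ max k rest.width + (rest.depth + 1) * max k rest.width := by
            gcongr
            exacts [le_max_left _ _, rest.numUnits_le.trans (by gcongr; exact le_max_right _ _)]
        _ = (rest.depth + 1 + 1) * max k rest.width := by ring

theorem numWeights_le : {k m : ℕ} → (N : Net k m) →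
    N.numWeights ≤ N.depth * (N.width * N.width + N.width)
  | k, m, .out A b => by
      rw [depth, one_mul]
      exact (layerWeights_le A b).trans (by gcongr <;> simp [width])
  | k, m, .hidden (l := l) A b rest => by
      rw [width]
      have hk : k ≤ max k rest.width := le_max_left _ _
      have hrest : rest.width ≤ max k rest.width := le_max_right _ _
      have hl : l ≤ max k rest.width := rest.input_le_width.trans hrest
      generalize max k rest.width = w at *
      calc layerWeights A b + rest.numWeights
          ≤ (w * w + w) + rest.depth * (w * w + w) :=
            add_le_add ((layerWeights_le A b).trans (by gcongr))
              (rest.numWeights_le.trans (by gcongr))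
        _ = (rest.depth + 1) * (w * w + w) := by ring

/-- Precomposition of a network with the affine map `x ↦ M x + v`, absorbed into the first
layer. -/
def precomp {k' : ℕ} : {k m : ℕ} → Net k m → Matrix (Fin k) (Fin k') ℝ → (Fin k → ℝ) → Net k' m
  | _, _, .out A b, M, v => .out (A * M) (A *ᵥ v + b)
  | _, _, .hidden A b rest, M, v => .hidden (A * M) (A *ᵥ v + b) rest

section Precomp

variable {k' k m : ℕ} (N : Net k m) (M : Matrix (Fin k) (Fin k') ℝ) (v : Fin k → ℝ)

theorem eval_precomp (x : Fin k' → ℝ) : (N.precomp M v).eval x = N.eval (M *ᵥ x + v) := by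
  cases N <;> simp [precomp, eval, Matrix.mulVec_add, add_assoc]

theorem depth_precomp : (N.precomp M v).depth = N.depth := by
  cases N <;> rfl

theorem width_precomp_le : (N.precomp M v).width ≤ max k' N.width := by
  cases N <;> simp only [precomp, width] <;> omega

end Precomp

/-- The composition of two networks, first `N₁` and then `N₂`. The affine last layer of `N₁` is
merged with the first layer of `N₂`, so the depths add up to one less than their sum. -/
def comp : {k l m : ℕ} → Net k l → Net l m → Net k m
  | _, _, _, .out A b, N₂ => N₂.precomp A b
  | _, _, _, .hidden A b rest, N₂ => .hidden A b (rest.comp N₂)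

theorem eval_comp : {k l m : ℕ} → (N₁ : Net k l) → (N₂ : Net l m) → (x : Fin k → ℝ) →
    (N₁.comp N₂).eval x = N₂.eval (N₁.eval x)
  | _, _, _, .out A b, N₂, x => by simp only [comp, eval_precomp, eval]
  | _, _, _, .hidden A b rest, N₂, x => by simp only [comp, eval, eval_comp rest N₂]

theorem depth_comp : {k l m : ℕ} → (N₁ : Net k l) → (N₂ : Net l m) →
    (N₁.comp N₂).depth + 1 = N₁.depth + N₂.depth
  | _, _, _, .out A b, N₂ => by simp only [comp, depth_precomp, depth, add_comm]
  | _, _, _, .hidden A b rest, N₂ => by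
      simp only [comp, depth, depth_comp rest N₂]; omega

theorem width_comp_le : {k l m : ℕ} → (N₁ : Net k l) → (N₂ : Net l m) →
    (N₁.comp N₂).width ≤ max N₁.width N₂.width
  | _, _, _, .out A b, N₂ => (width_precomp_le _ _ _).trans (max_le_max_right _ (le_max_left _ _))
  | _, _, _, .hidden A b rest, N₂ => by
      have := width_comp_le rest N₂
      simp only [comp, width]
      omega

section Stacking

variable {a b c e : ℕ}

/-- The block diagonal matrix of two matrices, the weight matrix of two layers run in parallel.
Unlike `Matrix.fromBlocks` it is indexed by `Fin`, as the layers of a network are. -/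
def blockDiag (A : Matrix (Fin a) (Fin b) ℝ) (A' : Matrix (Fin c) (Fin e) ℝ) :
    Matrix (Fin (a + c)) (Fin (b + e)) ℝ :=
  Fin.append (fun i => Fin.append (A i) 0) (fun i => Fin.append 0 (A' i))

/-- Two matrices above each other, the weight matrix of two layers with the same input. Unlike
`Matrix.fromRows` it is indexed by `Fin`. -/
def vStack (A : Matrix (Fin a) (Fin b) ℝ) (A' : Matrix (Fin c) (Fin b) ℝ) :
    Matrix (Fin (a + c)) (Fin b) ℝ :=
  Fin.append A A'

/-- Two matrices beside each other, the weight matrix of a layer that adds the outputs of two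
layers. Unlike `Matrix.fromCols` it is indexed by `Fin`. -/
def hStack (A : Matrix (Fin a) (Fin b) ℝ) (A' : Matrix (Fin a) (Fin c) ℝ) :
    Matrix (Fin a) (Fin (b + c)) ℝ :=
  fun i => Fin.append (A i) (A' i)

theorem blockDiag_mulVec (A : Matrix (Fin a) (Fin b) ℝ) (A' : Matrix (Fin c) (Fin e) ℝ)
    (x : Fin b → ℝ) (x' : Fin e → ℝ) :
    blockDiag A A' *ᵥ Fin.append x x' = Fin.append (A *ᵥ x) (A' *ᵥ x') := by
  ext i
  refine Fin.addCases (fun i => ?_) (fun i => ?_) i <;>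
    simp [blockDiag, Matrix.mulVec, dotProduct, Fin.sum_univ_add]

theorem vStack_castAdd (A : Matrix (Fin a) (Fin b) ℝ) (A' : Matrix (Fin c) (Fin b) ℝ) (i : Fin a)
    (j : Fin b) : vStack A A' (Fin.castAdd c i) j = A i j := congrFun (Fin.append_left A A' i) j

theorem vStack_natAdd (A : Matrix (Fin a) (Fin b) ℝ) (A' : Matrix (Fin c) (Fin b) ℝ) (i : Fin c)
    (j : Fin b) : vStack A A' (Fin.natAdd a i) j = A' i j := congrFun (Fin.append_right A A' i) j

theorem vStack_mulVec (A : Matrix (Fin a) (Fin b) ℝ) (A' : Matrix (Fin c) (Fin b) ℝ)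
    (x : Fin b → ℝ) : vStack A A' *ᵥ x = Fin.append (A *ᵥ x) (A' *ᵥ x) := by
  ext i
  refine Fin.addCases (fun i => ?_) (fun i => ?_) i <;>
    simp [vStack_castAdd, vStack_natAdd, Matrix.mulVec, dotProduct]

theorem hStack_mulVec (A : Matrix (Fin a) (Fin b) ℝ) (A' : Matrix (Fin a) (Fin c) ℝ)
    (x : Fin b → ℝ) (x' : Fin c → ℝ) :
    hStack A A' *ᵥ Fin.append x x' = A *ᵥ x + A' *ᵥ x' := by
  ext i
  simp [hStack, Matrix.mulVec, dotProduct, Fin.sum_univ_add]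

theorem max_append_add_append_zero (u u' : Fin a → ℝ) (v v' : Fin b → ℝ) :
    (fun i => max ((Fin.append u v + Fin.append u' v') i) 0) =
      Fin.append (fun i => max ((u + u') i) 0) (fun i => max ((v + v') i) 0) := by
  ext i
  refine Fin.addCases (fun i => ?_) (fun i => ?_) i <;> simp

theorem ncard_setOf_fin_add (p : Fin (a + b) → Prop) :
    {i | p i}.ncard = {i | p (Fin.castAdd b i)}.ncard + {i | p (Fin.natAdd a i)}.ncard := by
  classical
  simp only [Set.ncard_eq_toFinset_card', Set.toFinset_ofPred, Finset.card_filter]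
  exact Fin.sum_univ_add _

theorem ncard_setOf_add_ne_zero_le {ι M : Type*} [Finite ι] [AddZeroClass M] (f g : ι → M) :
    {i | f i + g i ≠ 0}.ncard ≤ {i | f i ≠ 0}.ncard + {i | g i ≠ 0}.ncard := by
  refine (Set.ncard_le_ncard fun i hi => ?_).trans (Set.ncard_union_le _ _)
  by_contra h
  simp only [Set.mem_union, Set.mem_ofPred_eq, not_or, not_not] at h
  exact hi (by rw [h.1, h.2, add_zero])

theorem layerWeights_eq_sum (A : Matrix (Fin a) (Fin b) ℝ) (v : Fin a → ℝ) :
    layerWeights A v = ∑ i, {j | A i j ≠ 0}.ncard + {i | v i ≠ 0}.ncard := by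
  classical
  simp only [layerWeights, Set.ncard_eq_toFinset_card', Set.toFinset_ofPred, Finset.card_filter]
  rw [Fintype.sum_prod_type]

theorem layerWeights_zero : layerWeights (0 : Matrix (Fin a) (Fin b) ℝ) 0 = 0 := by
  simp [layerWeights]

theorem layerWeights_blockDiag (A : Matrix (Fin a) (Fin b) ℝ) (A' : Matrix (Fin c) (Fin e) ℝ)
    (v : Fin a → ℝ) (v' : Fin c → ℝ) :
    layerWeights (blockDiag A A') (Fin.append v v') = layerWeights A v + layerWeights A' v' := by
  simp only [layerWeights_eq_sum, Fin.sum_univ_add, ncard_setOf_fin_add]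
  simp [blockDiag]
  ring

theorem layerWeights_vStack (A : Matrix (Fin a) (Fin b) ℝ) (A' : Matrix (Fin c) (Fin b) ℝ)
    (v : Fin a → ℝ) (v' : Fin c → ℝ) :
    layerWeights (vStack A A') (Fin.append v v') = layerWeights A v + layerWeights A' v' := by
  simp only [layerWeights_eq_sum, Fin.sum_univ_add, ncard_setOf_fin_add, vStack_castAdd,
    vStack_natAdd, Fin.append_left, Fin.append_right]
  ring

theorem layerWeights_hStack_le (A : Matrix (Fin a) (Fin b) ℝ) (A' : Matrix (Fin a) (Fin c) ℝ)
    (v v' : Fin a → ℝ) :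
    layerWeights (hStack A A') (v + v') ≤ layerWeights A v + layerWeights A' v' := by
  have := ncard_setOf_add_ne_zero_le v v'
  simp only [layerWeights_eq_sum, ncard_setOf_fin_add, hStack, Fin.append_left,
    Fin.append_right, Finset.sum_add_distrib, Pi.add_apply]
  omega

theorem layerWeights_add_le (A A' : Matrix (Fin a) (Fin b) ℝ) (v v' : Fin a → ℝ) :
    layerWeights (A + A') (v + v') ≤ layerWeights A v + layerWeights A' v' := by
  have hA := ncard_setOf_add_ne_zero_le (fun q : Fin a × Fin b => A q.1 q.2) (fun q => A' q.1 q.2)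
  have hv := ncard_setOf_add_ne_zero_le v v'
  simp only [layerWeights, Pi.add_apply, Matrix.add_apply]
  omega

end Stacking

theorem exists_eval_append_eq_add {k k' m : ℕ} (N : Net k m) (N' : Net k' m)
    (h : N.depth = N'.depth) :
    ∃ S : Net (k + k') m, (∀ x x', S.eval (Fin.append x x') = N.eval x + N'.eval x') ∧
      S.depth = N.depth ∧ S.width ≤ N.width + N'.width ∧
      S.numWeights ≤ N.numWeights + N'.numWeights ∧ S.numUnits ≤ N.numUnits + N'.numUnits := by
  match N, N' with
  | .out A b, .out A' b' =>
    refine ⟨.out (hStack A A') (b + b'), fun x x' => ?_, rfl, ?_,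
      layerWeights_hStack_le A A' b b', ?_⟩
    · simp only [eval, hStack_mulVec]
      abel
    all_goals simp only [width, numUnits]; omega
  | .hidden A b N, .hidden A' b' N' =>
    obtain ⟨S, eval_S, depth_S, width_S, weights_S, units_S⟩ :=
      N.exists_eval_append_eq_add N' (Nat.succ_injective h)
    refine ⟨.hidden (blockDiag A A') (Fin.append b b') S, fun x x' => ?_,
      congrArg (· + 1) depth_S, ?_, ?_, ?_⟩
    · simp only [eval, blockDiag_mulVec, max_append_add_append_zero, eval_S]
    all_goals simp only [width, numWeights, numUnits, layerWeights_blockDiag]; omega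
  | .out _ _, .hidden _ _ N' =>
    have := N'.one_le_depth
    simp only [depth] at h
    omega
  | .hidden _ _ N, .out _ _ =>
    have := N.one_le_depth
    simp only [depth] at h
    omega

theorem exists_eval_eq_add {k m : ℕ} (N N' : Net k m) (h : N.depth = N'.depth) :
    ∃ S : Net k m, (∀ x, S.eval x = N.eval x + N'.eval x) ∧
      S.depth = N.depth ∧ S.width ≤ N.width + N'.width ∧
      S.numWeights ≤ N.numWeights + N'.numWeights ∧ S.numUnits ≤ N.numUnits + N'.numUnits := by
  match N, N' with
  | .out A b, .out A' b' =>
    refine ⟨.out (A + A') (b + b'), fun x => ?_, rfl, ?_, layerWeights_add_le A A' b b', ?_⟩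
    · simp only [eval, Matrix.add_mulVec]
      abel
    all_goals simp only [width, numUnits]; omega
  | .hidden A b N, .hidden A' b' N' =>
    obtain ⟨S, eval_S, depth_S, width_S, weights_S, units_S⟩ :=
      N.exists_eval_append_eq_add N' (Nat.succ_injective h)
    refine ⟨.hidden (vStack A A') (Fin.append b b') S, fun x => ?_,
      congrArg (· + 1) depth_S, ?_, ?_, ?_⟩
    · simp only [eval, vStack_mulVec, max_append_add_append_zero, eval_S]
    all_goals simp only [width, numWeights, numUnits, layerWeights_vStack]; omega
  | .out _ _, .hidden _ _ N' =>
    have := N'.one_le_depth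
    simp only [depth] at h
    omega
  | .hidden _ _ N, .out _ _ =>
    have := N.one_le_depth
    simp only [depth] at h
    omega

theorem exists_eval_eq_zero (L k m : ℕ) :
    ∃ N : Net k m, (∀ x, N.eval x = 0) ∧ N.depth = L + 1 ∧ N.numWeights = 0 ∧
      N.numUnits = k + m := by
  induction L generalizing k with
  | zero => exact ⟨.out 0 0, fun x => by simp [eval], rfl, layerWeights_zero, rfl⟩
  | succ L ih =>
    obtain ⟨N, eval_N, depth_N, weights_N, units_N⟩ := ih 0
    exact ⟨.hidden 0 0 N, fun x => eval_N _, congrArg (· + 1) depth_N,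
      by rw [numWeights, weights_N, layerWeights_zero], by rw [numUnits, units_N, zero_add]⟩

theorem exists_eval_eq_sum {ι : Type*} (t : Finset ι) {k m L W U : ℕ} (hL : 1 ≤ L)
    (N : ι → Net k m)
    (hN : ∀ i ∈ t, (N i).depth = L ∧ (N i).numWeights ≤ W ∧ (N i).numUnits ≤ U) :
    ∃ S : Net k m, (∀ x, S.eval x = ∑ i ∈ t, (N i).eval x) ∧ S.depth = L ∧
      S.numWeights ≤ t.card * W ∧ S.numUnits ≤ t.card * U + (k + m) := by
  classical
  induction t using Finset.induction_on with
  | empty =>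
    obtain ⟨S, eval_S, depth_S, weights_S, units_S⟩ := exists_eval_eq_zero (L - 1) k m
    exact ⟨S, by simpa using eval_S, by omega, by simp [weights_S], by simp [units_S]⟩
  | insert i t hi ih =>
    obtain ⟨S, eval_S, depth_S, weights_S, units_S⟩ :=
      ih fun j hj => hN j (Finset.mem_insert_of_mem hj)
    obtain ⟨depth_i, weights_i, units_i⟩ := hN i (Finset.mem_insert_self _ _)
    obtain ⟨S', eval_S', depth_S', -, weights_S', units_S'⟩ :=
      exists_eval_eq_add (N i) S (depth_i.trans depth_S.symm)
    refine ⟨S', fun x => ?_, depth_S'.trans depth_i, ?_, ?_⟩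
    · rw [eval_S', eval_S, Finset.sum_insert hi]
    all_goals rw [Finset.card_insert_of_notMem hi, add_mul]; omega

end Net

/-- `f` is computed by a ReLU network of depth `L` and width at most `w`. The depth is prescribed
exactly because only networks of equal depth can be added. -/
def IsRealizable {k : ℕ} (L w : ℕ) (f : (Fin k → ℝ) → ℝ) : Prop :=
  ∃ N : Net k 1, N.depth = L ∧ N.width ≤ w ∧ ∀ x, N.eval x 0 = f x

namespace IsRealizable

variable {k L L' w w' : ℕ} {f g : (Fin k → ℝ) → ℝ}

theorem mono (hf : IsRealizable L w f) (h : w ≤ w') : IsRealizable L w' f := by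
  obtain ⟨N, depth_N, width_N, eval_N⟩ := hf
  exact ⟨N, depth_N, width_N.trans h, eval_N⟩

theorem one_le_width (hf : IsRealizable L w f) : 1 ≤ w := by
  obtain ⟨N, -, width_N, -⟩ := hf
  exact N.output_le_width.trans width_N

theorem comp {h : ℝ → ℝ} (hh : IsRealizable (k := 1) (L' + 1) w' fun z => h (z 0))
    (hf : IsRealizable L w f) : IsRealizable (L + L') (max w w') fun x => h (f x) := by
  obtain ⟨N, depth_N, width_N, eval_N⟩ := hf
  obtain ⟨N', depth_N', width_N', eval_N'⟩ := hh
  refine ⟨N.comp N', ?_, (N.width_comp_le N').trans (max_le_max width_N width_N'), fun x => ?_⟩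
  · have := N.depth_comp N'
    omega
  · rw [Net.eval_comp, eval_N']
    exact congrArg h (eval_N x)

theorem mul_add_const (a b : ℝ) (hf : IsRealizable L w f) :
    IsRealizable L w fun x => a * f x + b := by
  have h : IsRealizable (k := 1) 1 1 fun z => a * z 0 + b :=
    ⟨.out !![a] ![b], rfl, by simp [Net.width], fun x => by simp [Net.eval, Matrix.vecHead]⟩
  exact (comp (h := fun z => a * z + b) (L' := 0) h hf).mono (max_le le_rfl hf.one_le_width)

theorem add (hf : IsRealizable L w f) (hg : IsRealizable L w' g) :
    IsRealizable L (w + w') fun x => f x + g x := by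
  obtain ⟨N, depth_N, width_N, eval_N⟩ := hf
  obtain ⟨N', depth_N', width_N', eval_N'⟩ := hg
  obtain ⟨S, eval_S, depth_S, width_S, -⟩ := N.exists_eval_eq_add N' (depth_N.trans depth_N'.symm)
  refine ⟨S, depth_S.trans depth_N, width_S.trans (add_le_add width_N width_N'), fun x => ?_⟩
  rw [eval_S, Pi.add_apply, eval_N, eval_N']

theorem coord (i : Fin k) : IsRealizable 1 k fun x => x i := by
  refine ⟨.out (Matrix.of fun _ => Pi.single i 1) 0, rfl, max_le le_rfl i.pos, fun x => ?_⟩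
  simp [Net.eval, Matrix.mulVec]

theorem const (k : ℕ) (c : ℝ) : IsRealizable (k := k) 1 (k + 1) fun _ => c :=
  ⟨.out 0 ![c], rfl, by simp [Net.width], fun x => by simp [Net.eval]⟩

theorem relu (hf : IsRealizable L w f) : IsRealizable (L + 1) w fun x => max (f x) 0 := by
  have h : IsRealizable (k := 1) 2 1 fun z => max (z 0) 0 :=
    ⟨.hidden !![1] 0 (.out !![1] 0), rfl, by simp [Net.width],
      fun x => by simp [Net.eval, Matrix.vecHead]⟩
  exact (comp (h := fun z => max z 0) h hf).mono (max_le le_rfl hf.one_le_width)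

theorem pad (hf : IsRealizable L w f) (j : ℕ) : IsRealizable (L + j) (max w 2) f := by
  have hid : IsRealizable (k := 1) 2 2 fun z => z 0 := by
    have hcoord : IsRealizable (k := 1) 1 1 fun z => z 0 := coord 0
    convert hcoord.relu.add ((hcoord.mul_add_const (-1) 0).relu.mul_add_const (-1) 0)
      using 2 with z
    rw [neg_one_mul, neg_one_mul, add_zero, add_zero, ← sub_eq_add_neg,
      max_zero_sub_eq_self]
  induction j with
  | zero => exact hf.mono (le_max_left _ _)
  | succ j ih => exact (comp (h := fun z => z) hid ih).mono (by omega)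

end IsRealizable

/-! ### Approximate squares and products -/

/-- The tent map of slope `2` on `[0,1]`, whose iterates are the sawtooth functions of Yarotsky's
approximation of the square. -/
def tent (t : ℝ) : ℝ := 1 - |2 * t - 1|

theorem tent_mem_Icc {t : ℝ} (ht : t ∈ Set.Icc (0 : ℝ) 1) : tent t ∈ Set.Icc (0 : ℝ) 1 := by
  have : |2 * t - 1| ≤ 1 := abs_le.2 ⟨by linarith [ht.1], by linarith [ht.2]⟩
  exact ⟨sub_nonneg.2 this, sub_le_self _ (abs_nonneg _)⟩

theorem iterate_tent_mem_Icc {t : ℝ} (ht : t ∈ Set.Icc (0 : ℝ) 1) (r : ℕ) :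
    tent^[r] t ∈ Set.Icc (0 : ℝ) 1 :=
  Set.MapsTo.iterate (fun _ => tent_mem_Icc) r ht

theorem abs_tent_sub_le (a b : ℝ) : |tent a - tent b| ≤ 2 * |a - b| :=
  calc |tent a - tent b| = |(|2 * b - 1| - |2 * a - 1|)| := by
        rw [tent, tent, sub_sub_sub_cancel_left]
    _ ≤ |2 * b - 1 - (2 * a - 1)| := abs_abs_sub_abs_le_abs_sub _ _
    _ = 2 * |a - b| := by
        rw [sub_sub_sub_cancel_right, ← mul_sub, abs_mul, abs_two, abs_sub_comm]

theorem abs_iterate_tent_sub_le (r : ℕ) (a b : ℝ) :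
    |tent^[r] a - tent^[r] b| ≤ 2 ^ r * |a - b| := by
  induction r with
  | zero => simp
  | succ r ih =>
    rw [Function.iterate_succ_apply', Function.iterate_succ_apply', pow_succ', mul_assoc]
    exact (abs_tent_sub_le _ _).trans (by gcongr)

theorem sub_sq_eq_tent (t : ℝ) : t - t ^ 2 = tent t / 4 + (tent t - tent t ^ 2) / 4 := by
  rw [tent]
  linear_combination sq_abs (2 * t - 1) / 4

/-- Yarotsky's approximation of `x ^ 2` on `[-1,1]`: the `M`-th partial sum of the expansion
`x ^ 2 = |x| - ∑ r ≥ 1, tent^[r] |x| / 4 ^ r`. -/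
def sqApprox (M : ℕ) (x : ℝ) : ℝ := |x| - ∑ r ∈ Finset.range M, tent^[r + 1] |x| / 4 ^ (r + 1)

theorem sqApprox_succ (M : ℕ) (x : ℝ) :
    sqApprox (M + 1) x = sqApprox M x - tent^[M + 1] |x| / 4 ^ (M + 1) := by
  rw [sqApprox, sqApprox, Finset.sum_range_succ, sub_sub]

theorem sqApprox_sub_sq (M : ℕ) (x : ℝ) :
    sqApprox M x - x ^ 2 = (tent^[M] |x| - tent^[M] |x| ^ 2) / 4 ^ M := by
  induction M with
  | zero => simp [sqApprox]
  | succ M ih =>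
    rw [sqApprox_succ, sub_right_comm, ih, sub_sq_eq_tent, Function.iterate_succ_apply',
      pow_succ (4 : ℝ)]
    field_simp
    ring

theorem abs_sqApprox_sub_sq_le (M : ℕ) {x : ℝ} (hx : |x| ≤ 1) :
    |sqApprox M x - x ^ 2| ≤ 1 / 4 ^ M := by
  obtain ⟨h0, h1⟩ := iterate_tent_mem_Icc ⟨abs_nonneg x, hx⟩ M
  rw [sqApprox_sub_sq, abs_div, abs_of_pos (by positivity : (0 : ℝ) < 4 ^ M)]
  gcongr
  rw [abs_le]
  constructor <;> nlinarith

theorem abs_sqApprox_sub_le (M : ℕ) (a b : ℝ) :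
    |sqApprox M a - sqApprox M b| ≤ 2 * |a - b| := by
  have hterm (r : ℕ) : |tent^[r] |a| / 4 ^ r - tent^[r] |b| / 4 ^ r| ≤
      (1 / 2) ^ r * |(|a| - |b|)| := by
    rw [← sub_div, abs_div, abs_of_pos (by positivity : (0 : ℝ) < 4 ^ r),
      div_le_iff₀ (by positivity)]
    refine (abs_iterate_tent_sub_le r _ _).trans_eq ?_
    rw [mul_right_comm, ← mul_pow]
    norm_num
  calc |sqApprox M a - sqApprox M b|
      = |(|a| - |b|) - ∑ r ∈ Finset.range M,
          (tent^[r + 1] |a| / 4 ^ (r + 1) - tent^[r + 1] |b| / 4 ^ (r + 1))| := by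
        rw [sqApprox, sqApprox, Finset.sum_sub_distrib, sub_sub_sub_comm]
    _ ≤ |(|a| - |b|)| + ∑ r ∈ Finset.range M, (1 / 2) ^ (r + 1) * |(|a| - |b|)| := by
        refine (abs_sub _ _).trans ?_
        gcongr
        exact (Finset.abs_sum_le_sum_abs _ _).trans (Finset.sum_le_sum fun r _ => hterm (r + 1))
    _ = (∑ r ∈ Finset.range (M + 1), (1 / 2) ^ r) * |(|a| - |b|)| := by
        rw [Finset.sum_range_succ', add_mul, Finset.sum_mul]
        ring
    _ ≤ 2 * |a - b| :=
        mul_le_mul (sum_geometric_two_le _) (abs_abs_sub_abs_le_abs_sub a b) (abs_nonneg _)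
          (by simp)

/-- An approximation of `a * b` for `a, b ∈ [-1,1]`, obtained from `sqApprox` by polarization. -/
def mulApprox (M : ℕ) (a b : ℝ) : ℝ := sqApprox M ((a + b) / 2) - sqApprox M ((a - b) / 2)

theorem abs_mulApprox_sub_mul_le (M : ℕ) {a b : ℝ} (ha : |a| ≤ 1) (hb : |b| ≤ 1) :
    |mulApprox M a b - a * b| ≤ 2 / 4 ^ M := by
  have hadd : |(a + b) / 2| ≤ 1 := by
    rw [abs_div, abs_two]
    linarith [abs_add_le a b]
  have hsub : |(a - b) / 2| ≤ 1 := by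
    rw [abs_div, abs_two]
    linarith [abs_sub a b]
  calc |mulApprox M a b - a * b|
      = |(sqApprox M ((a + b) / 2) - ((a + b) / 2) ^ 2) -
          (sqApprox M ((a - b) / 2) - ((a - b) / 2) ^ 2)| := by
        rw [mulApprox]
        ring_nf
    _ ≤ 1 / 4 ^ M + 1 / 4 ^ M := (abs_sub _ _).trans
        (add_le_add (abs_sqApprox_sub_sq_le M hadd) (abs_sqApprox_sub_sq_le M hsub))
    _ = 2 / 4 ^ M := by ring

theorem abs_mulApprox_sub_le (M : ℕ) (a b a' b' : ℝ) :
    |mulApprox M a b - mulApprox M a' b'| ≤ 2 * (|a - a'| + |b - b'|) := by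
  have hadd : |(a + b) / 2 - (a' + b') / 2| ≤ (|a - a'| + |b - b'|) / 2 := by
    rw [← sub_div, abs_div, abs_two, add_sub_add_comm]
    gcongr
    exact abs_add_le _ _
  have hsub : |(a - b) / 2 - (a' - b') / 2| ≤ (|a - a'| + |b - b'|) / 2 := by
    rw [← sub_div, abs_div, abs_two, sub_sub_sub_comm]
    gcongr
    exact abs_sub _ _
  rw [mulApprox, mulApprox, sub_sub_sub_comm]
  linarith [abs_sub (sqApprox M ((a + b) / 2) - sqApprox M ((a' + b') / 2))
      (sqApprox M ((a - b) / 2) - sqApprox M ((a' - b') / 2)),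
    abs_sqApprox_sub_le M ((a + b) / 2) ((a' + b') / 2),
    abs_sqApprox_sub_le M ((a - b) / 2) ((a' - b') / 2)]

/-- An approximation of `∏ i, u i` for `u i ∈ [-1,1]`, by iterating `mulApprox`. -/
def prodApprox (M : ℕ) : {n : ℕ} → (Fin n → ℝ) → ℝ
  | 0, _ => 1
  | _ + 1, u => mulApprox M (u 0) (prodApprox M (Fin.tail u))

theorem abs_prod_le_one {n : ℕ} {u : Fin n → ℝ} (hu : ∀ i, |u i| ≤ 1) : |∏ i, u i| ≤ 1 := by
  rw [Finset.abs_prod]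
  exact Finset.prod_le_one (fun i _ => abs_nonneg _) fun i _ => hu i

theorem abs_prod_sub_prod_le {n : ℕ} {u v : Fin n → ℝ} {r : ℝ} (hu : ∀ i, |u i| ≤ 1)
    (hv : ∀ i, |v i| ≤ 1) (h : ∀ i, |u i - v i| ≤ r) : |∏ i, u i - ∏ i, v i| ≤ n * r := by
  induction n with
  | zero => simp
  | succ n ih =>
    have ih := ih (fun i => hu i.succ) (fun i => hv i.succ) fun i => h i.succ
    rw [Fin.prod_univ_succ, Fin.prod_univ_succ]
    calc |u 0 * ∏ i : Fin n, u i.succ - v 0 * ∏ i : Fin n, v i.succ|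
        = |(u 0 - v 0) * ∏ i : Fin n, u i.succ +
            v 0 * (∏ i : Fin n, u i.succ - ∏ i : Fin n, v i.succ)| := by ring_nf
      _ ≤ |u 0 - v 0| * |∏ i : Fin n, u i.succ| +
            |v 0| * |∏ i : Fin n, u i.succ - ∏ i : Fin n, v i.succ| := by
          rw [← abs_mul, ← abs_mul]
          exact abs_add_le _ _
      _ ≤ r * 1 + 1 * (n * r) := by
          gcongr
          · exact (abs_nonneg _).trans (h 0)
          · exact h 0
          · exact abs_prod_le_one fun i => hu i.succ
          · exact hv 0
      _ = (n + 1 : ℕ) * r := by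
          push_cast
          ring

theorem abs_prodApprox_sub_prod_le (M : ℕ) {n : ℕ} {u : Fin n → ℝ} (hu : ∀ i, |u i| ≤ 1) :
    |prodApprox M u - ∏ i, u i| ≤ (2 ^ (n + 1) - 2) / 4 ^ M := by
  induction n with
  | zero => simp [prodApprox]
  | succ n ih =>
    have ih : |prodApprox M (Fin.tail u) - ∏ i : Fin n, u i.succ| ≤ _ := ih fun i => hu i.succ
    have hmul := abs_mulApprox_sub_mul_le M (hu 0) (abs_prod_le_one fun i : Fin n => hu i.succ)
    have hlip := abs_mulApprox_sub_le M (u 0) (prodApprox M (Fin.tail u)) (u 0)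
      (∏ i : Fin n, u i.succ)
    rw [sub_self, abs_zero, zero_add] at hlip
    rw [Fin.prod_univ_succ, prodApprox]
    calc |mulApprox M (u 0) (prodApprox M (Fin.tail u)) - u 0 * ∏ i : Fin n, u i.succ|
        ≤ 2 * ((2 ^ (n + 1) - 2) / 4 ^ M) + 2 / 4 ^ M :=
          (abs_sub_le _ (mulApprox M (u 0) (∏ i : Fin n, u i.succ)) _).trans (by linarith)
      _ = (2 ^ (n + 1 + 1) - 2) / 4 ^ M := by
          field_simp
          ring

theorem abs_prodApprox_sub_le (M : ℕ) {n : ℕ} {u v : Fin n → ℝ} {r : ℝ} (hr : 0 ≤ r)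
    (h : ∀ i, |u i - v i| ≤ r) : |prodApprox M u - prodApprox M v| ≤ 4 ^ n * r := by
  suffices |prodApprox M u - prodApprox M v| ≤ (4 ^ n - 1) * r from this.trans (by linarith)
  induction n with
  | zero => simp [prodApprox]
  | succ n ih =>
    have ih : |prodApprox M (Fin.tail u) - prodApprox M (Fin.tail v)| ≤ _ := ih fun i => h i.succ
    have hpow : (1 : ℝ) ≤ 4 ^ n := one_le_pow₀ (by norm_num)
    rw [prodApprox, prodApprox]
    calc _ ≤ 2 * (r + (4 ^ n - 1) * r) :=
          (abs_mulApprox_sub_le M _ _ _ _).trans (by linarith [h 0])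
      _ ≤ (4 ^ (n + 1) - 1) * r := by
          rw [pow_succ]
          nlinarith

/-- The layer `(t, q) ↦ (tent t, q - c * tent t)` of the squaring network. -/
def sqLayer (c : ℝ) : Net 2 2 :=
  .hidden !![2, 0; -2, 0; 0, 1; 0, -1] ![-1, 1, 0, 0]
    (.out !![-1, -1, 0, 0; c, c, 1, -1] ![1, -c])

theorem eval_sqLayer (c t q : ℝ) : (sqLayer c).eval ![t, q] = ![tent t, q - c * tent t] := by
  have habs : max (t * 2 + -1) 0 + max (-(t * 2) + 1) 0 = |2 * t - 1| := by
    rw [mul_comm t, ← sub_eq_add_neg, ← sub_eq_neg_add, ← neg_sub (2 * t) 1,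
      max_zero_add_max_neg_zero_eq_abs_self]
  have hq : max q 0 - max (-q) 0 = q := max_zero_sub_eq_self q
  ext i
  fin_cases i
  · simp [sqLayer, Net.eval, dotProduct, Fin.sum_univ_four, tent]
    linear_combination -habs
  · simp [sqLayer, Net.eval, dotProduct, Fin.sum_univ_four, tent]
    linear_combination hq + c * habs

theorem exists_net_tent_sqApprox (M : ℕ) : ∃ N : Net 1 2, N.depth = M + 2 ∧ N.width ≤ 4 ∧
    ∀ x, N.eval x = ![tent^[M] |x 0|, sqApprox M (x 0)] := by
  induction M with
  | zero =>
    refine ⟨.hidden !![1; -1] 0 (.out !![1, 1; 1, 1] 0), rfl, by simp [Net.width], fun x => ?_⟩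
    ext i
    fin_cases i <;>
      simp [Net.eval, dotProduct, sqApprox, max_zero_add_max_neg_zero_eq_abs_self]
  | succ M ih =>
    obtain ⟨N, depth_N, width_N, eval_N⟩ := ih
    let T : Net 2 2 := sqLayer (1 / 4 ^ (M + 1))
    refine ⟨N.comp T, ?_, (N.width_comp_le T).trans ?_, fun x => ?_⟩
    · have depth_comp := N.depth_comp T
      have depth_T : T.depth = 2 := rfl
      omega
    · have width_T : T.width = 4 := rfl
      omega
    · rw [Net.eval_comp, eval_N, eval_sqLayer, sqApprox_succ, Function.iterate_succ_apply',
        one_div_mul_eq_div]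

theorem isRealizable_sqApprox (M : ℕ) :
    IsRealizable (k := 1) (M + 1 + 1) 4 fun z => sqApprox M (z 0) := by
  obtain ⟨N, depth_N, width_N, eval_N⟩ := exists_net_tent_sqApprox M
  let P : Net 2 1 := .out !![0, 1] 0
  refine ⟨N.comp P, ?_, (N.width_comp_le P).trans (max_le width_N ?_), fun x => ?_⟩
  · have depth_comp := N.depth_comp P
    have depth_P : P.depth = 1 := rfl
    omega
  · exact Nat.le_of_lt_succ (by decide : max 2 1 < 5)
  · rw [Net.eval_comp, eval_N]
    simp [P, Net.eval]

theorem IsRealizable.mulApprox {k L w w' : ℕ} {f g : (Fin k → ℝ) → ℝ} (M : ℕ)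
    (hf : IsRealizable L w f) (hg : IsRealizable L w' g) :
    IsRealizable (L + (M + 1)) (max (w + w') 4 + max (w + w') 4)
      fun x => Emulation.mulApprox M (f x) (g x) := by
  have hadd := (isRealizable_sqApprox M).comp ((hf.add hg).mul_add_const (1 / 2) 0)
  have hsub := (isRealizable_sqApprox M).comp
    ((hf.add (hg.mul_add_const (-1) 0)).mul_add_const (1 / 2) 0)
  convert hadd.add (hsub.mul_add_const (-1) 0) using 2 with x
  rw [Emulation.mulApprox]
  ring_nf

theorem exists_isRealizable_prodApprox (k w n : ℕ) :
    ∃ W : ℕ, ∀ (M : ℕ) (u : Fin n → (Fin k → ℝ) → ℝ), (∀ i, IsRealizable 2 w (u i)) →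
      IsRealizable (2 + n * (M + 1)) W fun x => prodApprox M fun i => u i x := by
  induction n with
  | zero =>
    exact ⟨max (k + 1) 2, fun M u _ => by simpa [prodApprox] using (IsRealizable.const k 1).pad 1⟩
  | succ n ih =>
    obtain ⟨W, hW⟩ := ih
    refine ⟨max (max w 2 + W) 4 + max (max w 2 + W) 4, fun M u hu => ?_⟩
    rw [add_one_mul, ← add_assoc]
    exact ((hu 0).pad (n * (M + 1))).mulApprox M (hW M (fun i => u i.succ) fun i => hu i.succ)

/-! ### Partial derivatives of smooth functions -/

/-- The space `ℝ^d` with the Euclidean norm, on which all functions of this development live. -/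
abbrev Pt (d : ℕ) : Type := EuclideanSpace ℝ (Fin d)

section Smooth

variable {d : ℕ}

theorem sum_apply_smul_single (v : Pt d) : ∑ i, v i • EuclideanSpace.single i (1 : ℝ) = v := by
  simpa using (EuclideanSpace.basisFun (Fin d) ℝ).sum_repr v

theorem abs_apply_sub_le (x y : Pt d) (i : Fin d) : |x i - y i| ≤ ‖x - y‖ :=
  PiLp.norm_apply_le (x - y) i

theorem norm_le_of_abs_apply_le {v : Pt d} {b : ℝ} (hv : ∀ i, |v i| ≤ b) : ‖v‖ ≤ d * b := by
  rw [← sum_apply_smul_single v]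
  calc ‖∑ i, v i • EuclideanSpace.single i (1 : ℝ)‖
      ≤ ∑ i, ‖v i • EuclideanSpace.single i (1 : ℝ)‖ := norm_sum_le _ _
    _ ≤ ∑ _i : Fin d, b := Finset.sum_le_sum fun i _ => by simpa [norm_smul] using hv i
    _ = d * b := by simp

theorem contDiff_partialDeriv {φ : Pt d → ℝ} (hφ : ContDiff ℝ ∞ φ) (i : Fin d) :
    ContDiff ℝ ∞ (partialDeriv i φ) :=
  (hφ.fderiv_right (m := ∞) (by simp)).clm_apply contDiff_const

theorem partialDeriv_partialDeriv_apply {φ : Pt d → ℝ} (hφ : ContDiff ℝ ∞ φ) (i j : Fin d)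
    (x : Pt d) : partialDeriv i (partialDeriv j φ) x =
      fderiv ℝ (fderiv ℝ φ) x (EuclideanSpace.single i 1) (EuclideanSpace.single j 1) := by
  have hdiff : Differentiable ℝ (fderiv ℝ φ) :=
    (hφ.fderiv_right (m := ∞) (by simp)).differentiable (by simp)
  unfold partialDeriv
  rw [fderiv_clm_apply (hdiff x) (differentiableAt_const _)]
  simp

theorem partialDeriv_comm {φ : Pt d → ℝ} (hφ : ContDiff ℝ ∞ φ) (i j : Fin d) :
    partialDeriv i (partialDeriv j φ) = partialDeriv j (partialDeriv i φ) := by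
  ext x
  have hdiff : DifferentiableAt ℝ (fderiv ℝ φ) x :=
    (hφ.fderiv_right (m := ∞) (by simp)).differentiable (by simp) x
  rw [partialDeriv_partialDeriv_apply hφ, partialDeriv_partialDeriv_apply hφ]
  exact second_derivative_symmetric (𝕜 := ℝ) (f := φ) (f' := fderiv ℝ φ)
    (fun y => (hφ.differentiable (by simp) y).hasFDerivAt) hdiff.hasFDerivAt _ _

theorem contDiff_iterate_partialDeriv {φ : Pt d → ℝ} (hφ : ContDiff ℝ ∞ φ) (j : Fin d) (m : ℕ) :
    ContDiff ℝ ∞ ((partialDeriv j)^[m] φ) := by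
  induction m with
  | zero => exact hφ
  | succ m ih =>
    rw [Function.iterate_succ_apply']
    exact contDiff_partialDeriv ih j

theorem iterate_partialDeriv_comm {φ : Pt d → ℝ} (hφ : ContDiff ℝ ∞ φ) (i j : Fin d) (m : ℕ) :
    (partialDeriv j)^[m] (partialDeriv i φ) = partialDeriv i ((partialDeriv j)^[m] φ) := by
  induction m with
  | zero => rfl
  | succ m ih =>
    rw [Function.iterate_succ_apply', Function.iterate_succ_apply', ih,
      partialDeriv_comm (contDiff_iterate_partialDeriv hφ j m)]

theorem multiDeriv_induction (P : ℕ → (Pt d → ℝ) → (Pt d → ℝ) → Prop)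
    (hP : ∀ k φ ψ i, P k φ ψ → P (k + 1) (partialDeriv i φ) (partialDeriv i ψ))
    (α : Fin d → ℕ) {φ ψ : Pt d → ℝ} (h : P 0 φ ψ) :
    P (∑ i, α i) (multiDeriv α φ) (multiDeriv α ψ) := by
  rw [Fin.sum_univ_def, multiDeriv, multiDeriv]
  induction List.finRange d with
  | nil => simpa only [List.map_nil, List.sum_nil, List.foldr_nil] using h
  | cons i l ih =>
    simp only [List.map_cons, List.sum_cons, List.foldr_cons]
    induction α i with
    | zero => simpa only [zero_add, Function.iterate_zero, id_eq] using ih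
    | succ m ihm =>
      rw [Function.iterate_succ_apply', Function.iterate_succ_apply', add_right_comm]
      exact hP _ _ _ _ ihm

theorem multiDeriv_zero (φ : Pt d → ℝ) : multiDeriv (0 : Fin d → ℕ) φ = φ := by
  unfold multiDeriv
  induction List.finRange d with
  | nil => rfl
  | cons i l ih => rw [List.foldr_cons, ih]; rfl

theorem multiDeriv_partialDeriv {φ : Pt d → ℝ} (hφ : ContDiff ℝ ∞ φ) (α : Fin d → ℕ) (i : Fin d) :
    multiDeriv α (partialDeriv i φ) = partialDeriv i (multiDeriv α φ) :=
  (multiDeriv_induction (fun _ φ ψ => ContDiff ℝ ∞ ψ ∧ φ = partialDeriv i ψ)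
    (fun _ φ ψ j h => ⟨contDiff_partialDeriv h.1 j, by rw [h.2, partialDeriv_comm h.1]⟩) α
    (ψ := φ) ⟨hφ, rfl⟩).2

theorem contDiff_foldr_iterate_partialDeriv {φ : Pt d → ℝ} (hφ : ContDiff ℝ ∞ φ) (α : Fin d → ℕ)
    (l : List (Fin d)) : ContDiff ℝ ∞ (l.foldr (fun j ψ => (partialDeriv j)^[α j] ψ) φ) := by
  induction l with
  | nil => exact hφ
  | cons j l ih => exact contDiff_iterate_partialDeriv ih j _

theorem foldr_iterate_partialDeriv_add_single {φ : Pt d → ℝ} (hφ : ContDiff ℝ ∞ φ)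
    (α : Fin d → ℕ) (i : Fin d) {l : List (Fin d)} (hl : l.Nodup) :
    l.foldr (fun j ψ => (partialDeriv j)^[(α + Pi.single i 1 : Fin d → ℕ) j] ψ) φ =
      if i ∈ l then partialDeriv i (l.foldr (fun j ψ => (partialDeriv j)^[α j] ψ) φ)
      else l.foldr (fun j ψ => (partialDeriv j)^[α j] ψ) φ := by
  induction l with
  | nil => simp only [List.foldr_nil, List.not_mem_nil, if_false]
  | cons j l ih =>
    obtain ⟨hj, hl⟩ := List.nodup_cons.1 hl
    have hsmooth := contDiff_foldr_iterate_partialDeriv hφ α l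
    simp only [List.foldr_cons, ih hl]
    by_cases hij : i = j
    · subst hij
      simp only [hj, if_false, List.mem_cons, true_or, if_true, Pi.add_apply, Pi.single_eq_same,
        Function.iterate_succ_apply']
    · simp only [List.mem_cons, hij, false_or, Pi.add_apply, Pi.single_eq_of_ne' hij, add_zero]
      split_ifs with h
      · exact iterate_partialDeriv_comm hsmooth i j _
      · rfl

theorem multiDeriv_add_single {φ : Pt d → ℝ} (hφ : ContDiff ℝ ∞ φ) (α : Fin d → ℕ) (i : Fin d) :
    multiDeriv (α + Pi.single i 1) φ = partialDeriv i (multiDeriv α φ) := by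
  have h := foldr_iterate_partialDeriv_add_single hφ α i (List.nodup_finRange d)
  rwa [if_pos (List.mem_finRange i)] at h

theorem tsupport_partialDeriv_subset (φ : Pt d → ℝ) (i : Fin d) :
    tsupport (partialDeriv i φ) ⊆ tsupport φ :=
  (closure_mono fun x hx => by
    contrapose! hx
    rw [Function.notMem_support] at hx ⊢
    rw [partialDeriv, hx, _root_.zero_apply]).trans (tsupport_fderiv_subset ℝ)

theorem tsupport_multiDeriv_subset (φ : Pt d → ℝ) (α : Fin d → ℕ) :
    tsupport (multiDeriv α φ) ⊆ tsupport φ :=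
  multiDeriv_induction (fun _ ψ _ => tsupport ψ ⊆ tsupport φ)
    (fun _ ψ _ i h => (tsupport_partialDeriv_subset ψ i).trans h) α (ψ := φ) subset_rfl

theorem partialDeriv_const_mul_comp_affine (F : Pt d → ℝ) (a c : ℝ) (v : Pt d) (i : Fin d)
    (x : Pt d) : partialDeriv i (fun x => a * F (c • x + v)) x =
      a * c * partialDeriv i F (c • x + v) := by
  have hsmul : (fun x => a * F (c • x + v)) = a • fun x => (fun z => F (z + v)) (c • x) := rfl
  have hfderiv : fderiv ℝ (fun x => (fun z => F (z + v)) (c • x)) x =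
      c • fderiv ℝ F (c • x + v) := by
    rw [fderiv_comp_smul (f := fun z => F (z + v)), fderiv_comp_add_right]
  rw [partialDeriv, hsmul, fderiv_const_smul_field, Pi.smul_apply, hfderiv]
  simp [partialDeriv, mul_assoc]

theorem multiDeriv_comp_sub (ρ : Pt d → ℝ) (x : Pt d) (α : Fin d → ℕ) (y : Pt d) :
    multiDeriv α (fun y => ρ (x - y)) y = (-1) ^ (∑ i, α i) * multiDeriv α ρ (x - y) := by
  refine congrFun (multiDeriv_induction
    (fun k φ ψ => φ = fun y => (-1) ^ k * ψ (x - y)) (fun k φ ψ i h => ?_) α (ψ := ρ) ?_) y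
  · ext y
    subst h
    have hderiv := partialDeriv_const_mul_comp_affine ψ ((-1) ^ k) (-1) x i y
    simp only [neg_smul, one_smul, neg_add_eq_sub] at hderiv
    rw [hderiv, pow_succ]
  · ext y
    rw [pow_zero, one_mul]

theorem norm_fderiv_le {F : Pt d → ℝ} {x : Pt d} {b : ℝ} (hb : 0 ≤ b)
    (h : ∀ i, |partialDeriv i F x| ≤ b) : ‖fderiv ℝ F x‖ ≤ d * b := by
  refine ContinuousLinearMap.opNorm_le_bound _ (by positivity) fun v => ?_
  conv_lhs => rw [← sum_apply_smul_single v, map_sum]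
  calc ‖∑ i, fderiv ℝ F x (v i • EuclideanSpace.single i (1 : ℝ))‖
      ≤ ∑ i, ‖fderiv ℝ F x (v i • EuclideanSpace.single i (1 : ℝ))‖ := norm_sum_le _ _
    _ ≤ ∑ _i : Fin d, b * ‖v‖ := by
        refine Finset.sum_le_sum fun i _ => ?_
        rw [map_smul, norm_smul, mul_comm]
        exact mul_le_mul (h i) (PiLp.norm_apply_le v i) (norm_nonneg _) hb
    _ = d * b * ‖v‖ := by simp [mul_assoc]

theorem abs_sub_le_of_abs_partialDeriv_le {K : Set (Pt d)} (hK : Convex ℝ K) {F : Pt d → ℝ}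
    (hF : Differentiable ℝ F) {b : ℝ} (hb : 0 ≤ b) (h : ∀ i, ∀ x ∈ K, |partialDeriv i F x| ≤ b)
    {x y : Pt d} (hx : x ∈ K) (hy : y ∈ K) : |F x - F y| ≤ d * b * ‖x - y‖ :=
  hK.norm_image_sub_le_of_norm_fderiv_le (𝕜 := ℝ) (fun z _ => hF z)
    (fun z hz => norm_fderiv_le hb fun i => h i z hz) hy hx

/-- All partial derivatives of `F` of order at most `n` are bounded by `B` on `K`. The recursion
over the first derivatives (instead of a bound for all `multiDeriv α F`) is the form in which
Taylor expansions use it. -/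
def DerivBdd (K : Set (Pt d)) (B : ℝ) : ℕ → (Pt d → ℝ) → Prop
  | 0, F => ∀ x ∈ K, |F x| ≤ B
  | n + 1, F => (∀ x ∈ K, |F x| ≤ B) ∧ ∀ i, DerivBdd K B n (partialDeriv i F)

theorem DerivBdd.abs_le {K : Set (Pt d)} {B : ℝ} {n : ℕ} {F : Pt d → ℝ} (h : DerivBdd K B n F)
    {x : Pt d} (hx : x ∈ K) : |F x| ≤ B := by
  cases n with
  | zero => exact h x hx
  | succ n => exact h.1 x hx

theorem DerivBdd.of_succ {K : Set (Pt d)} {B : ℝ} {n : ℕ} {F : Pt d → ℝ}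
    (h : DerivBdd K B (n + 1) F) : DerivBdd K B n F := by
  induction n generalizing F with
  | zero => exact h.1
  | succ n ih => exact ⟨h.1, fun i => ih (h.2 i)⟩

theorem DerivBdd.abs_sub_le {K : Set (Pt d)} (hK : Convex ℝ K) {B : ℝ} (hB : 0 ≤ B) {n : ℕ}
    {F : Pt d → ℝ} (hF : Differentiable ℝ F) (h : DerivBdd K B (n + 1) F) {x y : Pt d}
    (hx : x ∈ K) (hy : y ∈ K) : |F x - F y| ≤ d * B * ‖x - y‖ :=
  abs_sub_le_of_abs_partialDeriv_le hK hF hB (fun i _ hz => (h.2 i).abs_le hz) hx hy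

theorem derivBdd_of_abs_multiDeriv_le {K : Set (Pt d)} {B : ℝ} {n : ℕ} {F : Pt d → ℝ}
    (hF : ContDiff ℝ ∞ F) (h : ∀ α : Fin d → ℕ, ∑ i, α i ≤ n → ∀ x ∈ K, |multiDeriv α F x| ≤ B) :
    DerivBdd K B n F := by
  have hsup : ∀ x ∈ K, |F x| ≤ B := fun x hx => by
    simpa only [multiDeriv_zero] using h 0 (by simp) x hx
  induction n generalizing F with
  | zero => exact hsup
  | succ n ih =>
    have hpartial : ∀ i, ∀ α : Fin d → ℕ, ∑ i, α i ≤ n → ∀ x ∈ K,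
        |multiDeriv α (partialDeriv i F) x| ≤ B := fun i α hα x hx => by
      rw [multiDeriv_partialDeriv hF, ← multiDeriv_add_single hF]
      refine h _ ?_ x hx
      simp only [Pi.add_apply, Finset.sum_add_distrib, Finset.sum_pi_single', Finset.mem_univ,
        if_true]
      omega
    exact ⟨hsup, fun i => ih (contDiff_partialDeriv hF i) (hpartial i) fun x hx => by
      simpa only [multiDeriv_zero] using hpartial i 0 (by simp) x hx⟩

theorem DerivBdd.const_mul_comp_affine {K K' : Set (Pt d)} {B : ℝ} {n : ℕ} {F : Pt d → ℝ}
    (h : DerivBdd K B n F) {a c : ℝ} (ha : |a| ≤ 1) (hc : |c| ≤ 1) {v : Pt d}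
    (hv : ∀ x ∈ K', c • x + v ∈ K) : DerivBdd K' B n fun x => a * F (c • x + v) := by
  induction n generalizing F a with
  | zero =>
    intro x hx
    rw [abs_mul]
    exact (mul_le_of_le_one_left (abs_nonneg _) ha).trans (h _ (hv x hx))
  | succ n ih =>
    refine ⟨fun x hx => ?_, fun i => ?_⟩
    · rw [abs_mul]
      exact (mul_le_of_le_one_left (abs_nonneg _) ha).trans (h.1 _ (hv x hx))
    · rw [funext (partialDeriv_const_mul_comp_affine F a c v i)]
      exact ih (h.2 i) ((abs_mul a c).trans_le (mul_le_one₀ ha (abs_nonneg _) hc))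

end Smooth

/-! ### Mollification of functions with bounded weak derivatives -/

section Mollify

open Convolution ContinuousLinearMap Filter Topology

variable {d : ℕ}

/-- The cube `(t, 1 - t)^d`, on which a mollification at scale `t` of a function on the unit cube
makes sense. -/
def shrunkCube (d : ℕ) (t : ℝ) : Set (Pt d) := {x | ∀ i, x i ∈ Set.Ioo t (1 - t)}

/-- The closed unit cube `[0, 1]^d`. -/
def closedCube (d : ℕ) : Set (Pt d) := {x | ∀ i, x i ∈ Set.Icc 0 1}

theorem convex_setOf_forall_apply_mem {I : Set ℝ} (hI : Convex ℝ I) :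
    Convex ℝ {x : Pt d | ∀ i, x i ∈ I} := by
  rw [Set.ofPred_forall]
  exact convex_iInter fun i => hI.is_linear_preimage ⟨fun _ _ => rfl, fun _ _ => rfl⟩

theorem convex_shrunkCube (d : ℕ) (t : ℝ) : Convex ℝ (shrunkCube d t) :=
  convex_setOf_forall_apply_mem (convex_Ioo t (1 - t))

theorem convex_closedCube (d : ℕ) : Convex ℝ (closedCube d) :=
  convex_setOf_forall_apply_mem (convex_Icc 0 1)

theorem cube_subset_closedCube : cube d ⊆ closedCube d :=
  fun _ hx i => ⟨(hx i).1.le, (hx i).2.le⟩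

theorem isOpen_cube : IsOpen (cube d) := by
  simp only [cube, Set.ofPred_forall]
  exact isOpen_iInter_of_finite fun i =>
    isOpen_Ioo.preimage (by fun_prop : Continuous fun x : Pt d => x i)

theorem measurableSet_cube : MeasurableSet (cube d) :=
  isOpen_cube.measurableSet

instance isFiniteMeasure_cubeMeasure : IsFiniteMeasure (cubeMeasure d) := by
  refine ⟨?_⟩
  have hcube : cube d ⊆ Metric.closedBall (0 : Pt d) (d * 1) := fun x hx =>
    mem_closedBall_zero_iff.2 <| norm_le_of_abs_apply_le fun i => by
      rw [abs_of_pos (hx i).1]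
      exact (hx i).2.le
  rw [cubeMeasure, Measure.restrict_apply_univ]
  exact (measure_mono hcube).trans_lt measure_closedBall_lt_top

theorem closedBall_subset_cube {t : ℝ} {x : Pt d} (hx : x ∈ shrunkCube d t) :
    Metric.closedBall x t ⊆ cube d := by
  intro y hy i
  obtain ⟨hlow, hupp⟩ := abs_le.1 ((abs_apply_sub_le y x i).trans (mem_closedBall_iff_norm.1 hy))
  obtain ⟨hx0, hx1⟩ := hx i
  constructor <;> linarith

theorem eventually_mem_shrunkCube {r : ℕ → ℝ} (hr : Tendsto r atTop (𝓝 0)) {x : Pt d}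
    (hx : x ∈ cube d) : ∀ᶠ k in atTop, x ∈ shrunkCube d (r k) := by
  simp only [shrunkCube, Set.mem_ofPred_eq, eventually_all]
  intro i
  filter_upwards [hr.eventually (gt_mem_nhds (hx i).1),
    hr.eventually (gt_mem_nhds (sub_pos.2 (hx i).2))] with k hleft hright
  exact ⟨hleft, by linarith⟩

theorem convolution_lsmul_comm (f ρ : Pt d → ℝ) :
    ρ ⋆[lsmul ℝ ℝ, volume] f = f ⋆[lsmul ℝ ℝ, volume] ρ := by
  ext x
  rw [convolution_lsmul_swap, convolution_def]
  simp [mul_comm]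

theorem contDiff_convolution_normed {f : Pt d → ℝ} (hf : LocallyIntegrable f)
    (b : ContDiffBump (0 : Pt d)) :
    ContDiff ℝ ∞ (f ⋆[lsmul ℝ ℝ, volume] b.normed volume) :=
  b.hasCompactSupport_normed.contDiff_convolution_right _ hf b.contDiff_normed

theorem partialDeriv_convolution {f ρ : Pt d → ℝ} (hf : LocallyIntegrable f)
    (hρ : ContDiff ℝ ∞ ρ) (hρc : HasCompactSupport ρ) (i : Fin d) :
    partialDeriv i (f ⋆[lsmul ℝ ℝ, volume] ρ) = f ⋆[lsmul ℝ ℝ, volume] partialDeriv i ρ := by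
  ext x
  have hρ1 : ContDiff ℝ 1 ρ := hρ.of_le (by simp)
  rw [partialDeriv, (hρc.hasFDerivAt_convolution_right (lsmul ℝ ℝ) hf hρ1 x).fderiv,
    convolution_precompR_apply _ hf (hρc.fderiv ℝ) (hρ1.continuous_fderiv one_ne_zero)]
  rfl

theorem multiDeriv_convolution {f ρ : Pt d → ℝ} (hf : LocallyIntegrable f)
    (hρ : ContDiff ℝ ∞ ρ) (hρc : HasCompactSupport ρ) (α : Fin d → ℕ) :
    multiDeriv α (f ⋆[lsmul ℝ ℝ, volume] ρ) = f ⋆[lsmul ℝ ℝ, volume] multiDeriv α ρ :=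
  (multiDeriv_induction (fun _ φ ψ => ContDiff ℝ ∞ ψ ∧ HasCompactSupport ψ ∧
    φ = f ⋆[lsmul ℝ ℝ, volume] ψ) (fun _ _ ψ j h => ⟨contDiff_partialDeriv h.1 j,
      h.2.1.mono' (subset_closure.trans (tsupport_partialDeriv_subset ψ j)), by
        rw [h.2.2, partialDeriv_convolution hf h.1 h.2.1]⟩) α ⟨hρ, hρc, rfl⟩).2.2

theorem mem_closedBall_of_apply_sub_ne_zero {b : ContDiffBump (0 : Pt d)} {ψ : Pt d → ℝ}
    (hψ : tsupport ψ ⊆ tsupport (b.normed volume)) {x y : Pt d} (hy : ψ (x - y) ≠ 0) :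
    y ∈ Metric.closedBall x b.rOut := by
  have hmem := hψ (subset_tsupport _ (Function.mem_support.2 hy))
  rw [b.tsupport_normed_eq, mem_closedBall_zero_iff] at hmem
  rwa [mem_closedBall_iff_norm']

theorem IsWeakDeriv.multiDeriv_convolution_apply {f g : Pt d → ℝ} {α : Fin d → ℕ}
    (hg : IsWeakDeriv α f g) (hf : LocallyIntegrable f) (b : ContDiffBump (0 : Pt d)) {x : Pt d}
    (hx : Metric.closedBall x b.rOut ⊆ cube d) :
    multiDeriv α (f ⋆[lsmul ℝ ℝ, volume] b.normed volume) x =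
      ∫ y, g y * b.normed volume (x - y) ∂(cubeMeasure d) := by
  have htest : tsupport (fun y => b.normed volume (x - y)) ⊆ Metric.closedBall x b.rOut :=
    closure_minimal (fun _ hy => mem_closedBall_of_apply_sub_ne_zero subset_rfl hy)
      Metric.isClosed_closedBall
  have hweak := hg (fun y => b.normed volume (x - y))
    (b.contDiff_normed.comp (contDiff_const.sub contDiff_id))
    ((isCompact_closedBall x b.rOut).of_isClosed_subset (isClosed_tsupport _) htest)
    (htest.trans hx)
  simp only [multiDeriv_comp_sub, mul_left_comm (f _), integral_const_mul] at hweak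
  rw [multiDeriv_convolution hf b.contDiff_normed b.hasCompactSupport_normed, convolution_def,
    ← mul_left_cancel₀ (by positivity : ((-1 : ℝ) ^ (∑ i, α i)) ≠ 0) hweak]
  refine (setIntegral_eq_integral_of_forall_compl_eq_zero fun y hy => ?_).symm
  have hzero : multiDeriv α (b.normed volume) (x - y) = 0 := by
    by_contra hne
    exact hy (hx (mem_closedBall_of_apply_sub_ne_zero (tsupport_multiDeriv_subset _ α) hne))
  simp only [hzero, map_zero]

theorem abs_integral_mul_normed_le {g : Pt d → ℝ} {B : ℝ} (hB : 0 ≤ B)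
    (hg : ∀ᵐ y ∂(cubeMeasure d), |g y| ≤ B) (b : ContDiffBump (0 : Pt d)) (x : Pt d) :
    |∫ y, g y * b.normed volume (x - y) ∂(cubeMeasure d)| ≤ B := by
  have hint : Integrable (fun y => b.normed volume (x - y)) :=
    b.integrable_normed.comp_sub_left x
  calc |∫ y, g y * b.normed volume (x - y) ∂(cubeMeasure d)|
      ≤ ∫ y, B * b.normed volume (x - y) ∂(cubeMeasure d) := by
        rw [← Real.norm_eq_abs]
        refine norm_integral_le_of_norm_le (hint.restrict.const_mul B) ?_
        filter_upwards [hg] with y hy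
        rw [Real.norm_eq_abs, abs_mul, abs_of_nonneg (b.nonneg_normed _)]
        exact mul_le_mul_of_nonneg_right hy (b.nonneg_normed _)
    _ ≤ ∫ y, B * b.normed volume (x - y) :=
        setIntegral_le_integral (hint.const_mul B)
          (Eventually.of_forall fun y => mul_nonneg hB (b.nonneg_normed _))
    _ = B := by
        rw [integral_const_mul, integral_sub_left_eq_self (b.normed volume) volume x,
          b.integral_normed, mul_one]

/-- `f` has weak derivatives on the cube up to order `n`, bounded by `B`: the ball of radius `B` in
`W^{n,∞}`, without reference to the choice in `weakDeriv`. -/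
def WeakDerivBdd (n : ℕ) (B : ℝ) (f : Pt d → ℝ) : Prop :=
  ∀ α : Fin d → ℕ, ∑ i, α i ≤ n → ∃ g, IsWeakDeriv α f g ∧ ∀ᵐ y ∂(cubeMeasure d), |g y| ≤ B

theorem weakDerivBdd_of_sobolevNorm_le {n : ℕ} {B : ℝ} (hB : 0 ≤ B) {f : Pt d → ℝ}
    (h : MemSobolev n ∞ f) (hf : sobolevNorm n f ≤ ENNReal.ofReal B) : WeakDerivBdd n B f := by
  intro α hα
  have hweak : IsWeakDeriv α f (weakDeriv α f) := by
    rw [weakDeriv, dif_pos (h.2 α hα)]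
    exact (h.2 α hα).choose_spec.2
  refine ⟨weakDeriv α f, hweak, ?_⟩
  have hnorm : eLpNorm (weakDeriv α f) ∞ (cubeMeasure d) ≤ ENNReal.ofReal B :=
    (le_iSup₂ (f := fun (α : Fin d → ℕ) (_ : ∑ i, α i ≤ n) =>
      eLpNorm (weakDeriv α f) ∞ (cubeMeasure d)) α hα).trans hf
  rw [eLpNorm_exponent_top] at hnorm
  filter_upwards [ae_le_eLpNormEssSup (f := weakDeriv α f) (μ := cubeMeasure d)] with y hy
  rw [← Real.norm_eq_abs, ← ENNReal.ofReal_le_ofReal_iff hB, ofReal_norm]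
  exact hy.trans hnorm

theorem WeakDerivBdd.of_le {m n : ℕ} (hmn : m ≤ n) {B : ℝ} {f : Pt d → ℝ}
    (h : WeakDerivBdd n B f) : WeakDerivBdd m B f :=
  fun α hα => h α (hα.trans hmn)

theorem WeakDerivBdd.congr {n : ℕ} {B : ℝ} {f f' : Pt d → ℝ} (h : WeakDerivBdd n B f)
    (hff' : f =ᵐ[cubeMeasure d] f') : WeakDerivBdd n B f' := by
  intro α hα
  obtain ⟨g, hg, hgB⟩ := h α hα
  refine ⟨g, fun φ hφ hφc hφs => ?_, hgB⟩
  rw [← hg φ hφ hφc hφs]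
  exact integral_congr_ae (hff'.symm.mul .rfl)

theorem WeakDerivBdd.derivBdd_convolution {n : ℕ} {B : ℝ} (hB : 0 ≤ B) {f : Pt d → ℝ}
    (h : WeakDerivBdd n B f) (hf : LocallyIntegrable f) (b : ContDiffBump (0 : Pt d)) :
    DerivBdd (shrunkCube d b.rOut) B n (f ⋆[lsmul ℝ ℝ, volume] b.normed volume) := by
  refine derivBdd_of_abs_multiDeriv_le (contDiff_convolution_normed hf b) fun α hα x hx => ?_
  obtain ⟨g, hg, hgB⟩ := h α hα
  rw [hg.multiDeriv_convolution_apply hf b (closedBall_subset_cube hx)]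
  exact abs_integral_mul_normed_le hB hgB b x

theorem WeakDerivBdd.abs_sub_le_of_tendsto {B : ℝ} (hB : 0 ≤ B) {f : Pt d → ℝ}
    (h : WeakDerivBdd 1 B f) (hf : LocallyIntegrable f) {b : ℕ → ContDiffBump (0 : Pt d)}
    (hb : Tendsto (fun k => (b k).rOut) atTop (𝓝 0)) {x y : Pt d} (hx : x ∈ cube d)
    (hy : y ∈ cube d)
    (hfx : Tendsto (fun k => (f ⋆[lsmul ℝ ℝ, volume] (b k).normed volume) x) atTop (𝓝 (f x)))
    (hfy : Tendsto (fun k => (f ⋆[lsmul ℝ ℝ, volume] (b k).normed volume) y) atTop (𝓝 (f y))) :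
    |f x - f y| ≤ d * B * ‖x - y‖ := by
  refine le_of_tendsto (hfx.sub hfy).abs ?_
  filter_upwards [eventually_mem_shrunkCube hb hx, eventually_mem_shrunkCube hb hy] with k hxk hyk
  exact (h.derivBdd_convolution hB hf (b k)).abs_sub_le (convex_shrunkCube d _) hB
    ((contDiff_convolution_normed hf (b k)).differentiable (by simp)) hxk hyk

theorem WeakDerivBdd.exists_lipschitz {B : ℝ} (hB : 0 ≤ B) {f : Pt d → ℝ}
    (hf : MemLp f ∞ (cubeMeasure d)) (h : WeakDerivBdd 1 B f) :
    ∃ f' : Pt d → ℝ, f =ᵐ[cubeMeasure d] f' ∧ ∀ x y, |f' x - f' y| ≤ d * B * ‖x - y‖ := by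
  set f₀ : Pt d → ℝ := (cube d).indicator f with hf₀
  have hff₀ : f =ᵐ[cubeMeasure d] f₀ := (indicator_ae_eq_restrict measurableSet_cube).symm
  have hint : LocallyIntegrable f₀ := by
    refine Integrable.locallyIntegrable ?_
    rw [hf₀, integrable_indicator_iff measurableSet_cube]
    exact hf.integrable le_top
  let b : ℕ → ContDiffBump (0 : Pt d) := fun k =>
    ⟨1 / (k + 1) / 2, 1 / (k + 1), by positivity, half_lt_self (by positivity)⟩
  have hb : Tendsto (fun k => (b k).rOut) atTop (𝓝 0) := tendsto_one_div_add_atTop_nhds_zero_nat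
  have hae := ContDiffBump.ae_convolution_tendsto_right_of_locallyIntegrable (K := 2) hb
    (Eventually.of_forall fun k => by simp only [b]; linarith) hint
  simp only [convolution_lsmul_comm] at hae
  set T : Set (Pt d) := {x | x ∈ cube d ∧ Tendsto (fun k =>
    (f₀ ⋆[lsmul ℝ ℝ, volume] (b k).normed volume) x) atTop (𝓝 (f₀ x))}
  have hconst : ((d * B).toNNReal : ℝ) = d * B := Real.coe_toNNReal _ (by positivity)
  have hLip : LipschitzOnWith (d * B).toNNReal f₀ T := by
    refine LipschitzOnWith.of_dist_le_mul fun x hx y hy => ?_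
    rw [hconst, dist_eq_norm x y, Real.dist_eq]
    exact (h.congr hff₀).abs_sub_le_of_tendsto hB hint hb hx.1 hy.1 hx.2 hy.2
  obtain ⟨f', hf', heq⟩ := hLip.extend_real
  refine ⟨f', hff₀.trans ?_, fun x y => ?_⟩
  · rw [EventuallyEq, cubeMeasure, ae_restrict_iff' measurableSet_cube]
    filter_upwards [hae] with x hx hxc
    exact heq ⟨hxc, hx⟩
  · simpa only [hconst, dist_eq_norm x y, Real.dist_eq] using hf'.dist_le_mul x y

theorem abs_convolution_normed_sub_le {Λ : ℝ} {f : Pt d → ℝ} (hcont : Continuous f) (hΛ : 0 ≤ Λ)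
    (hf : ∀ x y, |f x - f y| ≤ Λ * ‖x - y‖) (b : ContDiffBump (0 : Pt d)) (x : Pt d) :
    |(f ⋆[lsmul ℝ ℝ, volume] b.normed volume) x - f x| ≤ Λ * b.rOut := by
  rw [← convolution_lsmul_comm, ← Real.dist_eq]
  refine ContDiffBump.dist_normed_convolution_le hcont.aestronglyMeasurable fun y hy => ?_
  rw [Real.dist_eq]
  refine (hf y x).trans (mul_le_mul_of_nonneg_left ?_ hΛ)
  rw [← dist_eq_norm]
  exact (Metric.mem_ball.1 hy).le

/-- The homothety of ratio `1 - 4t` about the centre of the unit cube. It maps the closed unit cube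
into `shrunkCube d t`, so that mollifications become defined up to the boundary. -/
def shrink (t : ℝ) (x : Pt d) : Pt d := (1 - 4 * t) • x + WithLp.toLp 2 fun _ => 2 * t

theorem shrink_apply (t : ℝ) (x : Pt d) (i : Fin d) :
    shrink t x i = (1 - 4 * t) * x i + 2 * t := rfl

theorem shrink_mem_shrunkCube {t : ℝ} (ht : 0 < t) (ht4 : t ≤ 1 / 4) {x : Pt d}
    (hx : x ∈ closedCube d) : shrink t x ∈ shrunkCube d t := by
  intro i
  obtain ⟨hx0, hx1⟩ := hx i
  rw [shrink_apply]
  constructor <;> nlinarith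

theorem norm_shrink_sub_le {t : ℝ} (ht : 0 ≤ t) {x : Pt d} (hx : x ∈ closedCube d) :
    ‖shrink t x - x‖ ≤ d * (2 * t) := by
  refine norm_le_of_abs_apply_le fun i => ?_
  obtain ⟨hx0, hx1⟩ := hx i
  rw [PiLp.sub_apply, shrink_apply, abs_le]
  constructor <;> nlinarith

theorem exists_mul_le {L δ : ℝ} (hL : 0 ≤ L) (hδ : 0 < δ) :
    ∃ t : ℝ, 0 < t ∧ t ≤ 1 / 4 ∧ L * t ≤ δ :=
  ⟨min (1 / 4) (δ / (L + 1)), by positivity, min_le_left _ _,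
    calc L * min (1 / 4) (δ / (L + 1)) ≤ (L + 1) * (δ / (L + 1)) :=
          mul_le_mul (by linarith) (min_le_right _ _) (by positivity) (by positivity)
      _ = δ := by field_simp⟩

theorem WeakDerivBdd.exists_smooth_approx {n : ℕ} {B Λ : ℝ} (hB : 0 ≤ B) (hΛ : 0 ≤ Λ)
    {f : Pt d → ℝ} (h : WeakDerivBdd n B f) (hf : ∀ x y, |f x - f y| ≤ Λ * ‖x - y‖) {δ : ℝ}
    (hδ : 0 < δ) : ∃ F : Pt d → ℝ, ContDiff ℝ ∞ F ∧ DerivBdd (closedCube d) B n F ∧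
      ∀ x ∈ closedCube d, |F x - f x| ≤ δ := by
  have hcont : Continuous f :=
    (LipschitzWith.of_dist_le_mul (K := ⟨Λ, hΛ⟩) fun x y => by
      rw [Real.dist_eq, dist_eq_norm x y]; exact hf x y).continuous
  obtain ⟨t, ht, ht4, htδ⟩ := exists_mul_le (L := Λ * (1 + 2 * d)) (by positivity) hδ
  let b : ContDiffBump (0 : Pt d) := ⟨t / 2, t, by positivity, half_lt_self ht⟩
  set g := f ⋆[lsmul ℝ ℝ, volume] b.normed volume
  refine ⟨fun x => 1 * g (shrink t x), ?_, ?_, fun x hx => ?_⟩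
  · exact contDiff_const.mul ((contDiff_convolution_normed hcont.locallyIntegrable b).comp
      ((contDiff_id.const_smul (1 - 4 * t)).add contDiff_const))
  · refine (h.derivBdd_convolution hB hcont.locallyIntegrable b).const_mul_comp_affine
      (by simp) ?_ fun x hx => shrink_mem_shrunkCube ht ht4 hx
    rw [abs_le]
    constructor <;> linarith
  · calc |1 * g (shrink t x) - f x|
        ≤ |g (shrink t x) - f (shrink t x)| + |f (shrink t x) - f x| := by
          rw [one_mul]
          exact abs_sub_le _ _ _
      _ ≤ Λ * t + Λ * (d * (2 * t)) :=
          add_le_add (abs_convolution_normed_sub_le hcont hΛ hf b _)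
            ((hf _ x).trans (mul_le_mul_of_nonneg_left (norm_shrink_sub_le ht.le hx) hΛ))
      _ = Λ * (1 + 2 * d) * t := by ring
      _ ≤ δ := htδ

end Mollify

/-! ### Taylor polynomials -/

section Taylor

variable {d : ℕ}

/-- The `k`-th derivative of `F` at `x₀` as a form of degree `k`: `v ↦ (v · ∇)^k F (x₀)`. -/
def taylorForm (x₀ : Pt d) : ℕ → (Pt d → ℝ) → Pt d → ℝ
  | 0, F, _ => F x₀
  | k + 1, F, v => ∑ i, v i * taylorForm x₀ k (partialDeriv i F) v

/-- The Taylor polynomial of degree less than `n` at `x₀`, as a function of the increment. -/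
def taylorPoly (x₀ : Pt d) (n : ℕ) (F : Pt d → ℝ) (v : Pt d) : ℝ :=
  ∑ k ∈ Finset.range n, taylorForm x₀ k F v / k.factorial

/-- The remainder of order `n` of the Taylor expansion at `x₀`, as a function of the point. -/
def taylorRem (x₀ : Pt d) (n : ℕ) (F : Pt d → ℝ) (x : Pt d) : ℝ :=
  F x - taylorPoly x₀ n F (x - x₀)

theorem contDiff_taylorForm (x₀ : Pt d) (k : ℕ) (F : Pt d → ℝ) :
    ContDiff ℝ ∞ (taylorForm x₀ k F) := by
  induction k generalizing F with
  | zero => exact contDiff_const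
  | succ k ih =>
    exact ContDiff.sum fun i _ => (EuclideanSpace.proj (𝕜 := ℝ) i).contDiff.mul (ih _)

theorem contDiff_taylorPoly (x₀ : Pt d) (n : ℕ) (F : Pt d → ℝ) :
    ContDiff ℝ ∞ (taylorPoly x₀ n F) :=
  ContDiff.sum fun k _ => (contDiff_taylorForm x₀ k F).div_const _

theorem contDiff_taylorRem (x₀ : Pt d) (n : ℕ) {F : Pt d → ℝ} (hF : ContDiff ℝ ∞ F) :
    ContDiff ℝ ∞ (taylorRem x₀ n F) :=
  hF.sub ((contDiff_taylorPoly x₀ n F).comp (contDiff_id.sub contDiff_const))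

theorem partialDeriv_sum_apply_mul {g : Fin d → Pt d → ℝ} {v : Pt d}
    (hg : ∀ j, DifferentiableAt ℝ (g j) v) (i : Fin d) :
    partialDeriv i (fun v => ∑ j, v j * g j v) v =
      g i v + ∑ j, v j * partialDeriv i (g j) v := by
  have hderiv : HasFDerivAt (fun v : Pt d => ∑ j, v j * g j v)
      (∑ j, (v j • fderiv ℝ (g j) v + g j v • EuclideanSpace.proj (𝕜 := ℝ) j)) v :=
    HasFDerivAt.fun_sum fun j _ =>
      (EuclideanSpace.proj (𝕜 := ℝ) j).hasFDerivAt.mul (hg j).hasFDerivAt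
  rw [partialDeriv, hderiv.fderiv]
  simp [Finset.sum_add_distrib, partialDeriv, add_comm]

theorem partialDeriv_taylorForm_eq_add_sum (x₀ : Pt d) (k : ℕ) (F : Pt d → ℝ) (i : Fin d)
    (v : Pt d) : partialDeriv i (taylorForm x₀ (k + 1) F) v =
      taylorForm x₀ k (partialDeriv i F) v +
        ∑ j, v j * partialDeriv i (taylorForm x₀ k (partialDeriv j F)) v :=
  partialDeriv_sum_apply_mul (fun _ => (contDiff_taylorForm x₀ k _).differentiable (by simp) v) i

theorem partialDeriv_taylorForm (x₀ : Pt d) (k : ℕ) {F : Pt d → ℝ} (hF : ContDiff ℝ ∞ F)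
    (i : Fin d) (v : Pt d) : partialDeriv i (taylorForm x₀ (k + 1) F) v =
      (k + 1) * taylorForm x₀ k (partialDeriv i F) v := by
  rw [partialDeriv_taylorForm_eq_add_sum]
  induction k generalizing F with
  | zero => simp [taylorForm, partialDeriv]
  | succ k ih =>
    have hterm : ∀ j, v j * partialDeriv i (taylorForm x₀ (k + 1) (partialDeriv j F)) v =
        (k + 1) * (v j * taylorForm x₀ k (partialDeriv j (partialDeriv i F)) v) := fun j => by
      rw [partialDeriv_taylorForm_eq_add_sum, ih (contDiff_partialDeriv hF j),
        partialDeriv_comm hF i j]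
      ring
    rw [Finset.sum_congr rfl fun j _ => hterm j, ← Finset.mul_sum]
    change _ + _ * taylorForm x₀ (k + 1) (partialDeriv i F) v = _
    push_cast
    ring

theorem taylorPoly_succ (x₀ : Pt d) (n : ℕ) (F : Pt d → ℝ) (v : Pt d) :
    taylorPoly x₀ (n + 1) F v =
      ∑ k ∈ Finset.range n, taylorForm x₀ (k + 1) F v / (k + 1).factorial + F x₀ := by
  simp [taylorPoly, Finset.sum_range_succ', taylorForm]

theorem partialDeriv_taylorPoly (x₀ : Pt d) (n : ℕ) {F : Pt d → ℝ} (hF : ContDiff ℝ ∞ F)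
    (i : Fin d) (v : Pt d) : partialDeriv i (taylorPoly x₀ (n + 1) F) v =
      taylorPoly x₀ n (partialDeriv i F) v := by
  have hderiv : HasFDerivAt (fun v : Pt d =>
      ∑ k ∈ Finset.range n, taylorForm x₀ (k + 1) F v / (k + 1).factorial + F x₀)
      (∑ k ∈ Finset.range n, ((k + 1).factorial : ℝ)⁻¹ • fderiv ℝ (taylorForm x₀ (k + 1) F) v)
      v := by
    simp only [div_eq_inv_mul]
    exact (HasFDerivAt.fun_sum fun k _ => (((contDiff_taylorForm x₀ (k + 1) F).differentiable
      (by simp)) v).hasFDerivAt.const_mul _).add_const _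
  rw [partialDeriv, funext (taylorPoly_succ x₀ n F), hderiv.fderiv, taylorPoly, _root_.sum_apply]
  refine Finset.sum_congr rfl fun k _ => ?_
  rw [_root_.smul_apply, ← partialDeriv, partialDeriv_taylorForm x₀ k hF i v, Nat.factorial_succ,
    smul_eq_mul]
  push_cast
  field_simp

theorem partialDeriv_taylorRem (x₀ : Pt d) (n : ℕ) {F : Pt d → ℝ} (hF : ContDiff ℝ ∞ F)
    (i : Fin d) (x : Pt d) : partialDeriv i (taylorRem x₀ (n + 1) F) x =
      taylorRem x₀ n (partialDeriv i F) x := by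
  have hpoly : DifferentiableAt ℝ (taylorPoly x₀ (n + 1) F) (x - x₀) :=
    (contDiff_taylorPoly x₀ (n + 1) F).differentiable (by simp) _
  have hderiv : HasFDerivAt (taylorRem x₀ (n + 1) F)
      (fderiv ℝ F x - fderiv ℝ (taylorPoly x₀ (n + 1) F) (x - x₀)) x := by
    refine (hF.differentiable (by simp) x).hasFDerivAt.sub ?_
    exact hpoly.hasFDerivAt.comp x ((hasFDerivAt_id x).sub_const x₀)
  rw [partialDeriv, hderiv.fderiv, _root_.sub_apply, taylorRem, ← partialDeriv_taylorPoly x₀ n hF]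
  rfl

theorem taylorRem_self (x₀ : Pt d) (n : ℕ) (F : Pt d → ℝ) : taylorRem x₀ (n + 1) F x₀ = 0 := by
  simp [taylorRem, taylorPoly_succ, taylorForm]

theorem abs_taylorRem_le {K : Set (Pt d)} (hK : Convex ℝ K) {B : ℝ} (hB : 0 ≤ B) {x₀ : Pt d}
    (hx₀ : x₀ ∈ K) (n : ℕ) {F : Pt d → ℝ} (hF : ContDiff ℝ ∞ F) (h : DerivBdd K B n F) {x : Pt d}
    (hx : x ∈ K) : |taylorRem x₀ n F x| ≤ B * (d * ‖x - x₀‖) ^ n := by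
  induction n generalizing F x with
  | zero => simpa [taylorRem, taylorPoly] using h x hx
  | succ n ih =>
    have hpartial : ∀ i, ∀ z ∈ K ∩ Metric.closedBall x₀ ‖x - x₀‖,
        |partialDeriv i (taylorRem x₀ (n + 1) F) z| ≤ B * (d * ‖x - x₀‖) ^ n := fun i z hz => by
      rw [partialDeriv_taylorRem x₀ n hF]
      refine (ih (contDiff_partialDeriv hF i) (h.2 i) hz.1).trans ?_
      have := mem_closedBall_iff_norm.1 hz.2
      gcongr
    have hmean := abs_sub_le_of_abs_partialDeriv_le (hK.inter (convex_closedBall x₀ ‖x - x₀‖))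
      ((contDiff_taylorRem x₀ (n + 1) hF).differentiable (by simp)) (by positivity) hpartial
      ⟨hx, mem_closedBall_iff_norm.2 le_rfl⟩ ⟨hx₀, Metric.mem_closedBall_self (norm_nonneg _)⟩
    rw [taylorRem_self, sub_zero] at hmean
    exact hmean.trans_eq (by ring)

theorem abs_taylorRem_sub_le {K : Set (Pt d)} (hK : Convex ℝ K) {B : ℝ} (hB : 0 ≤ B) {x₀ : Pt d}
    (hx₀ : x₀ ∈ K) (n : ℕ) {F : Pt d → ℝ} (hF : ContDiff ℝ ∞ F) (h : DerivBdd K B (n + 1) F)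
    {x y : Pt d} (hx : x ∈ K) (hy : y ∈ K) {r : ℝ} (hxr : ‖x - x₀‖ ≤ r) (hyr : ‖y - x₀‖ ≤ r) :
    |taylorRem x₀ (n + 1) F x - taylorRem x₀ (n + 1) F y| ≤ d * (B * (d * r) ^ n) * ‖x - y‖ := by
  have hr : 0 ≤ r := (norm_nonneg _).trans hxr
  refine abs_sub_le_of_abs_partialDeriv_le (hK.inter (convex_closedBall x₀ r))
    ((contDiff_taylorRem x₀ (n + 1) hF).differentiable (by simp)) (by positivity)
    (fun i z hz => ?_) ⟨hx, mem_closedBall_iff_norm.2 hxr⟩ ⟨hy, mem_closedBall_iff_norm.2 hyr⟩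
  rw [partialDeriv_taylorRem x₀ n hF]
  refine (abs_taylorRem_le hK hB hx₀ n (contDiff_partialDeriv hF i) (h.2 i) hz.1).trans ?_
  have := mem_closedBall_iff_norm.1 hz.2
  gcongr

/-- A factor of a monomial: a coordinate, or the constant `1` for `none`, which pads monomials of
low degree. -/
def optCoord (v : Pt d) : Option (Fin d) → ℝ
  | none => 1
  | some i => v i

/-- `p` is a polynomial of degree at most `k` with coefficients bounded by `C`, written as a
combination of products of exactly `k` factors that are coordinates or `1`. -/
def IsPoly (k : ℕ) (C : ℝ) (p : Pt d → ℝ) : Prop :=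
  ∃ c : (Fin k → Option (Fin d)) → ℝ, (∀ τ, |c τ| ≤ C) ∧
    ∀ v, p v = ∑ τ, c τ * ∏ j, optCoord v (τ j)

theorem isPoly_zero (k : ℕ) {C : ℝ} (hC : 0 ≤ C) : IsPoly (d := d) k C fun _ => 0 :=
  ⟨0, fun _ => by simpa only [Pi.zero_apply, abs_zero] using hC, fun _ => by simp⟩

theorem IsPoly.sum_optCoord_mul {k : ℕ} {C : ℝ} {p : Option (Fin d) → Pt d → ℝ}
    (hp : ∀ o, IsPoly k C (p o)) : IsPoly (k + 1) C fun v => ∑ o, optCoord v o * p o v := by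
  choose c hc hp using hp
  refine ⟨fun τ => c (τ 0) (Fin.tail τ), fun τ => hc _ _, fun v => ?_⟩
  rw [← (Fin.consEquiv fun _ => Option (Fin d)).sum_comp, Fintype.sum_prod_type]
  refine Finset.sum_congr rfl fun o _ => ?_
  rw [hp, Finset.mul_sum]
  refine Finset.sum_congr rfl fun τ _ => ?_
  have htail : Fin.tail ((Fin.consEquiv fun _ => Option (Fin d)) (o, τ)) = τ := rfl
  simp only [htail, Fin.consEquiv_apply, Fin.cons_zero, Fin.prod_univ_succ, Fin.cons_succ]
  ring

theorem IsPoly.succ {k : ℕ} {C : ℝ} (hC : 0 ≤ C) {p : Pt d → ℝ} (hp : IsPoly k C p) :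
    IsPoly (k + 1) C p := by
  have hsum := IsPoly.sum_optCoord_mul (p := fun o v => o.elim (p v) fun _ => 0) fun o => by
    cases o with
    | none => exact hp
    | some i => exact isPoly_zero k hC
  simpa [Fintype.sum_option, optCoord] using hsum

theorem IsPoly.mono {k l : ℕ} (hkl : k ≤ l) {C : ℝ} (hC : 0 ≤ C) {p : Pt d → ℝ}
    (hp : IsPoly k C p) : IsPoly l C p := by
  induction l, hkl using Nat.le_induction with
  | base => exact hp
  | succ l _ ih => exact ih.succ hC

theorem IsPoly.add {k : ℕ} {C C' : ℝ} {p q : Pt d → ℝ} (hp : IsPoly k C p) (hq : IsPoly k C' q) :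
    IsPoly k (C + C') fun v => p v + q v := by
  obtain ⟨c, hc, hp⟩ := hp
  obtain ⟨c', hc', hq⟩ := hq
  refine ⟨c + c', fun τ => (abs_add_le _ _).trans (add_le_add (hc τ) (hc' τ)), fun v => ?_⟩
  simp [hp, hq, add_mul, Finset.sum_add_distrib]

theorem IsPoly.div {k : ℕ} {C a : ℝ} (ha : 1 ≤ a) {p : Pt d → ℝ} (hp : IsPoly k C p) :
    IsPoly k C fun v => p v / a := by
  obtain ⟨c, hc, hp⟩ := hp
  refine ⟨fun τ => c τ / a, fun τ => ?_, fun v => ?_⟩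
  · rw [abs_div, abs_of_nonneg (zero_le_one.trans ha)]
    exact (div_le_self (abs_nonneg _) ha).trans (hc τ)
  · simp only [hp, Finset.sum_div]
    exact Finset.sum_congr rfl fun τ _ => by ring

theorem isPoly_taylorForm {K : Set (Pt d)} {B : ℝ} (hB : 0 ≤ B) {x₀ : Pt d} (hx₀ : x₀ ∈ K)
    {k n : ℕ} (hkn : k ≤ n) {F : Pt d → ℝ} (h : DerivBdd K B n F) :
    IsPoly k B (taylorForm x₀ k F) := by
  induction k generalizing F n with
  | zero => exact ⟨fun _ => F x₀, fun _ => h.abs_le hx₀, fun v => by simp [taylorForm]⟩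
  | succ k ih =>
    obtain ⟨n, rfl⟩ := Nat.exists_eq_succ_of_ne_zero (by omega : n ≠ 0)
    have hsum := IsPoly.sum_optCoord_mul (k := k) (C := B)
      (p := fun o v => o.elim 0 fun i => taylorForm x₀ k (partialDeriv i F) v) fun o => by
        cases o with
        | none => exact isPoly_zero k hB
        | some i => exact ih (by omega) (h.2 i)
    simpa [Fintype.sum_option, optCoord, taylorForm] using hsum

theorem isPoly_taylorPoly {K : Set (Pt d)} {B : ℝ} (hB : 0 ≤ B) {x₀ : Pt d} (hx₀ : x₀ ∈ K)
    {m n : ℕ} (hmn : m ≤ n + 1) {F : Pt d → ℝ} (h : DerivBdd K B n F) :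
    IsPoly n (m * B) (taylorPoly x₀ m F) := by
  induction m with
  | zero => exact ⟨0, by simp, by simp [taylorPoly]⟩
  | succ m ih =>
    have hfact : (1 : ℝ) ≤ m.factorial := mod_cast Nat.succ_le_of_lt m.factorial_pos
    have hform := ((isPoly_taylorForm hB hx₀ (by omega) h).div hfact).mono
      (by omega : m ≤ n) hB
    convert (ih (by omega)).add hform using 1
    · push_cast
      ring
    · ext v
      simp [taylorPoly, Finset.sum_range_succ]

end Taylor

/-! ### Quasi-interpolation by local Taylor polynomials -/

/-- The hat function of unit half-width, the profile of the partition of unity. -/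
def hat (u : ℝ) : ℝ := max (1 - |u|) 0

theorem hat_eq_relu (u : ℝ) : hat u = max (u + 1) 0 - 2 * max u 0 + max (u - 1) 0 := by
  unfold hat
  grind

theorem hat_nonneg (u : ℝ) : 0 ≤ hat u := le_max_right _ _

theorem hat_le_one (u : ℝ) : hat u ≤ 1 :=
  max_le (by linarith [abs_nonneg u]) zero_le_one

theorem abs_hat_le_one (u : ℝ) : |hat u| ≤ 1 :=
  (abs_of_nonneg (hat_nonneg u)).trans_le (hat_le_one u)

theorem abs_lt_one_of_hat_ne_zero {u : ℝ} (h : hat u ≠ 0) : |u| < 1 := by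
  contrapose! h
  exact max_eq_right (by linarith)

theorem abs_hat_sub_le (u v : ℝ) : |hat u - hat v| ≤ |u - v| :=
  calc |hat u - hat v| ≤ |1 - |u| - (1 - |v|)| := abs_max_sub_max_le_abs _ _ _
    _ = |(|v| - |u|)| := by ring_nf
    _ ≤ |v - u| := abs_abs_sub_abs_le_abs_sub v u
    _ = |u - v| := abs_sub_comm v u

theorem sum_range_hat (N : ℕ) (u : ℝ) : ∑ m ∈ Finset.range (N + 1), hat (u - m) =
    max (u + 1) 0 - max u 0 - max (u - N) 0 + max (u - N - 1) 0 := by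
  induction N with
  | zero =>
    simp only [zero_add, Finset.range_one, Finset.sum_singleton, Nat.cast_zero, sub_zero,
      hat_eq_relu]
    ring
  | succ N ih =>
    rw [Finset.sum_range_succ, ih, hat_eq_relu]
    push_cast
    ring_nf

theorem sum_hat {N : ℕ} {u : ℝ} (hu0 : 0 ≤ u) (huN : u ≤ N) :
    ∑ m : Fin (N + 1), hat (u - (m : ℕ)) = 1 := by
  rw [Fin.sum_univ_eq_sum_range fun m => hat (u - m), sum_range_hat, max_eq_left (by linarith),
    max_eq_left hu0, max_eq_right (by linarith), max_eq_right (by linarith)]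
  ring

section Partition

variable {d : ℕ}

/-- The points of the grid of mesh size `1 / N` in the unit cube. -/
def gridPoint (N : ℕ) (m : Fin d → Fin (N + 1)) : Pt d := WithLp.toLp 2 fun i => (m i : ℕ) / (N : ℝ)

/-- The partition of unity subordinate to the grid of mesh size `1 / N`: a product of hat functions
around each grid point. -/
def bumpAt (N : ℕ) (m : Fin d → Fin (N + 1)) (x : Pt d) : ℝ := ∏ i, hat (N * x i - (m i : ℕ))

/-- The quasi-interpolant of `F`: its Taylor polynomials of degree less than `n` at the grid points,
glued by the partition of unity. -/
def quasiInterp (N n : ℕ) (F : Pt d → ℝ) (x : Pt d) : ℝ :=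
  ∑ m : Fin d → Fin (N + 1), bumpAt N m x * taylorPoly (gridPoint N m) n F (x - gridPoint N m)

theorem gridPoint_apply (N : ℕ) (m : Fin d → Fin (N + 1)) (i : Fin d) :
    gridPoint N m i = (m i : ℕ) / (N : ℝ) := rfl

theorem gridPoint_mem_closedCube (N : ℕ) (m : Fin d → Fin (N + 1)) :
    gridPoint N m ∈ closedCube d := by
  intro i
  have hle : ((m i : ℕ) : ℝ) ≤ N := mod_cast Nat.lt_succ_iff.1 (m i).2
  rw [gridPoint_apply]
  exact ⟨by positivity, div_le_one_of_le₀ hle (by positivity)⟩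

theorem sum_bumpAt {N : ℕ} {x : Pt d} (hx : x ∈ closedCube d) :
    ∑ m : Fin d → Fin (N + 1), bumpAt N m x = 1 := by
  have hprod := Finset.prod_univ_sum (fun _ : Fin d => (Finset.univ : Finset (Fin (N + 1))))
    fun i j => hat (N * x i - (j : ℕ))
  rw [Fintype.piFinset_univ] at hprod
  simp only [bumpAt, ← hprod]
  exact Finset.prod_eq_one fun i _ => sum_hat (mul_nonneg N.cast_nonneg (hx i).1)
    (mul_le_of_le_one_right N.cast_nonneg (hx i).2)

theorem abs_bumpAt_le_one (N : ℕ) (m : Fin d → Fin (N + 1)) (x : Pt d) : |bumpAt N m x| ≤ 1 :=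
  abs_prod_le_one fun _ => abs_hat_le_one _

theorem abs_hat_apply_sub_le (N : ℕ) (c : ℝ) (x y : Pt d) (i : Fin d) :
    |hat (N * x i - c) - hat (N * y i - c)| ≤ N * ‖x - y‖ :=
  calc |hat (N * x i - c) - hat (N * y i - c)|
      ≤ |N * x i - c - (N * y i - c)| := abs_hat_sub_le _ _
    _ = N * |x i - y i| := by
        rw [sub_sub_sub_cancel_right, ← mul_sub, abs_mul, Nat.abs_cast]
    _ ≤ N * ‖x - y‖ := mul_le_mul_of_nonneg_left (abs_apply_sub_le x y i) N.cast_nonneg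

theorem abs_bumpAt_sub_le (N : ℕ) (m : Fin d → Fin (N + 1)) (x y : Pt d) :
    |bumpAt N m x - bumpAt N m y| ≤ d * (N * ‖x - y‖) :=
  abs_prod_sub_prod_le (fun _ => abs_hat_le_one _) (fun _ => abs_hat_le_one _)
    fun i => abs_hat_apply_sub_le N _ x y i

/-- The indices of the grid points near `x`: those whose bump functions may be nonzero at distance
at most `1 / N` from `x`. -/
def nearby (N : ℕ) (x : Pt d) : Finset (Fin d → Fin (N + 1)) :=
  Fintype.piFinset fun i => {j : Fin (N + 1) | |N * x i - (j : ℕ)| ≤ 2}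

theorem mem_nearby {N : ℕ} {x : Pt d} {m : Fin d → Fin (N + 1)} :
    m ∈ nearby N x ↔ ∀ i, |N * x i - (m i : ℕ)| ≤ 2 := by
  simp only [nearby, Fintype.mem_piFinset, Finset.mem_filter_univ]

theorem card_abs_sub_le_two (N : ℕ) (u : ℝ) :
    ({j : Fin (N + 1) | |u - (j : ℕ)| ≤ 2} : Finset (Fin (N + 1))).card ≤ 5 := by
  have hcard : ({j : Fin (N + 1) | |u - (j : ℕ)| ≤ 2} : Finset (Fin (N + 1))).card ≤
      (Finset.Icc ⌈u - (2 : ℤ)⌉ ⌊u + (2 : ℤ)⌋).card := by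
    refine Finset.card_le_card_of_injOn (fun j => ((j : ℕ) : ℤ)) (fun j hj => ?_)
      fun a _ b _ hab => Fin.ext (Int.ofNat_inj.1 hab)
    obtain ⟨hlow, hupp⟩ := abs_le.1 (Finset.mem_filter.1 hj).2
    rw [Finset.mem_coe, Finset.mem_Icc, Int.ceil_le, Int.le_floor]
    push_cast
    constructor <;> linarith
  rw [Int.card_Icc, Int.ceil_sub_intCast, Int.floor_add_intCast] at hcard
  have := Int.floor_le_ceil u
  omega

theorem card_nearby_le (N : ℕ) (x : Pt d) : (nearby N x).card ≤ 5 ^ d := by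
  rw [nearby, Fintype.card_piFinset]
  exact (Finset.prod_le_pow_card _ _ 5 fun i _ => card_abs_sub_le_two N (N * x i)).trans_eq
    (by rw [Finset.card_univ, Fintype.card_fin])

theorem abs_sum_nearby_le {N : ℕ} {x : Pt d} {g : (Fin d → Fin (N + 1)) → ℝ} {b : ℝ} (hb : 0 ≤ b)
    (hg : ∀ m ∈ nearby N x, |g m| ≤ b) : |∑ m ∈ nearby N x, g m| ≤ 5 ^ d * b :=
  calc |∑ m ∈ nearby N x, g m| ≤ ∑ m ∈ nearby N x, |g m| := Finset.abs_sum_le_sum_abs _ _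
    _ ≤ (nearby N x).card • b := Finset.sum_le_card_nsmul _ _ _ hg
    _ ≤ 5 ^ d * b := by
        rw [nsmul_eq_mul]
        exact mul_le_mul_of_nonneg_right (mod_cast card_nearby_le N x) hb

theorem abs_natCast_mul_apply_sub_le {N : ℕ} {x y : Pt d} (hxy : N * ‖x - y‖ ≤ 1) (i : Fin d) :
    |N * x i - N * y i| ≤ 1 := by
  rw [← mul_sub, abs_mul, Nat.abs_cast]
  exact (mul_le_mul_of_nonneg_left (abs_apply_sub_le x y i) N.cast_nonneg).trans hxy

theorem bumpAt_eq_zero_of_notMem_nearby {N : ℕ} {x y : Pt d} (hxy : N * ‖x - y‖ ≤ 1)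
    {m : Fin d → Fin (N + 1)} (hm : m ∉ nearby N x) : bumpAt N m y = 0 := by
  contrapose! hm
  refine mem_nearby.2 fun i => ?_
  have hhat := abs_lt_one_of_hat_ne_zero (Finset.prod_ne_zero_iff.1 hm i (Finset.mem_univ i))
  calc |N * x i - (m i : ℕ)| ≤ |N * x i - N * y i| + |N * y i - (m i : ℕ)| := abs_sub_le _ _ _
    _ ≤ 1 + 1 := add_le_add (abs_natCast_mul_apply_sub_le hxy i) hhat.le
    _ = 2 := by norm_num

theorem norm_sub_gridPoint_le {N : ℕ} (hN : 0 < N) {x y : Pt d} (hxy : N * ‖x - y‖ ≤ 1)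
    {m : Fin d → Fin (N + 1)} (hm : m ∈ nearby N x) : ‖y - gridPoint N m‖ ≤ d * (3 / N) := by
  refine norm_le_of_abs_apply_le fun i => ?_
  have hscale : (y - gridPoint N m) i = (N * y i - (m i : ℕ)) / N := by
    rw [PiLp.sub_apply, gridPoint_apply, sub_div,
      mul_div_cancel_left₀ _ (Nat.cast_ne_zero.2 hN.ne')]
  rw [hscale, abs_div, Nat.abs_cast]
  gcongr
  calc |N * y i - (m i : ℕ)| ≤ |N * y i - N * x i| + |N * x i - (m i : ℕ)| := abs_sub_le _ _ _
    _ ≤ 1 + 2 := by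
        rw [abs_sub_comm]
        exact add_le_add (abs_natCast_mul_apply_sub_le hxy i) (mem_nearby.1 hm i)
    _ = 3 := by norm_num

theorem sub_quasiInterp_eq_sum_nearby {N n : ℕ} {F : Pt d → ℝ} {x y : Pt d}
    (hy : y ∈ closedCube d) (hxy : N * ‖x - y‖ ≤ 1) : F y - quasiInterp N n F y =
      ∑ m ∈ nearby N x, bumpAt N m y * taylorRem (gridPoint N m) n F y := by
  have hall : F y - quasiInterp N n F y =
      ∑ m, bumpAt N m y * taylorRem (gridPoint N m) n F y := by
    simp only [taylorRem, mul_sub, Finset.sum_sub_distrib, ← Finset.sum_mul, sum_bumpAt hy, one_mul,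
      quasiInterp]
  rw [hall]
  refine (Finset.sum_subset (Finset.subset_univ _) fun m _ hm => ?_).symm
  rw [bumpAt_eq_zero_of_notMem_nearby hxy hm, zero_mul]

/-- The constant in the error estimates for quasi-interpolation of order `n + 1`: at most `5 ^ d`
bumps meet a ball of radius `1 / N`, and on it `d` times the distance to their grid points is at
most `3 d² / N`. -/
def interpConst (d n : ℕ) (B : ℝ) : ℝ := 5 ^ d * ((d + 1) * B * (3 * d ^ 2 + 1) ^ (n + 1))

theorem interpConst_nonneg (d n : ℕ) {B : ℝ} (hB : 0 ≤ B) : 0 ≤ interpConst d n B := by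
  unfold interpConst
  positivity

theorem mul_mul_three_div_le (d N : ℕ) :
    (d : ℝ) * (d * (3 / N)) ≤ (3 * d ^ 2 + 1) * (1 / N) :=
  calc (d : ℝ) * (d * (3 / N)) = 3 * d ^ 2 * (1 / N) := by ring
    _ ≤ (3 * d ^ 2 + 1) * (1 / N) := by gcongr; linarith

section Error

variable {N n : ℕ} (hN : 0 < N) {B : ℝ} (hB : 0 ≤ B) {F : Pt d → ℝ} (hF : ContDiff ℝ ∞ F)

include hN hB hF

theorem abs_taylorRem_gridPoint_le (h : DerivBdd (closedCube d) B n F) {x y : Pt d}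
    (hy : y ∈ closedCube d) (hxy : N * ‖x - y‖ ≤ 1) {m : Fin d → Fin (N + 1)}
    (hm : m ∈ nearby N x) :
    |taylorRem (gridPoint N m) n F y| ≤ B * ((3 * d ^ 2 + 1) * (1 / N)) ^ n := by
  refine (abs_taylorRem_le (convex_closedCube d) hB (gridPoint_mem_closedCube N m) n hF h
    hy).trans ?_
  have hdist : d * ‖y - gridPoint N m‖ ≤ (3 * d ^ 2 + 1) * (1 / N) :=
    (mul_le_mul_of_nonneg_left (norm_sub_gridPoint_le hN hxy hm) d.cast_nonneg).trans
      (mul_mul_three_div_le d N)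
  gcongr

theorem abs_taylorRem_gridPoint_sub_le (h : DerivBdd (closedCube d) B (n + 1) F) {x y : Pt d}
    (hx : x ∈ closedCube d) (hy : y ∈ closedCube d) (hxy : N * ‖x - y‖ ≤ 1)
    {m : Fin d → Fin (N + 1)} (hm : m ∈ nearby N x) :
    |taylorRem (gridPoint N m) (n + 1) F x - taylorRem (gridPoint N m) (n + 1) F y| ≤
      d * (B * ((3 * d ^ 2 + 1) * (1 / N)) ^ n) * ‖x - y‖ := by
  have hxx : N * ‖x - x‖ ≤ 1 := by simp
  refine (abs_taylorRem_sub_le (convex_closedCube d) hB (gridPoint_mem_closedCube N m) n hF h hx hy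
    (norm_sub_gridPoint_le hN hxx hm) (norm_sub_gridPoint_le hN hxy hm)).trans ?_
  gcongr d * (B * ?_ ^ n) * _
  exact mul_mul_three_div_le d N

theorem abs_sub_quasiInterp_le (h : DerivBdd (closedCube d) B (n + 1) F) {x : Pt d}
    (hx : x ∈ closedCube d) :
    |F x - quasiInterp N (n + 1) F x| ≤ interpConst d n B * (1 / N) ^ (n + 1) := by
  have hxx : N * ‖x - x‖ ≤ 1 := by simp
  rw [sub_quasiInterp_eq_sum_nearby hx hxx]
  calc |∑ m ∈ nearby N x, bumpAt N m x * taylorRem (gridPoint N m) (n + 1) F x|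
      ≤ 5 ^ d * (B * ((3 * d ^ 2 + 1) * (1 / N)) ^ (n + 1)) := by
        refine abs_sum_nearby_le (by positivity) fun m hm => ?_
        rw [abs_mul]
        exact (mul_le_of_le_one_left (abs_nonneg _) (abs_bumpAt_le_one N m x)).trans
          (abs_taylorRem_gridPoint_le hN hB hF h hx hxx hm)
    _ = 5 ^ d * (1 * B * (3 * d ^ 2 + 1) ^ (n + 1)) * (1 / N) ^ (n + 1) := by
        rw [mul_pow]
        ring
    _ ≤ interpConst d n B * (1 / N) ^ (n + 1) := by
        unfold interpConst
        gcongr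
        linarith

theorem abs_bumpAt_mul_taylorRem_sub_le (h : DerivBdd (closedCube d) B (n + 1) F) {x y : Pt d}
    (hx : x ∈ closedCube d) (hy : y ∈ closedCube d) (hxy : N * ‖x - y‖ ≤ 1)
    {m : Fin d → Fin (N + 1)} (hm : m ∈ nearby N x) :
    |bumpAt N m x * taylorRem (gridPoint N m) (n + 1) F x -
      bumpAt N m y * taylorRem (gridPoint N m) (n + 1) F y| ≤
      2 * ((d + 1) * B * (3 * d ^ 2 + 1) ^ (n + 1)) * (1 / N) ^ n * ‖x - y‖ := by
  have hN' : (0 : ℝ) < N := mod_cast hN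
  set R := taylorRem (gridPoint N m) (n + 1) F
  set L : ℝ := 3 * d ^ 2 + 1
  have hL : 1 ≤ L := le_add_of_nonneg_left (by positivity)
  have hNinv : (N : ℝ) * (1 / N) = 1 := mul_one_div_cancel hN'.ne'
  calc |bumpAt N m x * R x - bumpAt N m y * R y|
      = |bumpAt N m x * (R x - R y) + (bumpAt N m x - bumpAt N m y) * R y| := by ring_nf
    _ ≤ |bumpAt N m x| * |R x - R y| + |bumpAt N m x - bumpAt N m y| * |R y| := by
        rw [← abs_mul, ← abs_mul]
        exact abs_add_le _ _
    _ ≤ 1 * (d * (B * (L * (1 / N)) ^ n) * ‖x - y‖) +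
          d * (N * ‖x - y‖) * (B * (L * (1 / N)) ^ (n + 1)) := by
        gcongr
        · exact abs_bumpAt_le_one N m x
        · exact abs_taylorRem_gridPoint_sub_le hN hB hF h hx hy hxy hm
        · exact abs_bumpAt_sub_le N m x y
        · exact abs_taylorRem_gridPoint_le hN hB hF h hy hxy hm
    _ = (1 + L) * (d * B * L ^ n) * (1 / N) ^ n * ‖x - y‖ := by
        rw [mul_pow, mul_pow, pow_succ (1 / N : ℝ)]
        linear_combination (d * ‖x - y‖ * B * L ^ (n + 1) * (1 / N) ^ n) * hNinv
    _ ≤ (L + L) * ((d + 1) * B * L ^ n) * (1 / N) ^ n * ‖x - y‖ := by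
        gcongr
        linarith
    _ = 2 * ((d + 1) * B * L ^ (n + 1)) * (1 / N) ^ n * ‖x - y‖ := by ring

theorem abs_sub_quasiInterp_sub_le_of_near (h : DerivBdd (closedCube d) B (n + 1) F) {x y : Pt d}
    (hx : x ∈ closedCube d) (hy : y ∈ closedCube d) (hxy : N * ‖x - y‖ ≤ 1) :
    |(F x - quasiInterp N (n + 1) F x) - (F y - quasiInterp N (n + 1) F y)| ≤
      2 * interpConst d n B * (1 / N) ^ n * ‖x - y‖ := by
  rw [sub_quasiInterp_eq_sum_nearby (x := x) hx (by simp), sub_quasiInterp_eq_sum_nearby hy hxy,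
    ← Finset.sum_sub_distrib]
  refine (abs_sum_nearby_le (by positivity) fun m hm =>
    abs_bumpAt_mul_taylorRem_sub_le hN hB hF h hx hy hxy hm).trans_eq ?_
  unfold interpConst
  ring

theorem abs_sub_quasiInterp_sub_le (h : DerivBdd (closedCube d) B (n + 1) F) {x y : Pt d}
    (hx : x ∈ closedCube d) (hy : y ∈ closedCube d) :
    |(F x - quasiInterp N (n + 1) F x) - (F y - quasiInterp N (n + 1) F y)| ≤
      2 * interpConst d n B * (1 / N) ^ n * ‖x - y‖ := by
  have hN' : (0 : ℝ) < N := mod_cast hN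
  rcases le_total (N * ‖x - y‖) 1 with hnear | hfar
  · exact abs_sub_quasiInterp_sub_le_of_near hN hB hF h hx hy hnear
  · have hC := interpConst_nonneg d n hB
    calc |(F x - quasiInterp N (n + 1) F x) - (F y - quasiInterp N (n + 1) F y)|
        ≤ |F x - quasiInterp N (n + 1) F x| + |F y - quasiInterp N (n + 1) F y| := abs_sub _ _
      _ ≤ interpConst d n B * (1 / N) ^ (n + 1) + interpConst d n B * (1 / N) ^ (n + 1) :=
          add_le_add (abs_sub_quasiInterp_le hN hB hF h hx) (abs_sub_quasiInterp_le hN hB hF h hy)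
      _ = 2 * interpConst d n B * (1 / N) ^ n * (1 / N) := by ring
      _ ≤ 2 * interpConst d n B * (1 / N) ^ n * ‖x - y‖ := by
          gcongr
          exact (div_le_iff₀' hN').2 hfar

end Error

end Partition

/-! ### Bounds in Hölder norms -/

section Holder

variable {d : ℕ}

/-- The function `e` is bounded by `δ` and Hölder continuous with exponent `s` and constant `δ` on
the set `T`. -/
def HolderBdd (T : Set (Pt d)) (s δ : ℝ) (e : Pt d → ℝ) : Prop :=
  (∀ x ∈ T, |e x| ≤ δ) ∧ ∀ x ∈ T, ∀ y ∈ T, |e x - e y| ≤ δ * ‖x - y‖ ^ s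

variable {T : Set (Pt d)} {s a b : ℝ} {e g : Pt d → ℝ}

theorem HolderBdd.mono (h : HolderBdd T s a e) (hab : a ≤ b) : HolderBdd T s b e :=
  ⟨fun x hx => (h.1 x hx).trans hab, fun x hx y hy => (h.2 x hx y hy).trans (by gcongr)⟩

theorem HolderBdd.subset {T' : Set (Pt d)} (h : HolderBdd T s a e) (hT : T' ⊆ T) :
    HolderBdd T' s a e :=
  ⟨fun x hx => h.1 x (hT hx), fun x hx y hy => h.2 x (hT hx) y (hT hy)⟩

theorem HolderBdd.congr (h : HolderBdd T s a e) (heg : Set.EqOn e g T) : HolderBdd T s a g :=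
  ⟨fun x hx => heg hx ▸ h.1 x hx, fun x hx y hy => heg hx ▸ heg hy ▸ h.2 x hx y hy⟩

theorem HolderBdd.add (he : HolderBdd T s a e) (hg : HolderBdd T s b g) :
    HolderBdd T s (a + b) fun x => e x + g x := by
  refine ⟨fun x hx => (abs_add_le _ _).trans (add_le_add (he.1 x hx) (hg.1 x hx)),
    fun x hx y hy => ?_⟩
  rw [add_sub_add_comm, add_mul]
  exact (abs_add_le _ _).trans (add_le_add (he.2 x hx y hy) (hg.2 x hx y hy))

theorem HolderBdd.const_mul (he : HolderBdd T s a e) (c : ℝ) :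
    HolderBdd T s (|c| * a) fun x => c * e x := by
  refine ⟨fun x hx => ?_, fun x hx y hy => ?_⟩
  · rw [abs_mul]
    exact mul_le_mul_of_nonneg_left (he.1 x hx) (abs_nonneg _)
  · rw [← mul_sub, abs_mul, mul_assoc]
    exact mul_le_mul_of_nonneg_left (he.2 x hx y hy) (abs_nonneg _)

theorem HolderBdd.mul (ha : 0 ≤ a) (hb : 0 ≤ b) (he : HolderBdd T s a e) (hg : HolderBdd T s b g) :
    HolderBdd T s (2 * (a * b)) fun x => e x * g x := by
  refine ⟨fun x hx => ?_, fun x hx y hy => ?_⟩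
  · calc |e x * g x| = |e x| * |g x| := abs_mul _ _
      _ ≤ a * b := mul_le_mul (he.1 x hx) (hg.1 x hx) (abs_nonneg _) ha
      _ ≤ 2 * (a * b) := le_mul_of_one_le_left (by positivity) one_le_two
  · calc |e x * g x - e y * g y| = |(e x - e y) * g x + e y * (g x - g y)| := by ring_nf
      _ ≤ |e x - e y| * |g x| + |e y| * |g x - g y| := by
          rw [← abs_mul, ← abs_mul]
          exact abs_add_le _ _
      _ ≤ a * ‖x - y‖ ^ s * b + a * (b * ‖x - y‖ ^ s) := by
          gcongr
          exacts [he.2 x hx y hy, hg.1 x hx, he.1 y hy, hg.2 x hx y hy]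
      _ = 2 * (a * b) * ‖x - y‖ ^ s := by ring

theorem HolderBdd.sum {ι : Type*} (t : Finset ι) {e : ι → Pt d → ℝ} {a : ι → ℝ}
    (h : ∀ i ∈ t, HolderBdd T s (a i) (e i)) :
    HolderBdd T s (∑ i ∈ t, a i) fun x => ∑ i ∈ t, e i x := by
  classical
  induction t using Finset.induction_on with
  | empty => exact ⟨by simp, by simp⟩
  | insert i t hi ih =>
    simp only [Finset.sum_insert hi]
    exact (h i (Finset.mem_insert_self _ _)).add
      (ih fun j hj => h j (Finset.mem_insert_of_mem hj))

theorem rpow_one_sub_mul_rpow {t : ℝ} (ht : 0 ≤ t) (s : ℝ) : t ^ (1 - s) * t ^ s = t := by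
  rw [← Real.rpow_add' ht (by simp)]
  simp

theorem le_rpow_one_sub_mul_rpow {t u v : ℝ} (ht : 0 ≤ t) (hs0 : 0 ≤ s) (hs1 : s ≤ 1) (hu : t ≤ u)
    (hv : t ≤ v) : t ≤ u ^ (1 - s) * v ^ s :=
  calc t = t ^ (1 - s) * t ^ s := (rpow_one_sub_mul_rpow ht s).symm
    _ ≤ u ^ (1 - s) * v ^ s := by
        have : 0 ≤ 1 - s := sub_nonneg.2 hs1
        have : 0 ≤ u := ht.trans hu
        gcongr

theorem holderBdd_of_lipschitz {K p l : ℝ} (hK : 0 ≤ K) (hp : 0 ≤ p) (hpl : p ≤ l) (hs0 : 0 ≤ s)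
    (hs1 : s ≤ 1) (hsup : ∀ x ∈ T, |e x| ≤ K * p)
    (hlip : ∀ x ∈ T, ∀ y ∈ T, |e x - e y| ≤ 2 * K * l * ‖x - y‖) :
    HolderBdd T s (2 * K * (p ^ (1 - s) * l ^ s)) e := by
  have hl : 0 ≤ l := hp.trans hpl
  refine ⟨fun x hx => ?_, fun x hx y hy => ?_⟩
  · calc |e x| ≤ K * p := hsup x hx
      _ ≤ 2 * K * p := by linarith [mul_nonneg hK hp]
      _ ≤ 2 * K * (p ^ (1 - s) * l ^ s) := by
          gcongr
          exact le_rpow_one_sub_mul_rpow hp hs0 hs1 le_rfl hpl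
  · have hdiff : |e x - e y| ≤ 2 * K * p :=
      calc |e x - e y| ≤ |e x| + |e y| := abs_sub _ _
        _ ≤ K * p + K * p := add_le_add (hsup x hx) (hsup y hy)
        _ = 2 * K * p := by ring
    calc |e x - e y| ≤ (2 * K * p) ^ (1 - s) * (2 * K * l * ‖x - y‖) ^ s :=
          le_rpow_one_sub_mul_rpow (abs_nonneg _) hs0 hs1 hdiff (hlip x hx y hy)
      _ = (2 * K) ^ (1 - s) * (2 * K) ^ s * (p ^ (1 - s) * l ^ s) * ‖x - y‖ ^ s := by
          rw [Real.mul_rpow (by positivity) hp, Real.mul_rpow (by positivity) (norm_nonneg _),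
            Real.mul_rpow (by positivity) hl]
          ring
      _ = 2 * K * (p ^ (1 - s) * l ^ s) * ‖x - y‖ ^ s := by
          rw [rpow_one_sub_mul_rpow (by positivity)]

theorem exists_rpow_one_sub_mul_le {l ε : ℝ} (hl : 0 < l) (hε : 0 < ε) (hs1 : s < 1) :
    ∃ δ > 0, δ ≤ l ∧ δ ^ (1 - s) * l ^ s ≤ ε := by
  have hs : 0 < 1 - s := sub_pos.2 hs1
  refine ⟨min l ((ε / l ^ s) ^ (1 - s)⁻¹), by positivity, min_le_left _ _, ?_⟩
  calc min l ((ε / l ^ s) ^ (1 - s)⁻¹) ^ (1 - s) * l ^ s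
      ≤ ((ε / l ^ s) ^ (1 - s)⁻¹) ^ (1 - s) * l ^ s := by
        gcongr
        exact min_le_right _ _
    _ = ε / l ^ s * l ^ s := by rw [Real.rpow_inv_rpow (by positivity) hs.ne']
    _ = ε := div_mul_cancel₀ _ (by positivity)

end Holder

/-! ### Approximation of functions with bounded weak derivatives -/

section Approximation

variable {d : ℕ}

/-- Indices of the terms of the quasi-interpolant of mesh size `1 / N` when its Taylor polynomials
are expanded as in `IsPoly`: a grid point and a monomial of degree at most `n`. -/
abbrev TermIndex (d N n : ℕ) : Type := (Fin d → Fin (N + 1)) × (Fin n → Option (Fin d))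

/-- The `d + n` factors of the term with index `t` of a quasi-interpolant: the hat functions of the
grid point, then the factors of the monomial centred at the grid point. -/
def factor {N n : ℕ} (t : TermIndex d N n) : Fin (d + n) → (Fin d → ℝ) → ℝ :=
  Fin.append (fun i z => hat (N * z i - (t.1 i : ℕ)))
    fun j z => (t.2 j).elim 1 fun i => z i - (t.1 i : ℕ) / (N : ℝ)

theorem factor_induction {N n : ℕ} {t : TermIndex d N n} {P : ((Fin d → ℝ) → ℝ) → Prop}
    (hhat : ∀ i, P fun z => hat (N * z i - (t.1 i : ℕ))) (hone : P fun _ => 1)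
    (hcoord : ∀ i, P fun z => z i - (t.1 i : ℕ) / (N : ℝ)) (k : Fin (d + n)) :
    P (factor t k) := by
  refine Fin.addCases (fun i => ?_) (fun j => ?_) k
  · simpa only [factor, Fin.append_left] using hhat i
  · simp only [factor, Fin.append_right]
    cases t.2 j with
    | none => exact hone
    | some i => exact hcoord i

theorem prod_factor {N n : ℕ} (t : TermIndex d N n) (x : Pt d) :
    ∏ k, factor t k x = bumpAt N t.1 x * ∏ j, optCoord (x - gridPoint N t.1) (t.2 j) := by
  simp only [Fin.prod_univ_add, factor, Fin.append_left, Fin.append_right, bumpAt]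
  congr 1
  refine Finset.prod_congr rfl fun j _ => ?_
  cases t.2 j <;> rfl

theorem isRealizable_hat_apply (N : ℕ) (c : ℝ) (i : Fin d) :
    IsRealizable 2 (3 * d) fun z => hat (N * z i - c) := by
  have hcoord := IsRealizable.coord i
  convert (((hcoord.mul_add_const N (1 - c)).relu.add
    ((hcoord.mul_add_const N (-c)).relu.mul_add_const (-2) 0)).add
    (hcoord.mul_add_const N (-1 - c)).relu).mono (w' := 3 * d) (by lia) using 2 with z
  rw [hat_eq_relu]
  ring_nf

theorem isRealizable_factor {N n : ℕ} (t : TermIndex d N n) (k : Fin (d + n)) :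
    IsRealizable 2 (3 * d + 2) (factor t k) := by
  refine factor_induction (fun i => (isRealizable_hat_apply N _ i).mono (by lia))
    (((IsRealizable.const d 1).pad 1).mono (by lia)) (fun i => ?_) k
  convert (((IsRealizable.coord i).mul_add_const 1 (-((t.1 i : ℕ) / (N : ℝ)))).pad 1).mono
    (w' := 3 * d + 2) (by lia) using 2 with z
  ring

theorem abs_factor_le_one {N n : ℕ} (t : TermIndex d N n) {x : Pt d} (hx : x ∈ closedCube d)
    (k : Fin (d + n)) : |factor t k x| ≤ 1 := by
  refine factor_induction (P := fun u => |u x| ≤ 1) (fun i => abs_hat_le_one _) (by simp)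
    (fun i => ?_) k
  exact abs_sub_le_of_nonneg_of_le (hx i).1 (hx i).2 (gridPoint_mem_closedCube N t.1 i).1
    (gridPoint_mem_closedCube N t.1 i).2

theorem abs_factor_sub_le {N n : ℕ} (hN : 0 < N) (t : TermIndex d N n) (x y : Pt d)
    (k : Fin (d + n)) : |factor t k x - factor t k y| ≤ N * ‖x - y‖ := by
  refine factor_induction (P := fun u => |u x - u y| ≤ N * ‖x - y‖)
    (fun i => abs_hat_apply_sub_le N _ x y i) ?_ (fun i => ?_) k
  · rw [sub_self, abs_zero]
    positivity
  · rw [sub_sub_sub_cancel_right]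
    exact (abs_apply_sub_le x y i).trans
      (le_mul_of_one_le_left (norm_nonneg _) (Nat.one_le_cast.2 hN))

theorem quasiInterp_eq_sum_prod_factor {N n : ℕ} {B : ℝ} (hB : 0 ≤ B) {F : Pt d → ℝ}
    (h : DerivBdd (closedCube d) B n F) :
    ∃ c : TermIndex d N n → ℝ, (∀ t, |c t| ≤ (n + 1) * B) ∧
      ∀ x, quasiInterp N (n + 1) F x = ∑ t, c t * ∏ k, factor t k x := by
  choose c hc htaylor using fun m =>
    isPoly_taylorPoly hB (gridPoint_mem_closedCube N m) (le_refl (n + 1)) h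
  refine ⟨fun t => c t.1 t.2, fun t => mod_cast hc t.1 t.2, fun x => ?_⟩
  simp only [quasiInterp, htaylor, prod_factor, Finset.mul_sum, Fintype.sum_prod_type]
  exact Finset.sum_congr rfl fun m _ => Finset.sum_congr rfl fun τ _ => mul_left_comm _ _ _

variable {s : ℝ}

theorem holderBdd_sub_quasiInterp (hs0 : 0 ≤ s) (hs1 : s ≤ 1) {N n : ℕ} (hN : 0 < N) {B : ℝ}
    (hB : 0 ≤ B) {F : Pt d → ℝ} (hF : ContDiff ℝ ∞ F) (h : DerivBdd (closedCube d) B (n + 1) F) :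
    HolderBdd (closedCube d) s (2 * interpConst d n B * (1 / N : ℝ) ^ ((n : ℝ) + 1 - s))
      fun x => F x - quasiInterp N (n + 1) F x := by
  have hη : (0 : ℝ) < 1 / N := by positivity
  have hη1 : (1 / N : ℝ) ≤ 1 := div_le_one_of_le₀ (mod_cast hN) N.cast_nonneg
  have hrate : ((1 / N : ℝ) ^ (n + 1)) ^ (1 - s) * ((1 / N : ℝ) ^ n) ^ s =
      (1 / N : ℝ) ^ ((n : ℝ) + 1 - s) := by
    rw [← Real.rpow_natCast, ← Real.rpow_natCast, ← Real.rpow_mul hη.le, ← Real.rpow_mul hη.le,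
      ← Real.rpow_add hη]
    congr 1
    push_cast
    ring
  rw [← hrate]
  exact holderBdd_of_lipschitz (interpConst_nonneg d n hB) (by positivity)
    (pow_le_pow_of_le_one hη.le hη1 n.le_succ) hs0 hs1
    (fun x hx => abs_sub_quasiInterp_le hN hB hF h hx)
    fun x hx y hy => abs_sub_quasiInterp_sub_le hN hB hF h hx hy

theorem holderBdd_prod_sub_prodApprox (hs0 : 0 ≤ s) (hs1 : s ≤ 1) {N n : ℕ} (hN : 0 < N) (M : ℕ)
    (t : TermIndex d N n) :
    HolderBdd (closedCube d) s (2 * 4 ^ (d + n + 1) * ((1 / 4 ^ M) ^ (1 - s) * (N : ℝ) ^ s))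
      fun x => ∏ k, factor t k x - prodApprox M fun k => factor t k x := by
  have hN' : (1 : ℝ) ≤ N := mod_cast hN
  refine holderBdd_of_lipschitz (by positivity) (by positivity)
    ((div_le_one_of_le₀ (one_le_pow₀ (by norm_num)) (by positivity)).trans hN') hs0 hs1
    (fun x hx => ?_) fun x hx y hy => ?_
  · calc |∏ k, factor t k x - prodApprox M fun k => factor t k x|
        ≤ (2 ^ (d + n + 1) - 2) / 4 ^ M := by
          rw [abs_sub_comm]
          exact abs_prodApprox_sub_prod_le M (abs_factor_le_one t hx)
      _ ≤ 2 ^ (d + n + 1) / 4 ^ M := by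
          gcongr
          exact sub_le_self _ zero_le_two
      _ ≤ 4 ^ (d + n + 1) / 4 ^ M := by
          gcongr
          norm_num
      _ = 4 ^ (d + n + 1) * (1 / 4 ^ M) := div_eq_mul_one_div _ _
  · have hprod := abs_prod_sub_prod_le (abs_factor_le_one t hx) (abs_factor_le_one t hy)
      (abs_factor_sub_le hN t x y)
    have happrox := abs_prodApprox_sub_le M (by positivity) (abs_factor_sub_le hN t x y)
    have hcount : ((d + n : ℕ) : ℝ) ≤ 4 ^ (d + n) :=
      mod_cast (Nat.lt_pow_self (by norm_num : 1 < 4)).le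
    rw [sub_sub_sub_comm]
    calc _ ≤ (d + n : ℕ) * (N * ‖x - y‖) + 4 ^ (d + n) * (N * ‖x - y‖) :=
          (abs_sub _ _).trans (add_le_add hprod happrox)
      _ ≤ 4 ^ (d + n) * (N * ‖x - y‖) + 4 ^ (d + n) * (N * ‖x - y‖) := by gcongr
      _ = 2 * 4 ^ (d + n) * N * ‖x - y‖ := by ring
      _ ≤ 2 * 4 ^ (d + n + 1) * N * ‖x - y‖ := by
          gcongr 2 * ?_ * N * ‖x - y‖
          exact pow_le_pow_right₀ (by norm_num) (Nat.le_succ _)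

theorem card_mul_rpow_le {n κ : ℕ} (hκ : (d + n + 1 : ℝ) ≤ 2 * κ * (1 - s)) (a : ℕ) :
    ((2 ^ a : ℕ) + 1 : ℝ) ^ d * ((1 / 4 ^ (κ * a)) ^ (1 - s) * ((2 ^ a : ℕ) : ℝ) ^ s) ≤
      2 ^ d * (1 / (2 ^ a : ℕ) : ℝ) ^ ((n : ℝ) + 1 - s) := by
  have hbits : (1 / 4 ^ (κ * a) : ℝ) = ((2 ^ a : ℕ) : ℝ) ^ (-(2 * κ) : ℝ) := by
    rw [Real.rpow_neg (by positivity), one_div]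
    norm_cast
    rw [← pow_mul, show 4 = 2 ^ 2 by rfl, ← pow_mul]
    ring_nf
  have hN : (1 : ℝ) ≤ (2 ^ a : ℕ) := Nat.one_le_cast.2 Nat.one_le_two_pow
  set N : ℝ := ((2 ^ a : ℕ) : ℝ)
  have hN0 : 0 < N := by positivity
  calc (N + 1) ^ d * ((1 / 4 ^ (κ * a)) ^ (1 - s) * N ^ s)
      ≤ (2 * N) ^ d * ((1 / 4 ^ (κ * a)) ^ (1 - s) * N ^ s) := by
        gcongr
        linarith
    _ = 2 ^ d * N ^ (d + (-(2 * κ) * (1 - s) + s) : ℝ) := by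
        rw [hbits, mul_pow, ← Real.rpow_mul hN0.le, ← Real.rpow_add hN0, mul_assoc,
          ← Real.rpow_natCast N, ← Real.rpow_add hN0]
    _ ≤ 2 ^ d * N ^ (-(n + 1 - s) : ℝ) := by
        gcongr
        linarith
    _ = 2 ^ d * (1 / N) ^ ((n : ℝ) + 1 - s) := by
        rw [Real.rpow_neg hN0.le, one_div, Real.inv_rpow hN0.le]

theorem holderBdd_sum_prod_sub_prodApprox (hs0 : 0 ≤ s) (hs1 : s ≤ 1) {n κ : ℕ}
    (hκ : (d + n + 1 : ℝ) ≤ 2 * κ * (1 - s)) (a : ℕ) {c : TermIndex d (2 ^ a) n → ℝ} {C : ℝ}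
    (hC : 0 ≤ C) (hc : ∀ t, |c t| ≤ C) :
    HolderBdd (closedCube d) s (2 * 4 ^ (d + n + 1) * C * (d + 1) ^ n * 2 ^ d *
        (1 / (2 ^ a : ℕ) : ℝ) ^ ((n : ℝ) + 1 - s))
      fun x => ∑ t, c t * (∏ k, factor t k x - prodApprox (κ * a) fun k => factor t k x) := by
  have hterm := fun t : TermIndex d (2 ^ a) n =>
    (holderBdd_prod_sub_prodApprox hs0 hs1 (by positivity) (κ * a) t).const_mul (c t)
  refine (HolderBdd.sum Finset.univ fun t _ =>
    (hterm t).mono (mul_le_mul_of_nonneg_right (hc t) (by positivity))).mono ?_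
  rw [Finset.sum_const, nsmul_eq_mul, Finset.card_univ]
  simp only [Fintype.card_prod, Fintype.card_pi, Fintype.card_fin, Fintype.card_option,
    Finset.prod_const, Finset.card_univ, Nat.cast_mul, Nat.cast_pow _ d, Nat.cast_pow _ n,
    Nat.cast_add, Nat.cast_one]
  calc _ = 2 * 4 ^ (d + n + 1) * C * (d + 1) ^ n * (((2 ^ a : ℕ) + 1 : ℝ) ^ d *
        ((1 / 4 ^ (κ * a)) ^ (1 - s) * ((2 ^ a : ℕ) : ℝ) ^ s)) := by ring
    _ ≤ 2 * 4 ^ (d + n + 1) * C * (d + 1) ^ n *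
        (2 ^ d * (1 / (2 ^ a : ℕ) : ℝ) ^ ((n : ℝ) + 1 - s)) := by
      gcongr 2 * 4 ^ (d + n + 1) * C * (d + 1) ^ n * ?_
      exact card_mul_rpow_le hκ a
    _ = _ := by ring

theorem WeakDerivBdd.exists_smooth_holder_approx {n : ℕ} {B : ℝ} (hB : 0 ≤ B) (hs0 : 0 ≤ s)
    (hs1 : s < 1) {f : Pt d → ℝ} (h : WeakDerivBdd (n + 1) B f)
    (hf : ∀ x y, |f x - f y| ≤ d * B * ‖x - y‖) {ε : ℝ} (hε : 0 < ε) :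
    ∃ F : Pt d → ℝ, ContDiff ℝ ∞ F ∧ DerivBdd (closedCube d) B (n + 1) F ∧
      HolderBdd (closedCube d) s (2 * ε) fun x => f x - F x := by
  obtain ⟨δ, hδ, hδl, hδε⟩ :=
    exists_rpow_one_sub_mul_le (l := d * B + 1) (by positivity) hε hs1
  obtain ⟨F, hF, hFB, hfF⟩ := h.exists_smooth_approx hB (by positivity) hf hδ
  have hholder : HolderBdd (closedCube d) s _ fun x => f x - F x :=
    holderBdd_of_lipschitz zero_le_one hδ.le hδl hs0 hs1.le
      (fun x hx => by rw [one_mul, abs_sub_comm]; exact hfF x hx) fun x hx y hy => by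
        rw [sub_sub_sub_comm]
        calc _ ≤ d * B * ‖x - y‖ + d * B * ‖x - y‖ :=
              (abs_sub _ _).trans (add_le_add (hf x y) (hFB.abs_sub_le (convex_closedCube d) hB
                (hF.differentiable (by simp)) hx hy))
          _ ≤ 2 * 1 * (d * B + 1) * ‖x - y‖ := by linarith [norm_nonneg (x - y)]
  exact ⟨F, hF, hFB, hholder.mono (by linarith)⟩

theorem exists_isRealizable_terms (d n : ℕ) (hs0 : 0 ≤ s) (hs1 : s < 1) {B : ℝ} (hB : 0 ≤ B) :
    ∃ C > (0 : ℝ), ∃ κ W : ℕ, ∀ (a : ℕ) (f : Pt d → ℝ), WeakDerivBdd (n + 1) B f →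
      (∀ x y, |f x - f y| ≤ d * B * ‖x - y‖) →
      ∃ u : TermIndex d (2 ^ a) n → (Fin d → ℝ) → ℝ,
        (∀ t, IsRealizable (2 + (d + n) * (κ * a + 1)) W (u t)) ∧
        HolderBdd (closedCube d) s (C * (1 / (2 ^ a : ℕ) : ℝ) ^ ((n : ℝ) + 1 - s))
          fun x => f x - ∑ t, u t x := by
  obtain ⟨κ, hκ⟩ : ∃ κ : ℕ, (d + n + 1 : ℝ) ≤ 2 * κ * (1 - s) := by
    obtain ⟨κ, hκ⟩ := exists_nat_ge ((d + n + 1 : ℝ) / (2 * (1 - s)))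
    have := (div_le_iff₀ (by linarith)).1 hκ
    exact ⟨κ, by linarith⟩
  obtain ⟨W, hW⟩ := exists_isRealizable_prodApprox d (3 * d + 2) (d + n)
  have hinterp := interpConst_nonneg d n hB
  refine ⟨2 + 2 * interpConst d n B + 2 * 4 ^ (d + n + 1) * ((n + 1) * B) * (d + 1) ^ n * 2 ^ d,
    by positivity, κ, W, fun a f hfw hf => ?_⟩
  have hN : 0 < 2 ^ a := by positivity
  obtain ⟨F, hF, hFB, hmollify⟩ := hfw.exists_smooth_holder_approx hB hs0 hs1 hf
    (ε := (1 / (2 ^ a : ℕ) : ℝ) ^ ((n : ℝ) + 1 - s)) (by positivity)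
  obtain ⟨c, hc, hquasi⟩ := quasiInterp_eq_sum_prod_factor hB hFB.of_succ
  refine ⟨fun t z => c t * prodApprox (κ * a) fun k => factor t k z, fun t => ?_, ?_⟩
  · simpa only [add_zero] using (hW (κ * a) _ (isRealizable_factor t)).mul_add_const (c t) 0
  · have hinterpolate := holderBdd_sub_quasiInterp hs0 hs1.le hN hB hF hFB
    have hmultiply := holderBdd_sum_prod_sub_prodApprox hs0 hs1.le hκ a (by positivity) hc
    refine (((hmollify.add hinterpolate).add hmultiply).mono (le_of_eq ?_)).congr fun x _ => ?_
    · ring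
    · simp only [hquasi, mul_sub, Finset.sum_sub_distrib]
      ring

end Approximation

/-! ### Emulators and their size -/

section Emulator

variable {d D : ℕ}

theorem IsRealizable.exists_net_eval_eq_single {k L w : ℕ} {f : (Fin k → ℝ) → ℝ}
    (hf : IsRealizable L w f) (j : Fin D) :
    ∃ N : Net k D, N.depth = L ∧ N.width ≤ max w D ∧ ∀ x, N.eval x = Pi.single j (f x) := by
  have one_le_w := hf.one_le_width
  obtain ⟨N, depth_N, width_N, eval_N⟩ := hf
  let E : Net 1 D := .out (Matrix.of fun i _ => (Pi.single j 1 : Fin D → ℝ) i) 0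
  refine ⟨N.comp E, ?_, (N.width_comp_le E).trans (max_le ?_ (max_le ?_ ?_)), fun x => ?_⟩
  · simpa only [E, Net.depth, Nat.add_right_cancel_iff, depth_N] using N.depth_comp E
  · exact width_N.trans (le_max_left _ _)
  · exact one_le_w.trans (le_max_left _ _)
  · exact le_max_right _ _
  · ext i
    simp [N.eval_comp, E, Net.eval, Matrix.mulVec, dotProduct, eval_N, Pi.single_apply]

theorem exists_net_eval_eq_sum {ι : Type*} [Fintype ι] {k L w : ℕ} (hL : 1 ≤ L)
    {u : Fin D → ι → (Fin k → ℝ) → ℝ} (hu : ∀ j i, IsRealizable L w (u j i)) :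
    ∃ N : Net k D, (∀ x j, N.eval x j = ∑ i, u j i x) ∧ N.depth = L ∧
      N.numWeights ≤ D * Fintype.card ι * (L * (max w D * max w D + max w D)) ∧
      N.numUnits ≤ D * Fintype.card ι * ((L + 1) * max w D) + (k + D) := by
  choose N depth_N width_N eval_N using fun j i => (hu j i).exists_net_eval_eq_single j
  obtain ⟨S, eval_S, depth_S, numWeights_S, numUnits_S⟩ :=
    Net.exists_eval_eq_sum (Finset.univ : Finset (Fin D × ι)) hL (fun q => N q.1 q.2)
      (W := L * (max w D * max w D + max w D)) (U := (L + 1) * max w D) fun q _ => by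
        refine ⟨depth_N _ _, (N q.1 q.2).numWeights_le.trans ?_,
          (N q.1 q.2).numUnits_le.trans ?_⟩ <;>
        · rw [depth_N]
          gcongr <;> exact width_N _ _
  rw [Finset.card_univ, Fintype.card_prod, Fintype.card_fin] at numWeights_S numUnits_S
  refine ⟨S, fun x j => ?_, depth_S, numWeights_S, numUnits_S⟩
  simp only [eval_S, eval_N, Finset.sum_apply, Fintype.sum_prod_type, Pi.single_apply]
  rw [Finset.sum_comm]
  simp

theorem card_termIndex_le (d n : ℕ) {N : ℕ} (hN : 0 < N) :
    Fintype.card (TermIndex d N n) ≤ 2 ^ d * (d + 1) ^ n * N ^ d := by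
  simp only [Fintype.card_prod, Fintype.card_pi, Fintype.card_fin, Fintype.card_option,
    Finset.prod_const, Finset.card_univ]
  calc (N + 1) ^ d * (d + 1) ^ n ≤ (2 * N) ^ d * (d + 1) ^ n := by
        gcongr
        lia
    _ = 2 ^ d * (d + 1) ^ n * N ^ d := by ring

theorem exists_emulator (d D n : ℕ) {s : ℝ} (hs0 : 0 ≤ s) (hs1 : s < 1) {B : ℝ} (hB : 0 ≤ B) :
    ∃ C > (0 : ℝ), ∃ K > (0 : ℕ), ∀ (a : ℕ) (f : Fin D → Pt d → ℝ),
      (∀ j, WeakDerivBdd (n + 1) B (f j)) → (∀ j x y, |f j x - f j y| ≤ d * B * ‖x - y‖) →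
      ∃ N : Net d D,
        (∀ j, HolderBdd (closedCube d) s (C * (1 / (2 ^ a : ℕ) : ℝ) ^ ((n : ℝ) + 1 - s))
          fun x => f j x - N.emulator x j) ∧
        N.depth ≤ K * (a + 1) ∧ N.numWeights ≤ K * ((2 ^ a) ^ d * (a + 1)) ∧
        N.numUnits ≤ K * ((2 ^ a) ^ d * (a + 1)) := by
  obtain ⟨C, hC, κ, w, hterms⟩ := exists_isRealizable_terms d n hs0 hs1 hB
  let L₀ := 2 + (d + n) * (κ + 1)
  let T₀ := D * (2 ^ d * (d + 1) ^ n)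
  let W := max w D
  refine ⟨C, hC, L₀ + T₀ * L₀ * (W * W + W) + (T₀ * ((L₀ + 1) * W) + (d + D)),
    by positivity, fun a f hf hlip => ?_⟩
  choose u hu hfu using fun j => hterms a (f j) (hf j) (hlip j)
  obtain ⟨N, eval_N, depth_N, numWeights_N, numUnits_N⟩ := exists_net_eval_eq_sum (by lia) hu
  have hdepth : 2 + (d + n) * (κ * a + 1) ≤ L₀ * (a + 1) :=
    calc 2 + (d + n) * (κ * a + 1) ≤ 2 * (a + 1) + (d + n) * ((κ + 1) * (a + 1)) := by
          gcongr <;> lia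
      _ = L₀ * (a + 1) := by ring
  have hcard : D * Fintype.card (TermIndex d (2 ^ a) n) ≤ T₀ * (2 ^ a) ^ d := by
    rw [mul_assoc]
    gcongr
    exact card_termIndex_le d n (by positivity)
  refine ⟨N, fun j => ?_, ?_, ?_, ?_⟩
  · simpa only [Net.emulator, eval_N] using hfu j
  · calc N.depth ≤ L₀ * (a + 1) := depth_N.trans_le hdepth
      _ ≤ _ := by
        gcongr
        lia
  · calc N.numWeights ≤ T₀ * (2 ^ a) ^ d * (L₀ * (a + 1) * (W * W + W)) :=
          numWeights_N.trans (by gcongr)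
      _ = T₀ * L₀ * (W * W + W) * ((2 ^ a) ^ d * (a + 1)) := by ring
      _ ≤ _ := by
        gcongr
        lia
  · calc N.numUnits ≤ T₀ * (2 ^ a) ^ d * ((L₀ * (a + 1) + (a + 1)) * W) +
            (d + D) * ((2 ^ a) ^ d * (a + 1)) := by
          refine numUnits_N.trans ?_
          gcongr
          · lia
          · exact Nat.le_mul_of_pos_right _ (by positivity)
      _ = (T₀ * ((L₀ + 1) * W) + (d + D)) * ((2 ^ a) ^ d * (a + 1)) := by ring
      _ ≤ _ := Nat.mul_le_mul_right _ (Nat.le_add_left _ _)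

end Emulator

/-! ### Emulators of the potential -/

section PotentialEmulator

variable {d D : ℕ}

theorem slobodeckijNorm_le_of_holderBdd {s δ : ℝ} {e : Pt d → ℝ} {T : Set (Pt d)}
    (hT : ∀ᵐ x ∂(cubeMeasure d), x ∈ T) (h : HolderBdd T s δ e) :
    slobodeckijNorm s e ≤ ENNReal.ofReal δ := by
  have hsup : eLpNorm e ∞ (cubeMeasure d) ≤ ENNReal.ofReal δ := by
    rw [eLpNorm_exponent_top]
    exact eLpNormEssSup_le_of_ae_bound (hT.mono h.1)
  unfold slobodeckijNorm
  split_ifs with hs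
  · exact hsup
  · refine max_le hsup ?_
    rw [eLpNorm_exponent_top]
    refine eLpNormEssSup_le_of_ae_bound ?_
    filter_upwards [Measure.quasiMeasurePreserving_fst.ae hT,
      Measure.quasiMeasurePreserving_snd.ae hT] with z hx hy
    have hpow : 0 ≤ ‖z.1 - z.2‖ ^ s := Real.rpow_nonneg (norm_nonneg _) s
    rw [Real.norm_eq_abs, abs_div, abs_of_nonneg hpow]
    exact div_le_of_le_mul₀ hpow ((abs_nonneg _).trans (h.1 _ hx)) (h.2 _ hx _ hy)

theorem potential_sub_potential (Γ : Matrix (Fin D) (Fin D) ℝ) (y : Fin D → ℝ)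
    (G G' : Pt d → Fin D → ℝ) (x : Pt d) :
    potential Γ y G x - potential Γ y G' x = ∑ j, ∑ k, -(1 / 2) * Γ⁻¹ j k *
      ((G x j - G' x j) * (y k - G x k) + (y j - G' x j) * (G x k - G' x k)) := by
  simp only [potential, dotProduct, Matrix.mulVec, Finset.mul_sum, Pi.sub_apply,
    ← Finset.sum_sub_distrib]
  refine Finset.sum_congr rfl fun j _ => Finset.sum_congr rfl fun k _ => ?_
  ring

theorem holderBdd_potential_sub (Γ : Matrix (Fin D) (Fin D) ℝ) (y : Fin D → ℝ)
    {G G' : Pt d → Fin D → ℝ} {T : Set (Pt d)} {s A δ : ℝ} (hA : 0 ≤ A) (hδ0 : 0 ≤ δ) (hδ1 : δ ≤ 1)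
    (hG : ∀ j, HolderBdd T s A fun x => y j - G x j)
    (hG' : ∀ j, HolderBdd T s δ fun x => G x j - G' x j) :
    HolderBdd T s ((∑ j, ∑ k, |Γ⁻¹ j k|) * (2 * A + 1) * δ)
      fun x => potential Γ y G x - potential Γ y G' x := by
  have hyG' : ∀ j, HolderBdd T s (A + 1) fun x => y j - G' x j := fun j =>
    (((hG j).add (hG' j)).mono (by linarith)).congr fun x _ => by ring
  have hterm : ∀ j k, HolderBdd T s (|-(1 / 2) * Γ⁻¹ j k| * (2 * (δ * A) + 2 * ((A + 1) * δ)))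
      fun x => -(1 / 2) * Γ⁻¹ j k *
        ((G x j - G' x j) * (y k - G x k) + (y j - G' x j) * (G x k - G' x k)) := fun j k =>
    (((hG' j).mul hδ0 hA (hG k)).add ((hyG' j).mul (by linarith) hδ0 (hG' k))).const_mul _
  have hsum := HolderBdd.sum Finset.univ fun j _ => HolderBdd.sum Finset.univ fun k _ => hterm j k
  refine (hsum.mono (le_of_eq ?_)).congr fun x _ => (potential_sub_potential Γ y G G' x).symm
  simp only [Finset.sum_mul, abs_mul, abs_neg]
  refine Finset.sum_congr rfl fun j _ => Finset.sum_congr rfl fun k _ => ?_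
  rw [abs_of_pos (by norm_num : (0 : ℝ) < 1 / 2)]
  ring

theorem WeakDerivBdd.holderBdd {n : ℕ} {B s : ℝ} (hB : 0 ≤ B) (hs0 : 0 ≤ s) (hs1 : s ≤ 1)
    {f : Pt d → ℝ} (h : WeakDerivBdd n B f) (hf : ∀ x y, |f x - f y| ≤ d * B * ‖x - y‖) :
    HolderBdd (closedCube d) s (2 * ((d + 1) * (B + 1))) f := by
  obtain ⟨F, -, hFB, hfF⟩ := h.exists_smooth_approx hB (by positivity) hf one_pos
  set l : ℝ := (d + 1) * (B + 1)
  have hBl : B + 1 ≤ l := le_mul_of_one_le_left (by positivity) (by simp)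
  have hdBl : d * B ≤ 2 * 1 * l := by
    have : d * B ≤ (d + 1) * (B + 1) := by gcongr <;> simp
    linarith
  have hsup : ∀ x ∈ closedCube d, |f x| ≤ 1 * l := fun x hx => by
    have := abs_sub_abs_le_abs_sub (f x) (F x)
    rw [abs_sub_comm] at this
    linarith [hfF x hx, hFB.abs_le hx]
  convert holderBdd_of_lipschitz zero_le_one (by positivity) (le_refl l) hs0 hs1 hsup
    fun x _ y _ => (hf x y).trans (by gcongr) using 1
  rw [← Real.rpow_add (by positivity), sub_add_cancel, Real.rpow_one, mul_one]

theorem holderBdd_const {T : Set (Pt d)} {s b c : ℝ} (hc : |c| ≤ b) :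
    HolderBdd T s b fun _ => c := by
  refine ⟨fun _ _ => hc, fun x _ y _ => ?_⟩
  have := (abs_nonneg c).trans hc
  rw [sub_self, abs_zero]
  positivity

theorem exists_ae_emulator (d D n : ℕ) {s : ℝ} (hs0 : 0 ≤ s) (hs1 : s < 1) {B : ℝ} (hB : 0 ≤ B) :
    ∃ C > (0 : ℝ), ∃ K > (0 : ℕ), ∀ (a : ℕ) (G : Pt d → Fin D → ℝ),
      (∀ j, MemLp (fun θ => G θ j) ∞ (cubeMeasure d)) →
      (∀ j, WeakDerivBdd (n + 1) B fun θ => G θ j) →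
      ∃ (N : Net d D) (T : Set (Pt d)), (∀ᵐ x ∂(cubeMeasure d), x ∈ T) ∧
        (∀ j, HolderBdd T s (2 * ((d + 1) * (B + 1))) fun x => G x j) ∧
        (∀ j, HolderBdd T s (C * (1 / (2 ^ a : ℕ) : ℝ) ^ ((n : ℝ) + 1 - s))
          fun x => G x j - N.emulator x j) ∧
        N.depth ≤ K * (a + 1) ∧ N.numWeights ≤ K * ((2 ^ a) ^ d * (a + 1)) ∧
        N.numUnits ≤ K * ((2 ^ a) ^ d * (a + 1)) := by
  obtain ⟨C, hC, K, hK, hemulate⟩ := exists_emulator d D n hs0 hs1 hB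
  refine ⟨C, hC, K, hK, fun a G hG hGw => ?_⟩
  choose f hGf hlip using fun j =>
    ((hGw j).of_le (Nat.le_add_left 1 n)).exists_lipschitz hB (hG j)
  have hf : ∀ j, WeakDerivBdd (n + 1) B (f j) := fun j => (hGw j).congr (hGf j)
  obtain ⟨N, hN, hsize⟩ := hemulate a f hf hlip
  have hsub : {x | x ∈ cube d ∧ ∀ j, G x j = f j x} ⊆ closedCube d := fun x hx =>
    cube_subset_closedCube hx.1
  refine ⟨N, {x | x ∈ cube d ∧ ∀ j, G x j = f j x}, ?_, fun j => ?_, fun j => ?_, hsize⟩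
  · filter_upwards [ae_restrict_mem measurableSet_cube, Filter.eventually_all.2 hGf]
      with x hx hGfx
    exact ⟨hx, hGfx⟩
  · exact (((hf j).holderBdd hB hs0 hs1.le (hlip j)).subset hsub).congr fun x hx => (hx.2 j).symm
  · exact ((hN j).subset hsub).congr fun x hx => by rw [hx.2 j]

theorem exists_potential_emulator (d D n : ℕ) {s : ℝ} (hs0 : 0 ≤ s) (hs1 : s < 1)
    (Γ : Matrix (Fin D) (Fin D) ℝ) {B : ℝ} (hB : 0 ≤ B) :
    ∃ R : ℝ, ∃ K > (0 : ℕ), ∀ y : Fin D → ℝ, (∀ j, |y j| ≤ B) →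
      ∀ G : Pt d → Fin D → ℝ, (∀ j, MemLp (fun θ => G θ j) ∞ (cubeMeasure d)) →
      (∀ j, WeakDerivBdd (n + 1) B fun θ => G θ j) →
      ∀ ε ≤ (1 : ℝ), ∀ a : ℕ, R * (1 / (2 ^ a : ℕ) : ℝ) ^ ((n : ℝ) + 1 - s) ≤ ε →
      ∃ N : Net d D,
        slobodeckijNorm s (fun θ => potential Γ y G θ - potential Γ y N.emulator θ) ≤
          ENNReal.ofReal ε ∧
        N.depth ≤ K * (a + 1) ∧ N.numWeights ≤ K * ((2 ^ a) ^ d * (a + 1)) ∧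
        N.numUnits ≤ K * ((2 ^ a) ^ d * (a + 1)) := by
  obtain ⟨C, hC, K, hK, hemulate⟩ := exists_ae_emulator d D n hs0 hs1 hB
  let A := B + 2 * ((d + 1) * (B + 1))
  have hA : 0 ≤ A := by positivity
  let P := (∑ j, ∑ k, |Γ⁻¹ j k|) * (2 * A + 1)
  have hP : 0 ≤ P := by positivity
  refine ⟨C * (P + 1), K, hK, fun y hy G hG hGw ε hε1 a ha => ?_⟩
  obtain ⟨N, T, hT, hGT, hN, hsize⟩ := hemulate a G hG hGw
  set δ := C * (1 / (2 ^ a : ℕ) : ℝ) ^ ((n : ℝ) + 1 - s) with hδ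
  have hδ0 : 0 ≤ δ := by positivity
  have hPδ : (P + 1) * δ ≤ ε := by
    rw [hδ]
    linarith
  have hyG : ∀ j, HolderBdd T s A fun x => y j - G x j := fun j =>
    (((holderBdd_const (hy j)).add ((hGT j).const_mul (-1))).mono (by simp [A])).congr
      fun x _ => by ring
  refine ⟨N, slobodeckijNorm_le_of_holderBdd hT
    ((holderBdd_potential_sub Γ y hA hδ0 (by nlinarith) hyG hN).mono ?_), hsize⟩
  linarith [hPδ]

end PotentialEmulator

/-! ### The choice of the mesh size -/

section Mesh

theorem exists_le_two_pow_le {x : ℝ} (hx : 1 ≤ x) : ∃ a : ℕ, x ≤ 2 ^ a ∧ (2 : ℝ) ^ a ≤ 2 * x := by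
  obtain ⟨a, hle, hlt⟩ := exists_nat_pow_near hx one_lt_two
  exact ⟨a + 1, hlt.le, by rw [pow_succ']; gcongr⟩

theorem exists_mul_one_div_two_pow_rpow_le (R : ℝ) {p : ℝ} (hp : 0 < p) :
    ∃ c > (0 : ℝ), ∀ ε : ℝ, 0 < ε → ε ≤ 1 → ∃ a : ℕ,
      R * (1 / (2 ^ a : ℕ) : ℝ) ^ p ≤ ε ∧ (2 : ℝ) ^ a ≤ c * ε ^ (-(1 / p)) := by
  set Q : ℝ := max R 1
  have hQ : 1 ≤ Q := le_max_right _ _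
  refine ⟨2 * Q ^ (1 / p), by positivity, fun ε hε hε1 => ?_⟩
  obtain ⟨a, hlow, hupp⟩ := exists_le_two_pow_le (x := (Q / ε) ^ (1 / p))
    (Real.one_le_rpow ((one_le_div hε).2 (hε1.trans hQ)) (by positivity))
  refine ⟨a, ?_, ?_⟩
  · calc R * (1 / (2 ^ a : ℕ) : ℝ) ^ p ≤ Q * (1 / (Q / ε) ^ (1 / p)) ^ p := by
          push_cast
          gcongr
          exact le_max_left _ _
      _ = ε := by
          rw [one_div _, Real.inv_rpow (by positivity), ← Real.rpow_mul (by positivity),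
            one_div_mul_cancel hp.ne', Real.rpow_one]
          field_simp
  · rwa [Real.div_rpow (by positivity) hε.le, div_eq_mul_inv, ← Real.rpow_neg hε.le,
      ← mul_assoc] at hupp

theorem exists_add_one_le_mul_neg_log {c p : ℝ} (hc : 0 < c) (hp : 0 < p) :
    ∃ c' > (0 : ℝ), ∀ ε : ℝ, 0 < ε → ε ≤ 1 / 2 → ∀ a : ℕ, (2 : ℝ) ^ a ≤ c * ε ^ (-(1 / p)) →
      (a + 1 : ℝ) ≤ c' * -Real.log ε := by
  have hlog2 : 0 < Real.log 2 := Real.log_pos one_lt_two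
  refine ⟨(|Real.log c| / Real.log 2 + 1 / p + 1) / Real.log 2, by positivity,
    fun ε hε hε2 a ha => ?_⟩
  have hlogε : Real.log 2 ≤ -Real.log ε := by
    rw [← Real.log_inv]
    exact Real.log_le_log two_pos ((le_inv_comm₀ two_pos hε).2 (by linarith))
  have hlogc : Real.log c ≤ |Real.log c| / Real.log 2 * -Real.log ε :=
    calc Real.log c ≤ |Real.log c| / Real.log 2 * Real.log 2 := by
          rw [div_mul_cancel₀ _ hlog2.ne']
          exact le_abs_self _
      _ ≤ _ := by gcongr
  have hloga : a * Real.log 2 ≤ Real.log c + 1 / p * -Real.log ε := by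
    have := Real.log_le_log (by positivity) ha
    rw [Real.log_pow, Real.log_mul hc.ne' (by positivity), Real.log_rpow hε] at this
    linarith
  rw [div_mul_eq_mul_div, le_div_iff₀ hlog2]
  linarith

theorem exists_mesh (R : ℝ) (d : ℕ) {p q : ℝ} (hp : 0 < p) (hq : 1 ≤ q) :
    ∃ c > (0 : ℝ), ∀ ε : ℝ, 0 < ε → ε ≤ 1 / 2 → ∃ a : ℕ,
      R * (1 / (2 ^ a : ℕ) : ℝ) ^ p ≤ ε ∧ (a + 1 : ℝ) ≤ c * Real.log (ε ^ (-q)) ∧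
        ((2 ^ a) ^ d * (a + 1) : ℝ) ≤ c * ε ^ (-(d / p)) * Real.log (ε ^ (-q)) ^ 2 := by
  obtain ⟨c, hc, hmesh⟩ := exists_mul_one_div_two_pow_rpow_le R hp
  obtain ⟨c', hc', hlevel⟩ := exists_add_one_le_mul_neg_log hc hp
  refine ⟨c' + c ^ d * c' ^ 2, by positivity, fun ε hε hε2 => ?_⟩
  obtain ⟨a, haR, hac⟩ := hmesh ε hε (by linarith)
  have hlog : -Real.log ε ≤ Real.log (ε ^ (-q)) := by
    rw [Real.log_rpow hε]
    nlinarith [Real.log_nonpos hε.le (by linarith)]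
  have hlevel : (a + 1 : ℝ) ≤ c' * Real.log (ε ^ (-q)) := (hlevel ε hε hε2 a hac).trans (by gcongr)
  have hlog0 : 0 ≤ Real.log (ε ^ (-q)) :=
    (pos_of_mul_pos_right (a.cast_add_one_pos.trans_le hlevel) hc'.le).le
  have hpow : (c * ε ^ (-(1 / p))) ^ d = c ^ d * ε ^ (-(d / p)) := by
    rw [mul_pow, ← Real.rpow_mul_natCast hε.le]
    ring_nf
  refine ⟨a, haR, hlevel.trans ?_, ?_⟩
  · gcongr
    exact le_add_of_nonneg_right (by positivity)
  · calc ((2 ^ a) ^ d * (a + 1) : ℝ) ≤ (2 ^ a) ^ d * (a + 1) ^ 2 := by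
          gcongr
          exact le_self_pow₀ (by simp) two_ne_zero
      _ ≤ (c * ε ^ (-(1 / p))) ^ d * (c' * Real.log (ε ^ (-q))) ^ 2 := by gcongr
      _ = c ^ d * c' ^ 2 * ε ^ (-(d / p)) * Real.log (ε ^ (-q)) ^ 2 := by
          rw [hpow]
          ring
      _ ≤ _ := by
          gcongr
          exact le_add_of_nonneg_left hc'.le

end Mesh

/-! ### The Hellinger distance of posteriors -/

section Hellinger

variable {d D : ℕ}

theorem aemeasurable_potential (Γ : Matrix (Fin D) (Fin D) ℝ) (y : Fin D → ℝ)
    {G : Pt d → Fin D → ℝ} {μ : Measure (Pt d)} (hG : ∀ j, AEMeasurable (fun θ => G θ j) μ) :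
    AEMeasurable (potential Γ y G) μ := by
  have hcont : Continuous fun v : Fin D → ℝ => 1 / 2 * ((y - v) ⬝ᵥ (Γ⁻¹ *ᵥ (y - v))) := by
    fun_prop
  exact hcont.measurable.comp_aemeasurable (aemeasurable_pi_iff.2 hG)

theorem Net.continuous_emulator (N : Net d D) : Continuous N.emulator :=
  N.continuous_eval.comp (by fun_prop)

theorem quadForm_inv_nonneg {S : Matrix (Fin D) (Fin D) ℝ} (hS : S.PosDef) (v : Fin D → ℝ) :
    0 ≤ v ⬝ᵥ (S⁻¹ *ᵥ v) := by
  simpa using hS.inv.posSemidef.dotProduct_mulVec_nonneg v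

theorem potential_nonneg {Γ : Matrix (Fin D) (Fin D) ℝ} (hΓ : Γ.PosDef) (y : Fin D → ℝ)
    (G : Pt d → Fin D → ℝ) (θ : Pt d) : 0 ≤ potential Γ y G θ :=
  mul_nonneg (by norm_num) (quadForm_inv_nonneg hΓ _)

theorem ae_abs_le_of_slobodeckijNorm_le {s ε : ℝ} (hε : 0 ≤ ε) {e : Pt d → ℝ}
    (h : slobodeckijNorm s e ≤ ENNReal.ofReal ε) : ∀ᵐ θ ∂(cubeMeasure d), |e θ| ≤ ε := by
  have hsup : eLpNormEssSup e (cubeMeasure d) ≤ ENNReal.ofReal ε := by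
    rw [← eLpNorm_exponent_top]
    unfold slobodeckijNorm at h
    split_ifs at h
    · exact h
    · exact (le_max_left _ _).trans h
  filter_upwards [ae_le_eLpNormEssSup (f := e) (μ := cubeMeasure d)] with θ hθ
  have := hθ.trans hsup
  rwa [← ofReal_norm, ENNReal.ofReal_le_ofReal_iff hε] at this

theorem exp_sub_one_le {ε : ℝ} (hε : 0 ≤ ε) (hε2 : ε ≤ 1 / 2) : Real.exp ε - 1 ≤ 2 * ε := by
  have hexp : (1 - ε) * Real.exp ε ≤ 1 := by
    calc (1 - ε) * Real.exp ε ≤ Real.exp (-ε) * Real.exp ε := by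
          gcongr
          exact Real.one_sub_le_exp_neg ε
      _ = 1 := by rw [← Real.exp_add, neg_add_cancel, Real.exp_zero]
  nlinarith

theorem sq_sqrt_sub_sqrt_le {p q E : ℝ} (hp : 0 ≤ p) (hE : 1 ≤ E) (hqp : q ≤ E ^ 2 * p)
    (hpq : p ≤ E ^ 2 * q) : (√p - √q) ^ 2 ≤ (E - 1) ^ 2 * p := by
  have sqrt_le : ∀ {u v : ℝ}, u ≤ E ^ 2 * v → √u ≤ E * √v := fun h => by
    simpa only [Real.sqrt_mul (sq_nonneg E), Real.sqrt_sq (zero_le_one.trans hE)]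
      using Real.sqrt_le_sqrt h
  have habs : |√p - √q| ≤ (E - 1) * √p := by
    have hqp' := sqrt_le hqp
    have hpq' := sqrt_le hpq
    rw [abs_le]
    constructor <;> nlinarith [Real.sqrt_nonneg p, Real.sqrt_nonneg q]
  calc (√p - √q) ^ 2 = |√p - √q| ^ 2 := (sq_abs _).symm
    _ ≤ ((E - 1) * √p) ^ 2 := by gcongr
    _ = (E - 1) ^ 2 * p := by rw [mul_pow, Real.sq_sqrt hp]

variable {Φ Ψ π₀ : Pt d → ℝ}

theorem integrable_exp_neg_mul (hΦ : AEMeasurable Φ (cubeMeasure d)) (hΦ0 : ∀ θ, 0 ≤ Φ θ)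
    (hπ : Integrable π₀ (cubeMeasure d)) :
    Integrable (fun θ => Real.exp (-Φ θ) * π₀ θ) (cubeMeasure d) := by
  refine hπ.bdd_mul (c := 1) (Real.measurable_exp.comp_aemeasurable hΦ.neg).aestronglyMeasurable
    (ae_of_all _ fun θ => ?_)
  rw [Real.norm_eq_abs, Real.abs_exp]
  exact Real.exp_le_one_iff.2 (neg_nonpos.2 (hΦ0 θ))

theorem normalizer_pos (hπ0 : ∀ θ, 0 ≤ π₀ θ) (hmass : 0 < ∫ θ, π₀ θ ∂(cubeMeasure d))
    (hΦ : Integrable (fun θ => Real.exp (-Φ θ) * π₀ θ) (cubeMeasure d)) :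
    0 < normalizer Φ π₀ := by
  have hπ : Integrable π₀ (cubeMeasure d) := Integrable.of_integral_ne_zero hmass.ne'
  rw [integral_pos_iff_support_of_nonneg hπ0 hπ] at hmass
  rw [normalizer, integral_pos_iff_support_of_nonneg
    (fun θ => mul_nonneg (Real.exp_nonneg _) (hπ0 θ)) hΦ]
  convert hmass using 2
  ext θ
  simp [Real.exp_ne_zero]

theorem exp_neg_mul_le {ε : ℝ} {θ : Pt d} (hπ0 : 0 ≤ π₀ θ) (hθ : |Φ θ - Ψ θ| ≤ ε) :
    Real.exp (-Φ θ) * π₀ θ ≤ Real.exp ε * (Real.exp (-Ψ θ) * π₀ θ) := by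
  rw [← mul_assoc, ← Real.exp_add]
  gcongr
  linarith [(abs_le.1 hθ).1]

theorem normalizer_le {ε : ℝ} (hπ0 : ∀ θ, 0 ≤ π₀ θ)
    (hΦ : Integrable (fun θ => Real.exp (-Φ θ) * π₀ θ) (cubeMeasure d))
    (hΨ : Integrable (fun θ => Real.exp (-Ψ θ) * π₀ θ) (cubeMeasure d))
    (h : ∀ᵐ θ ∂(cubeMeasure d), |Φ θ - Ψ θ| ≤ ε) :
    normalizer Φ π₀ ≤ Real.exp ε * normalizer Ψ π₀ := by
  rw [normalizer, normalizer, ← integral_const_mul]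
  exact integral_mono_ae hΦ (hΨ.const_mul _) (h.mono fun θ hθ => exp_neg_mul_le (hπ0 θ) hθ)

theorem posterior_le {ε : ℝ} {θ : Pt d} (hπ0 : 0 ≤ π₀ θ) (hZΦ : 0 < normalizer Φ π₀)
    (hZΨ : 0 < normalizer Ψ π₀) (hZ : normalizer Ψ π₀ ≤ Real.exp ε * normalizer Φ π₀)
    (hθ : |Φ θ - Ψ θ| ≤ ε) : posterior Φ π₀ θ ≤ Real.exp ε ^ 2 * posterior Ψ π₀ θ := by
  have hinv : (normalizer Φ π₀)⁻¹ ≤ Real.exp ε * (normalizer Ψ π₀)⁻¹ := by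
    rwa [← div_eq_mul_inv, inv_eq_one_div, div_le_div_iff₀ hZΦ hZΨ, one_mul]
  calc posterior Φ π₀ θ ≤
        (Real.exp ε * (normalizer Ψ π₀)⁻¹) * (Real.exp ε * (Real.exp (-Ψ θ) * π₀ θ)) :=
        mul_le_mul hinv (exp_neg_mul_le hπ0 hθ) (by positivity) (by positivity)
    _ = Real.exp ε ^ 2 * posterior Ψ π₀ θ := by
        rw [posterior]
        ring

theorem posterior_nonneg (hπ0 : ∀ θ, 0 ≤ π₀ θ) (hZ : 0 < normalizer Φ π₀) (θ : Pt d) :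
    0 ≤ posterior Φ π₀ θ :=
  mul_nonneg (inv_nonneg.2 hZ.le) (mul_nonneg (Real.exp_nonneg _) (hπ0 θ))

theorem integral_posterior (hZ : 0 < normalizer Φ π₀) :
    ∫ θ, posterior Φ π₀ θ ∂(cubeMeasure d) = 1 := by
  simp only [posterior, integral_const_mul]
  exact inv_mul_cancel₀ hZ.ne'

theorem hellinger_le_of_sq_sqrt_sub_sqrt_le {f g : Pt d → ℝ} {b : ℝ} (hb : 0 ≤ b)
    (hf0 : ∀ θ, 0 ≤ f θ) (hf : ∫ θ, f θ ∂(cubeMeasure d) = 1)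
    (h : ∀ᵐ θ ∂(cubeMeasure d), (√(f θ) - √(g θ)) ^ 2 ≤ b ^ 2 * f θ) :
    hellinger f g ≤ ENNReal.ofReal b := by
  have hint : Integrable f (cubeMeasure d) := Integrable.of_integral_ne_zero (by simp [hf])
  have hlint : ∫⁻ θ, ENNReal.ofReal ((√(f θ) - √(g θ)) ^ 2) ∂(cubeMeasure d) ≤
      ENNReal.ofReal (b ^ 2) := by
    calc _ ≤ ∫⁻ θ, ENNReal.ofReal (b ^ 2 * f θ) ∂(cubeMeasure d) :=
          lintegral_mono_ae (h.mono fun θ hθ => ENNReal.ofReal_le_ofReal hθ)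
      _ = ENNReal.ofReal (b ^ 2) := by
          rw [← ofReal_integral_eq_lintegral_ofReal (hint.const_mul _)
            (ae_of_all _ fun θ => mul_nonneg (sq_nonneg b) (hf0 θ)), integral_const_mul, hf,
            mul_one]
  calc hellinger f g ≤ ENNReal.ofReal (b ^ 2) ^ (1 / 2 : ℝ) :=
        ENNReal.rpow_le_rpow
          ((mul_le_of_le_one_left' (ENNReal.inv_le_one.2 one_le_two)).trans hlint) (by norm_num)
    _ = ENNReal.ofReal b := by
        rw [ENNReal.ofReal_rpow_of_nonneg (sq_nonneg b) (by norm_num), ← Real.sqrt_eq_rpow,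
          Real.sqrt_sq hb]

theorem hellinger_posterior_le (hΦ : AEMeasurable Φ (cubeMeasure d))
    (hΨ : AEMeasurable Ψ (cubeMeasure d)) (hΦ0 : ∀ θ, 0 ≤ Φ θ) (hΨ0 : ∀ θ, 0 ≤ Ψ θ)
    (hπ0 : ∀ θ, 0 ≤ π₀ θ) (hmass : 0 < ∫ θ, π₀ θ ∂(cubeMeasure d)) {ε : ℝ} (hε : 0 ≤ ε)
    (hε2 : ε ≤ 1 / 2) (h : ∀ᵐ θ ∂(cubeMeasure d), |Φ θ - Ψ θ| ≤ ε) :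
    hellinger (posterior Φ π₀) (posterior Ψ π₀) ≤ ENNReal.ofReal (2 * ε) := by
  have hπ : Integrable π₀ (cubeMeasure d) := Integrable.of_integral_ne_zero hmass.ne'
  have hintΦ := integrable_exp_neg_mul hΦ hΦ0 hπ
  have hintΨ := integrable_exp_neg_mul hΨ hΨ0 hπ
  have hZΦ := normalizer_pos hπ0 hmass hintΦ
  have hZΨ := normalizer_pos hπ0 hmass hintΨ
  have hsymm : ∀ᵐ θ ∂(cubeMeasure d), |Ψ θ - Φ θ| ≤ ε := h.mono fun θ hθ => by
    rwa [abs_sub_comm]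
  have hpost := posterior_nonneg (Φ := Φ) hπ0 hZΦ
  refine hellinger_le_of_sq_sqrt_sub_sqrt_le (by positivity) hpost (integral_posterior hZΦ) ?_
  filter_upwards [h, hsymm] with θ hΦΨ hΨΦ
  calc (√(posterior Φ π₀ θ) - √(posterior Ψ π₀ θ)) ^ 2
      ≤ (Real.exp ε - 1) ^ 2 * posterior Φ π₀ θ :=
        sq_sqrt_sub_sqrt_le (hpost θ) (Real.one_le_exp hε)
          (posterior_le (hπ0 θ) hZΨ hZΦ (normalizer_le hπ0 hintΦ hintΨ h) hΨΦ)
          (posterior_le (hπ0 θ) hZΦ hZΨ (normalizer_le hπ0 hintΨ hintΦ hsymm) hΦΨ)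
    _ ≤ (2 * ε) ^ 2 * posterior Φ π₀ θ := by
        gcongr
        exacts [hpost θ, sub_nonneg.2 (Real.one_le_exp hε), exp_sub_one_le hε hε2]

theorem hellinger_posterior_potential_le {Γ : Matrix (Fin D) (Fin D) ℝ} (hΓ : Γ.PosDef)
    (y : Fin D → ℝ) {G : Pt d → Fin D → ℝ} (hG : ∀ j, AEMeasurable (fun θ => G θ j) (cubeMeasure d))
    (N : Net d D) {s ε : ℝ} (hε : 0 ≤ ε) (hε2 : ε ≤ 1 / 2)
    (hN : slobodeckijNorm s (fun θ => potential Γ y G θ - potential Γ y N.emulator θ) ≤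
      ENNReal.ofReal ε)
    (hπ0 : ∀ θ, 0 ≤ π₀ θ) (hmass : 0 < ∫ θ, π₀ θ ∂(cubeMeasure d)) :
    hellinger (posterior (potential Γ y G) π₀) (posterior (potential Γ y N.emulator) π₀) ≤
      ENNReal.ofReal (2 * ε) :=
  hellinger_posterior_le (aemeasurable_potential Γ y hG)
    (aemeasurable_potential Γ y fun j =>
      ((continuous_apply j).comp N.continuous_emulator).aemeasurable)
    (potential_nonneg hΓ y G) (potential_nonneg hΓ y N.emulator) hπ0 hmass hε hε2
    (ae_abs_le_of_slobodeckijNorm_le hε hN)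

end Hellinger

/-! ### Gaussian priors -/

section Gaussian

variable {d : ℕ}

theorem gaussianDensity_pos (m : Fin d → ℝ) {S : Matrix (Fin d) (Fin d) ℝ} (hS : S.PosDef)
    (θ : Pt d) : 0 < gaussianDensity m S θ := by
  have := hS.det_pos
  unfold gaussianDensity
  positivity

theorem gaussianDensity_le (m : Fin d → ℝ) {S : Matrix (Fin d) (Fin d) ℝ} (hS : S.PosDef)
    (θ : Pt d) : gaussianDensity m S θ ≤ (√((2 * Real.pi) ^ d * S.det))⁻¹ := by
  unfold gaussianDensity
  refine mul_le_of_le_one_right (by positivity) (Real.exp_le_one_iff.2 ?_)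
  linarith [quadForm_inv_nonneg hS fun i => θ i - m i]

theorem integrable_gaussianDensity (m : Fin d → ℝ) {S : Matrix (Fin d) (Fin d) ℝ}
    (hS : S.PosDef) : Integrable (gaussianDensity m S) (cubeMeasure d) := by
  have hcont : Continuous (gaussianDensity m S) := by
    unfold gaussianDensity
    fun_prop
  refine Integrable.of_bound (C := (√((2 * Real.pi) ^ d * S.det))⁻¹) hcont.aestronglyMeasurable
    (ae_of_all _ fun θ => ?_)
  rw [Real.norm_eq_abs, abs_of_pos (gaussianDensity_pos m hS θ)]
  exact gaussianDensity_le m hS θ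

theorem cubeMeasure_univ_pos (d : ℕ) : 0 < cubeMeasure d Set.univ := by
  rw [cubeMeasure, Measure.restrict_apply_univ]
  refine isOpen_cube.measure_pos volume ⟨WithLp.toLp 2 fun _ => 1 / 2, fun i => ?_⟩
  change 0 < (1 / 2 : ℝ) ∧ (1 / 2 : ℝ) < 1
  norm_num

theorem integral_gaussianDensity_pos (m : Fin d → ℝ) {S : Matrix (Fin d) (Fin d) ℝ}
    (hS : S.PosDef) : 0 < ∫ θ, gaussianDensity m S θ ∂(cubeMeasure d) := by
  rw [integral_pos_iff_support_of_nonneg (fun θ => (gaussianDensity_pos m hS θ).le)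
    (integrable_gaussianDensity m hS),
    Function.support_eq_univ fun θ => (gaussianDensity_pos m hS θ).ne']
  exact cubeMeasure_univ_pos d

end Gaussian

/-! ### Emulators whose size is measured by the accuracy -/

section Accuracy

theorem exists_net_slobodeckijNorm_potential_sub_le (d D : ℕ) {n : ℕ} (hn : 0 < n) {s : ℝ}
    (hs0 : 0 ≤ s) (hs1 : s < 1) (Γ : Matrix (Fin D) (Fin D) ℝ) {B : ℝ} (hB : 0 ≤ B) :
    ∃ c > (0 : ℝ), ∀ y : Fin D → ℝ, (∀ j, |y j| ≤ B) → ∀ G : Pt d → Fin D → ℝ,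
      (∀ j, MemSobolev n ∞ fun θ => G θ j) →
      (∀ j, sobolevNorm n (fun θ => G θ j) ≤ ENNReal.ofReal B) →
      ∀ ε : ℝ, 0 < ε → ε ≤ 1 / 2 → ∃ N : Net d D,
        slobodeckijNorm s (fun θ => potential Γ y G θ - potential Γ y N.emulator θ) ≤
          ENNReal.ofReal ε ∧
        (N.depth : ℝ) ≤ c * Real.log (ε ^ (-(n / (n - s) : ℝ))) ∧
        (N.numWeights : ℝ) ≤
          c * ε ^ (-(d / (n - s) : ℝ)) * Real.log (ε ^ (-(n / (n - s) : ℝ))) ^ 2 ∧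
        (N.numUnits : ℝ) ≤
          c * ε ^ (-(d / (n - s) : ℝ)) * Real.log (ε ^ (-(n / (n - s) : ℝ))) ^ 2 := by
  obtain ⟨k, rfl⟩ := Nat.exists_eq_add_one_of_ne_zero hn.ne'
  have hp : (0 : ℝ) < (k + 1 : ℕ) - s := sub_pos.2 (hs1.trans_le (by simp))
  have hq : (1 : ℝ) ≤ (k + 1 : ℕ) / ((k + 1 : ℕ) - s) := (one_le_div hp).2 (sub_le_self _ hs0)
  obtain ⟨R, K, hK, hemulate⟩ := exists_potential_emulator d D k hs0 hs1 Γ hB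
  obtain ⟨c, hc, hmesh⟩ := exists_mesh R d hp hq
  refine ⟨K * c, by positivity, fun y hy G hG hGB ε hε hε2 => ?_⟩
  obtain ⟨a, haR, hlevel, hsize⟩ := hmesh ε hε hε2
  obtain ⟨N, hN, hdepth, hweights, hunits⟩ := hemulate y hy G (fun j => (hG j).1)
    (fun j => weakDerivBdd_of_sobolevNorm_le hB (hG j) (hGB j)) ε (by linarith) a
    (by exact_mod_cast haR)
  have hsize' : ((K * ((2 ^ a) ^ d * (a + 1)) : ℕ) : ℝ) ≤
      K * c * ε ^ (-(d / ((k + 1 : ℕ) - s)) : ℝ) *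
        Real.log (ε ^ (-((k + 1 : ℕ) / ((k + 1 : ℕ) - s)) : ℝ)) ^ 2 := by
    rw [Nat.cast_mul, mul_assoc (K * c), mul_assoc (K : ℝ), ← mul_assoc c]
    exact mul_le_mul_of_nonneg_left (mod_cast hsize) K.cast_nonneg
  refine ⟨N, hN, ?_, (Nat.cast_le.2 hweights).trans hsize', (Nat.cast_le.2 hunits).trans hsize'⟩
  calc (N.depth : ℝ) ≤ K * (a + 1) := mod_cast hdepth
    _ ≤ K * (c * Real.log _) := by gcongr
    _ = K * c * Real.log _ := (mul_assoc _ _ _).symm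

end Accuracy

end Emulation

end

theorem theorem3_general (d D n : ℕ) (hn : 0 < n) (s : ℝ) (hs : 0 ≤ s) (hs1 : s < 1)
    (Γ : Matrix (Fin D) (Fin D) ℝ) (hΓ : Γ.PosDef) (B : ℝ) (hB : 0 ≤ B) :
    ∃ c > (0 : ℝ), ∃ C > (0 : ℝ),
      ∀ (y : Fin D → ℝ) (_ : ∀ j, |y j| ≤ B)
        (G : EuclideanSpace ℝ (Fin d) → Fin D → ℝ)
        (_ : ∀ j, Emulation.MemSobolev n ∞ (fun θ => G θ j))
        (_ : ∀ j, Emulation.sobolevNorm n (fun θ => G θ j) ≤ ENNReal.ofReal B)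
        (ε : ℝ) (_ : 0 < ε) (_ : ε < 1 / 2),
        (∃ N : Emulation.Net d D,
          Emulation.slobodeckijNorm s
            (fun θ => Emulation.potential Γ y G θ - Emulation.potential Γ y N.emulator θ)
              ≤ ENNReal.ofReal ε ∧
          (N.depth : ℝ) ≤ c * Real.log (ε ^ (-(n / (n - s) : ℝ))) ∧
          (N.numWeights : ℝ) ≤
            c * ε ^ (-(d / (n - s) : ℝ)) * Real.log (ε ^ (-(n / (n - s) : ℝ))) ^ 2 ∧
          (N.numUnits : ℝ) ≤
            c * ε ^ (-(d / (n - s) : ℝ)) * Real.log (ε ^ (-(n / (n - s) : ℝ))) ^ 2) ∧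
        (∀ N : Emulation.Net d D,
          Emulation.slobodeckijNorm s
            (fun θ => Emulation.potential Γ y G θ - Emulation.potential Γ y N.emulator θ)
              ≤ ENNReal.ofReal ε →
          ∀ π₀ : EuclideanSpace ℝ (Fin d) → ℝ, (∀ θ, 0 ≤ π₀ θ) →
            0 < ∫ θ, π₀ θ ∂Emulation.cubeMeasure d →
            Emulation.hellinger (Emulation.posterior (Emulation.potential Γ y G) π₀)
              (Emulation.posterior (Emulation.potential Γ y N.emulator) π₀) ≤
                ENNReal.ofReal (C * ε)) := by
  obtain ⟨c, hc, hemulate⟩ :=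
    Emulation.exists_net_slobodeckijNorm_potential_sub_le d D hn hs hs1 Γ hB
  refine ⟨c, hc, 2, two_pos, fun y hy G hG hGB ε hε hε2 =>
    ⟨hemulate y hy G hG hGB ε hε hε2.le, fun N hN π₀ hprior hmass => ?_⟩⟩
  exact Emulation.hellinger_posterior_potential_le hΓ y (fun j => (hG j).1.1.aemeasurable) N
    hε.le hε2.le hN hprior hmass

theorem theorem3 (d D n : ℕ) (hd : 0 < d) (hn : 0 < n) (s : ℝ) (hs : 0 ≤ s) (hs1 : s < 1)
    (Γ : Matrix (Fin D) (Fin D) ℝ) (hΓ : Γ.PosDef) (B : ℝ) (hB : 0 ≤ B) :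
    ∃ c > (0 : ℝ), ∃ C > (0 : ℝ),
      ∀ (y : Fin D → ℝ) (_ : ∀ j, |y j| ≤ B)
        (G : EuclideanSpace ℝ (Fin d) → Fin D → ℝ)
        (_ : ∀ j, Emulation.MemSobolev n ∞ (fun θ => G θ j))
        (_ : ∀ j, Emulation.sobolevNorm n (fun θ => G θ j) ≤ ENNReal.ofReal B)
        (ε : ℝ) (_ : 0 < ε) (_ : ε < 1 / 2),
        -- emulators of the claimed accuracy and size exist
        (∃ N : Emulation.Net d D,
          Emulation.slobodeckijNorm s
            (fun θ => Emulation.potential Γ y G θ - Emulation.potential Γ y N.emulator θ)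
              ≤ ENNReal.ofReal ε ∧
          (N.depth : ℝ) ≤ c * Real.log (ε ^ (-(n / (n - s) : ℝ))) ∧
          (N.numWeights : ℝ) ≤
            c * ε ^ (-(d / (n - s) : ℝ)) * Real.log (ε ^ (-(n / (n - s) : ℝ))) ^ 2 ∧
          (N.numUnits : ℝ) ≤
            c * ε ^ (-(d / (n - s) : ℝ)) * Real.log (ε ^ (-(n / (n - s) : ℝ))) ^ 2) ∧
        -- and each emulator of this accuracy gives a posterior within `C ε`, for every prior
        (∀ N : Emulation.Net d D,
          Emulation.slobodeckijNorm s
            (fun θ => Emulation.potential Γ y G θ - Emulation.potential Γ y N.emulator θ)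
              ≤ ENNReal.ofReal ε →
          ∀ (m : Fin d → ℝ) (S : Matrix (Fin d) (Fin d) ℝ), S.PosDef →
            Emulation.hellinger
              (Emulation.posterior (Emulation.potential Γ y G) (Emulation.gaussianDensity m S))
              (Emulation.posterior (Emulation.potential Γ y N.emulator)
                (Emulation.gaussianDensity m S)) ≤ ENNReal.ofReal (C * ε)) := by
  obtain ⟨c, hc, C, hC, h⟩ := theorem3_general d D n hn s hs hs1 Γ hΓ B hB
  exact ⟨c, hc, C, hC, fun y hy G hG hGB ε hε hε2 =>
    (h y hy G hG hGB ε hε hε2).imp_right fun hposterior N hN m S hS =>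
      hposterior N hN _ (fun θ => (Emulation.gaussianDensity_pos m hS θ).le)
        (Emulation.integral_gaussianDensity_pos m hS)⟩
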